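/- **Theorem 1.2.** Let $N\ge 1$, let $i,j$ range over $\mathbb Z/(2N+1)\mathbb Z$ as indices of $a_i,s_i$, and let $$K=\mathbb C\big(a_1,\dots,a_{2N},b,c,q^{1/(2N-1)}\big)(f_1,\dots,f_{2N})$$ be the field of rational functions in these independent variables. Put $a_0=q/(a_1\cdots a_{2N})$ and $\epsilon=q^{(2N+1)/(1-2N)}$, an integral power of $q^{1/(2N-1)}$. Transformations are $\mathbb C$-automorphisms of $K$, products are compositions, and $\varphi^\infty=1$ means that $\varphi^k\neq1$ for all $k\ge1$. Let $\lambda(l)=c$ for $l$ even and $\lambda(l)=c^{-1}$ for $l$ odd. *The transformations.* There are (unique) $\mathbb C$-automorphisms $s_1,\dots,s_{2N},w_1,\pi,\mu$ of $K$ as follows. On $q^{1/(2N-1)}$, $w_1$ acts by inversion and the others act trivially. For $1\le i\le 2N$, $s_i$ fixes $b,c$, and $s_i(a_i)=a_i^{-1}$, $s_i(a_{i\pm1})=a_ia_{i\pm1}$, and $s_i$ fixes the other $a_j$. On the variables $f_j$ ($1\le j\le 2N$), $$s_i(f_{i-1})=f_{i-1}\frac{\lambda(i-1)^2-a_i^{2N+1}f_i}{a_i^{2N+1}\lambda(i-1)^2-f_i},\qquad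 s_i(f_{i+1})=f_{i+1}\frac{a_i^{2N+1}\lambda(i-1)^2-f_i}{\lambda(i-1)^2-a_i^{2N+1}f_i},$$ whenever the index $i-1$, respectively $i+1$, lies in $\{1,\dots,2N\}$, and $s_i(f_j)=f_j$ for the other $j$. Next, $$w_1(a_j)=a_{2N+1-j}^{-1},\quad w_1(b)=q^{2N+1}b,\quad w_1(c)=c^{-1},\quad w_1(f_j)=f_{2N+1-j};$$ $$\pi(a_j)=a_{j+1},\quad \pi(b)=qb,\quad \pi(c)=c^{-1},\quad \pi(f_j)=f_{j+1}\ (1\le j\le 2N-1),$$ $$\pi(f_{2N})=-\frac{c^4}{\prod_{k=1}^Nf_{2k-1}}\left(\prod_{k=1}^Nf_{2k}+\frac{q^{2N}a_0b}{\big(\prod_{k=1}^{2N-1}a_k^{2N-k}\big)c}\right).$$ Finally $\mu(a_j)=a_j$, $\mu(b)=b$, $\mu(c)=\epsilon/c$, and $\mu(f_j)=g_j$ for $1\le j\le 2N$, where $g_1,\dots,g_{2N}\in K$ are determined by the following relations (in which no denominator vanishes): $$\left(1-\frac{f_1}{a_1^{2N+1}c^2}\right)\frac{f_1-\epsilon^{2N-3}c^{6-4N}g_1}{f_1-q^{2N+1}\epsilon^{2N-3}c^4g_1}+\sum_{k=1}^{N-1}\frac{\prod_{i=1}^kf_{2i-1}}{\big(\prod_{i=1}^{2k}a_i^{2N+1}\big)c^{4k}\prod_{i=1}^kf_{2i}}\left(1-\frac{f_{2k+1}}{a_{2k+1}^{2N+1}c^2}\right)$$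 $$\qquad+\frac{a_0^{2N+1}}{q^{2N+1}c^{4N}\prod_{i=1}^Nf_{2i}}\left(\frac{q^{2N}bc}{\prod_{i=0}^{2N-1}a_i^{2N-i}}+\prod_{i=1}^Nf_{2i-1}\right)=0,$$ $$\frac{g_{2l+3}\,(\epsilon^2f_{2l+1}-c^4g_{2l+1})(a_{2l+3}^{2N+1}c^2-f_{2l+3})}{f_{2l+2}\,(\epsilon^2f_{2l+3}-c^4g_{2l+3})(a_{2l+1}^{2N+1}c^2-f_{2l+1})}=\epsilon^2a_{2l+2}^{2N+1}a_{2l+3}^{2N+1}\qquad(0\le l\le N-2),$$ $$\frac{(c^2-\epsilon^2a_{2l+2}^{2N+1}g_{2l+2})(\epsilon^2a_{2l+1}^{2N+1}-c^2g_{2l+1})}{(1-a_{2l+2}^{2N+1}c^2f_{2l+2})(a_{2l+1}^{2N+1}c^2-f_{2l+1})}=\epsilon^2\qquad(0\le l\le N-1).$$ Put $s_0=\pi^{-1}s_1\pi$, $w_0=\pi^2w_1$, $r=\pi w_1$, $\mu_0=\pi^{-1}\mu\pi$, $\mu_1=\mu$. *The relations.* For all $i,j\in\mathbb Z/(2N+1)\mathbb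 Z$ and $k,l\in\{0,1\}$: $$s_i^2=(s_is_{i\pm1})^3=1,\quad (s_is_j)^2=1\ (j\ne i\pm1),\quad w_k^2=(w_0w_1)^\infty=1,$$ $$w_0s_i=s_{2N-i+3}w_0,\quad w_1s_i=s_{2N-i+1}w_1,\quad r^2=1,\quad rs_i=s_{2N-i+2}r,\quad rw_0=w_1r,\quad rw_1=w_0r,$$ $$\mu_k^2=(\mu_0\mu_1)^\infty=1,\quad \mu_ks_i=s_i\mu_k,\quad \mu_kw_l=w_l\mu_k,\quad r\mu_0=\mu_1r,\quad r\mu_1=\mu_0r.$$ *The group.* $\langle s_0,\dots,s_{2N}\rangle$ is a Coxeter group of affine type $A_{2N}^{(1)}$ with simple reflections $s_i$; $\langle w_0,w_1\rangle$ and $\langle\mu_0,\mu_1\rangle$ are Coxeter groups of affine type $A_1^{(1)}$ with simple reflections $w_k$ and $\mu_k$; $r\neq1$; and, as internal products of subgroups, $$G:=\langle s_0,\dots,s_{2N},w_0,w_1,\mu_0,\mu_1,r\rangle=\Big(\big(\langle s_0,\dots,s_{2N}\rangle\rtimes\langle w_0,w_1\rangle\big)\times\langle\mu_0,\mu_1\rangle\Big)\rtimes\langle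 r\rangle .$$ So $G$ is an extended affine Weyl group of type $(A_{2N}\rtimes A_1)^{(1)}\times A_1^{(1)}$. Moreover $\mu_0\mu_1$ maps $c$ to $\epsilon^2c$ and fixes all $a_i$, $b$ and $q$. *The $q$-difference system.* The $2N$-th order system $q\mathrm P^{(2N)}(A_4^{(1)})$ is obtained from the action of $G$: the element $T=\pi^{-2N-1}\in G$ satisfies $T(a_i)=a_i$, $T(b)=pb$, $T(c)=c^{-1}$, $T(q)=q$ with $p=q^{-2N-1}$, and $F_i=f_i$, $\overline F_i=T(f_i)$ satisfy, with nonzero denominators, $$\frac{a_i^{2N+1}(\overline F_iF_i-1)}{a_i^{2N+1}-c^{2(-1)^i}F_i}=\begin{cases}\dfrac{\overline F_{i+1}F_{i+1}-1}{1-a_{i+1}^{2N+1}c^{2(-1)^i}\overline F_{i+1}}&(1\le i\le 2N-1),\\[3ex]\dfrac{\big(\prod_{k=1}^{2N}a_k^k\big)bc}{\prod_{k=1}^NF_{2k-1}}&(i=2N).\end{cases}$$ -/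

import Mathlib

noncomputable section

namespace QPA4

/-- Names of the independent variables: `a_i` for the nonzero `i` in `ℤ/(2N+1)ℤ`, `b`, `c`,
a variable `t` standing for `q^(1/(2N-1))`, and `f_j` for `1 ≤ j ≤ 2N`. -/
inductive Var (N : ℕ) : Type
  | a (i : {i : ZMod (2 * N + 1) // i ≠ 0}) : Var N
  | b : Var N
  | c : Var N
  | t : Var N
  | f (j : {j : ℕ // 1 ≤ j ∧ j ≤ 2 * N}) : Var N

/-- The field `ℂ(a_1, …, a_{2N}, b, c, q^(1/(2N-1)), f_1, …, f_{2N})` of rational functions. -/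
abbrev K (N : ℕ) : Type := FractionRing (MvPolynomial (Var N) ℂ)

/-- The group of `ℂ`-automorphisms of the rational function field, i.e. of birational
transformations; the product is composition, `(φ * ψ) x = φ (ψ x)`. -/
abbrev Bir (N : ℕ) : Type := K N ≃ₐ[ℂ] K N

/-- A variable, as an element of the field. -/
def var {N : ℕ} (v : Var N) : K N :=
  algebraMap (MvPolynomial (Var N) ℂ) (K N) (MvPolynomial.X v)

/-- `t = q^(1/(2N-1))`. -/
def t (N : ℕ) : K N := var Var.t

/-- The parameter `b`. -/
def b (N : ℕ) : K N := var Var.b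

/-- The parameter `c`. -/
def c (N : ℕ) : K N := var Var.c

/-- `q = t^(2N-1)`, for `N ≥ 1`. -/
def q (N : ℕ) : K N := t N ^ (2 * N - 1)

/-- `ε = q^((2N+1)/(1-2N)) = t^(-(2N+1))`. -/
def eps (N : ℕ) : K N := t N ^ (-(2 * (N : ℤ) + 1))

/-- The parameters `a_i`, `i ∈ ℤ/(2N+1)ℤ`; `a_0` is given by `a_0 a_1 ⋯ a_{2N} = q`. -/
def a (N : ℕ) (i : ZMod (2 * N + 1)) : K N :=
  if h : i = 0 then q N / ∏ k : {k : ZMod (2 * N + 1) // k ≠ 0}, var (Var.a k)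
  else var (Var.a ⟨i, h⟩)

/-- The variables `f_1, …, f_{2N}` (the value at other indices is never used). -/
def f (N : ℕ) (j : ℕ) : K N :=
  if h : 1 ≤ j ∧ j ≤ 2 * N then var (Var.f ⟨j, h⟩) else 1

/-- `λ(l)`: this is `c` for even `l` and `1/c` for odd `l`. -/
def lam (N : ℕ) (l : ℕ) : K N := if Even l then c N else (c N)⁻¹

/-- `φ` is the transformation `s_i`, where `1 ≤ i ≤ 2N`. -/
structure IsS (N i : ℕ) (φ : Bir N) : Prop where
  map_t : φ (t N) = t N
  map_b : φ (b N) = b N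
  map_c : φ (c N) = c N
  map_a : ∀ j : ZMod (2 * N + 1), φ (a N j) =
    if j = i then (a N i)⁻¹
    else if j = i + 1 ∨ j = i - 1 then a N i * a N j
    else a N j
  map_f : ∀ j : ℕ, 1 ≤ j → j ≤ 2 * N → φ (f N j) =
    if j + 1 = i then
      f N j * ((lam N (i - 1) ^ 2 - a N i ^ (2 * N + 1) * f N i) /
        (a N i ^ (2 * N + 1) * lam N (i - 1) ^ 2 - f N i))
    else if j = i + 1 then
      f N j * ((a N i ^ (2 * N + 1) * lam N (i - 1) ^ 2 - f N i) /
        (lam N (i - 1) ^ 2 - a N i ^ (2 * N + 1) * f N i))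
    else f N j

/-- `φ` is the transformation `w_1`. -/
structure IsW1 (N : ℕ) (φ : Bir N) : Prop where
  map_t : φ (t N) = (t N)⁻¹
  map_b : φ (b N) = q N ^ (2 * N + 1) * b N
  map_c : φ (c N) = (c N)⁻¹
  map_a : ∀ j : ZMod (2 * N + 1), φ (a N j) = (a N (((2 * N + 1 : ℕ) : ZMod (2 * N + 1)) - j))⁻¹
  map_f : ∀ j : ℕ, 1 ≤ j → j ≤ 2 * N → φ (f N j) = f N (2 * N + 1 - j)

/-- `φ` is the transformation `π`. -/
structure IsPi (N : ℕ) (φ : Bir N) : Prop where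
  map_t : φ (t N) = t N
  map_b : φ (b N) = q N * b N
  map_c : φ (c N) = (c N)⁻¹
  map_a : ∀ j : ZMod (2 * N + 1), φ (a N j) = a N (j + 1)
  map_f : ∀ j : ℕ, 1 ≤ j → j ≤ 2 * N - 1 → φ (f N j) = f N (j + 1)
  map_f_last : φ (f N (2 * N)) =
    -(c N ^ 4 / ∏ k ∈ Finset.Icc 1 N, f N (2 * k - 1)) *
      ((∏ k ∈ Finset.Icc 1 N, f N (2 * k)) +
        q N ^ (2 * N) * a N 0 * b N /
          ((∏ k ∈ Finset.Icc 1 (2 * N - 1), a N k ^ (2 * N - k)) * c N))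

/-- The relations that determine rational functions `g_1, …, g_{2N}` of `f_1, …, f_{2N}` (and of
the parameters), together with the non-vanishing of all their denominators. -/
structure GRelations (N : ℕ) (g : ℕ → K N) : Prop where
  den_one : f N 1 - q N ^ (2 * N + 1) * eps N ^ (2 * (N : ℤ) - 3) * c N ^ 4 * g 1 ≠ 0
  rel_one :
    (1 - f N 1 / (a N 1 ^ (2 * N + 1) * c N ^ 2)) *
        ((f N 1 - eps N ^ (2 * (N : ℤ) - 3) * c N ^ (6 - 4 * (N : ℤ)) * g 1) /
          (f N 1 - q N ^ (2 * N + 1) * eps N ^ (2 * (N : ℤ) - 3) * c N ^ 4 * g 1))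
      + ∑ k ∈ Finset.Icc 1 (N - 1),
          (∏ i ∈ Finset.Icc 1 k, f N (2 * i - 1)) /
            ((∏ i ∈ Finset.Icc 1 (2 * k), a N i ^ (2 * N + 1)) * c N ^ (4 * k) *
              ∏ i ∈ Finset.Icc 1 k, f N (2 * i)) *
          (1 - f N (2 * k + 1) / (a N ((2 * k + 1 : ℕ) : ZMod (2 * N + 1)) ^ (2 * N + 1) * c N ^ 2))
      + a N 0 ^ (2 * N + 1) /
          (q N ^ (2 * N + 1) * c N ^ (4 * N) * ∏ i ∈ Finset.Icc 1 N, f N (2 * i)) *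
          (q N ^ (2 * N) * b N * c N / (∏ i ∈ Finset.range (2 * N), a N i ^ (2 * N - i))
            + ∏ i ∈ Finset.Icc 1 N, f N (2 * i - 1)) = 0
  den_odd : ∀ l : ℕ, l + 2 ≤ N →
    f N (2 * l + 2) * (eps N ^ 2 * f N (2 * l + 3) - c N ^ 4 * g (2 * l + 3)) *
      (a N ((2 * l + 1 : ℕ) : ZMod (2 * N + 1)) ^ (2 * N + 1) * c N ^ 2 - f N (2 * l + 1)) ≠ 0
  rel_odd : ∀ l : ℕ, l + 2 ≤ N →
    (g (2 * l + 3) * (eps N ^ 2 * f N (2 * l + 1) - c N ^ 4 * g (2 * l + 1)) *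
      (a N ((2 * l + 3 : ℕ) : ZMod (2 * N + 1)) ^ (2 * N + 1) * c N ^ 2 - f N (2 * l + 3))) /
    (f N (2 * l + 2) * (eps N ^ 2 * f N (2 * l + 3) - c N ^ 4 * g (2 * l + 3)) *
      (a N ((2 * l + 1 : ℕ) : ZMod (2 * N + 1)) ^ (2 * N + 1) * c N ^ 2 - f N (2 * l + 1)))
    = eps N ^ 2 * a N ((2 * l + 2 : ℕ) : ZMod (2 * N + 1)) ^ (2 * N + 1) *
        a N ((2 * l + 3 : ℕ) : ZMod (2 * N + 1)) ^ (2 * N + 1)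
  den_even : ∀ l : ℕ, l < N →
    (1 - a N ((2 * l + 2 : ℕ) : ZMod (2 * N + 1)) ^ (2 * N + 1) * c N ^ 2 * f N (2 * l + 2)) *
      (a N ((2 * l + 1 : ℕ) : ZMod (2 * N + 1)) ^ (2 * N + 1) * c N ^ 2 - f N (2 * l + 1)) ≠ 0
  rel_even : ∀ l : ℕ, l < N →
    ((c N ^ 2 - eps N ^ 2 * a N ((2 * l + 2 : ℕ) : ZMod (2 * N + 1)) ^ (2 * N + 1) *
          g (2 * l + 2)) *
      (eps N ^ 2 * a N ((2 * l + 1 : ℕ) : ZMod (2 * N + 1)) ^ (2 * N + 1) -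
          c N ^ 2 * g (2 * l + 1))) /
    ((1 - a N ((2 * l + 2 : ℕ) : ZMod (2 * N + 1)) ^ (2 * N + 1) * c N ^ 2 * f N (2 * l + 2)) *
      (a N ((2 * l + 1 : ℕ) : ZMod (2 * N + 1)) ^ (2 * N + 1) * c N ^ 2 - f N (2 * l + 1)))
    = eps N ^ 2

/-- `φ` is the transformation `μ`; it maps `f_j` to `g_j`. -/
structure IsMu (N : ℕ) (φ : Bir N) : Prop where
  map_t : φ (t N) = t N
  map_b : φ (b N) = b N
  map_c : φ (c N) = eps N / c N
  map_a : ∀ j : ZMod (2 * N + 1), φ (a N j) = a N j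
  map_f : GRelations N fun j => φ (f N j)

/-- One time step `F ↦ F'` of the `2N`-th order `q`-difference system `qP^{(2N)}(A_4^{(1)})` with
parameters `a_1, …, a_{2N}, c` at the time `b`, all denominators being nonzero. The accompanying
evolution of the parameters is `a_i' = a_i`, `b' = p b`, `c' = 1/c`. -/
structure QPStep (N : ℕ) {E : Type*} [Field E] (a : ℕ → E) (b c : E) (F F' : ℕ → E) : Prop where
  den_left : ∀ i : ℕ, 1 ≤ i → i ≤ 2 * N →
    a i ^ (2 * N + 1) - c ^ (2 * (-1 : ℤ) ^ i) * F i ≠ 0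
  den_right : ∀ i : ℕ, 1 ≤ i → i ≤ 2 * N - 1 →
    1 - a (i + 1) ^ (2 * N + 1) * c ^ (2 * (-1 : ℤ) ^ i) * F' (i + 1) ≠ 0
  den_last : ∏ k ∈ Finset.Icc 1 N, F (2 * k - 1) ≠ 0
  eq_of_lt : ∀ i : ℕ, 1 ≤ i → i ≤ 2 * N - 1 →
    a i ^ (2 * N + 1) * (F' i * F i - 1) /
        (a i ^ (2 * N + 1) - c ^ (2 * (-1 : ℤ) ^ i) * F i)
      = (F' (i + 1) * F (i + 1) - 1) /
        (1 - a (i + 1) ^ (2 * N + 1) * c ^ (2 * (-1 : ℤ) ^ i) * F' (i + 1))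
  eq_last :
    a (2 * N) ^ (2 * N + 1) * (F' (2 * N) * F (2 * N) - 1) /
        (a (2 * N) ^ (2 * N + 1) - c ^ (2 * (-1 : ℤ) ^ (2 * N)) * F (2 * N))
      = (∏ k ∈ Finset.Icc 1 (2 * N), a k ^ k) * b * c / ∏ k ∈ Finset.Icc 1 N, F (2 * k - 1)

/-- The Coxeter matrix of type `A_{n-1}^{(1)}`, `n ≥ 3`: a cycle with `n` nodes. -/
def affineA (n : ℕ) : CoxeterMatrix (ZMod n) where
  M := Matrix.of fun i j => if i = j then 1 else if j = i + 1 ∨ i = j + 1 then 3 else 2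
  isSymm := by
    ext i j
    simp only [Matrix.transpose_apply, Matrix.of_apply, eq_comm (a := j) (b := i),
      or_comm (a := i = j + 1)]
  diagonal := by simp
  off_diagonal := by
    intro i j h
    simp only [Matrix.of_apply, h, if_false]
    split_ifs <;> simp

/-- The Coxeter matrix of type `A_1^{(1)}`: two nodes joined by an edge with label `∞`
(encoded as `0`). -/
def affineA1 : CoxeterMatrix (Fin 2) where
  M := !![1, 0; 0, 1]
  isSymm := by
    ext i j
    fin_cases i <;> fin_cases j <;> rfl
  diagonal := by
    intro i
    fin_cases i <;> rfl
  off_diagonal := by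
    intro i j h
    fin_cases i <;> fin_cases j <;> simp_all

/-- The elements `s i` generate a group of which they are the simple reflections of a Coxeter
system with Coxeter matrix `M`. -/
def IsCoxeterGroup {G B : Type*} [Group G] (M : CoxeterMatrix B) (s : B → G) : Prop :=
  ∃ cs : CoxeterSystem M (Subgroup.closure (Set.range s)), ∀ i, (cs.simple i : G) = s i

/-- `L` is the internal semidirect product `H ⋊ U` of its subgroups `H` (normal) and `U`. -/
def IsSemidirect {G : Type*} [Group G] (H U L : Subgroup G) : Prop :=
  L = H ⊔ U ∧ H ⊓ U = ⊥ ∧ ∀ u ∈ U, ∀ h ∈ H, u * h * u⁻¹ ∈ H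

/-- `L` is the internal direct product `H × U` of its subgroups `H` and `U`. -/
def IsDirect {G : Type*} [Group G] (H U L : Subgroup G) : Prop :=
  L = H ⊔ U ∧ H ⊓ U = ⊥ ∧ ∀ u ∈ U, ∀ h ∈ H, u * h = h * u

end QPA4

end

noncomputable section

namespace QPA4

/-! ### Automorphisms of the rational function field from generating families. -/

section Generation

open scoped IntermediateField.algebraAdjoinAdjoin

/-! Existence of the transformations costs only a generation check. The field has finite
transcendence degree, so any generating family indexed by the variables is again a transcendence
basis (`exists_bir`, `exists_bir_of_generate`). One prescribes images and recovers the old variables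
rationally from them. Non-vanishing statements are proved by rescaling automorphisms: an expression
that is not homogeneous for such a scaling cannot be zero.

Dividing f_j by λ(j-1)^2 gives variables x_j on which s_i acts without c: x_{i-1} is multiplied by
(1 - A_i x_i)/(A_i - x_i) and x_{i+1} by the inverse, with A_i = a_i^{2N+1}. Put x_{2N+1} = π x_{2N}
and x_{2N+2} = π² x_{2N}. The local rule of the reflections persists on this longer sequence, as far
as it is needed (`Refl.map_xx_last`, `Refl.map_xx_last_one`, `Refl.map_xx_last'_one`), so π
conjugates s_i to s_{i+1}. Each relation among the s_i is therefore verified at one position, the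
braid relation for s_1 and s_2 being the only substantial one, and carried around the cycle.

The implicit transformation μ is made explicit by a chain. Let ρ_j be x_j/A_j for j odd and 1/(A_j
x_j) for j even, E_j = ρ_1⋯ρ_j, and let θ_j be the alternating partial sums of the E_i, shifted by
the constant θ_0 for which θ_{2N+2} = κ θ_1. Then μ multiplies x_j by (θ_{j-1}/θ_{j+1})^{±1}. The
defining relations become a triangular system which this formula solves uniquely
(`normalRelations_muX`, `NormalRelations.unique`, `gRelations_iff`). Telescoping gives μ(θ_j) = -θ_0
θ_1/θ_j, whence μ² = 1. Commutation is also read off from θ: s_2 moves only θ_2, w_1 reverses the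
sequence up to a common factor, and π² shifts it by two up to a common factor. Because 2 is
invertible modulo 2N+1, conjugation by π² spreads commutation with s_2 to every s_i.

For the group structure, the a_i behave as exponentiated simple roots. A length argument and a
grading in which all a_i have positive degree make the action of the Coxeter group on them faithful
(`eq_one_of_map_root_eq`, `a_mul_ne_one`). The remaining factors are separated by t and b: the s_i
and μ_k fix both, w_1 inverts t, and π multiplies b by q; a parity count of the exponent of q
excludes r.

The q-difference system is a single identity for x_1, x_{2N+1}, x_{2N+2} and π^{-1} x_1
(`IsShift.symm_mul_xx_last_eq`), translated by powers of π^{-1}; its evaluation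
`IsShift.symm_mul_xx_last` gives the last equation. -/

instance (N : ℕ) : Finite (Var N) := by
  have : Finite {j : ℕ // 1 ≤ j ∧ j ≤ 2 * N} :=
    Set.Finite.to_subtype ((Set.finite_Icc 1 (2 * N)).subset fun j hj => hj)
  let g : ({i : ZMod (2 * N + 1) // i ≠ 0} ⊕ {j : ℕ // 1 ≤ j ∧ j ≤ 2 * N}) ⊕ Fin 3 → Var N
    | .inl (.inl i) => .a i
    | .inl (.inr j) => .f j
    | .inr 0 => .b
    | .inr 1 => .c
    | .inr 2 => .t
  refine Finite.of_surjective g ?_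
  rintro (i | _ | _ | _ | j)
  exacts [⟨.inl (.inl i), rfl⟩, ⟨.inr 0, rfl⟩, ⟨.inr 1, rfl⟩, ⟨.inr 2, rfl⟩, ⟨.inl (.inr j), rfl⟩]

theorem isTranscendenceBasis_var (N : ℕ) : IsTranscendenceBasis ℂ (var : Var N → K N) := by
  have : Algebra.IsAlgebraic (MvPolynomial (Var N) ℂ) (K N) :=
    IsLocalization.isAlgebraic _ (nonZeroDivisors (MvPolynomial (Var N) ℂ))
  exact (IsTranscendenceBasis.mvPolynomial (Var N) ℂ).algebraMap_comp

theorem adjoin_range_var (N : ℕ) : IntermediateField.adjoin ℂ (Set.range (var : Var N → K N)) = ⊤ := by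
  rw [eq_top_iff]
  rintro x -
  obtain ⟨p, r, hr, rfl⟩ := IsFractionRing.div_surjective (A := MvPolynomial (Var N) ℂ) x
  have key : ∀ p : MvPolynomial (Var N) ℂ, algebraMap _ (K N) p ∈
      IntermediateField.adjoin ℂ (Set.range (var : Var N → K N)) := by
    intro p
    induction p using MvPolynomial.induction_on with
    | C z =>
      have : algebraMap (MvPolynomial (Var N) ℂ) (K N) (MvPolynomial.C z) = algebraMap ℂ (K N) z := by
        rw [IsScalarTower.algebraMap_apply ℂ (MvPolynomial (Var N) ℂ) (K N)]; rfl
      rw [this]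
      exact IntermediateField.algebraMap_mem _ z
    | add p r hp hr => rw [map_add]; exact add_mem hp hr
    | mul_X p v hp =>
      rw [map_mul]
      exact mul_mem hp (IntermediateField.subset_adjoin _ _ ⟨v, rfl⟩)
  exact div_mem (key p) (key r)

/-- Any family of generators of the rational function field that is indexed by the variables is
the image of the variables under an automorphism. -/
theorem exists_bir {N : ℕ} (y : Var N → K N)
    (h : ∀ v, var v ∈ IntermediateField.adjoin ℂ (Set.range y)) :
    ∃ φ : Bir N, ∀ v, φ (var v) = y v := by
  have htop : IntermediateField.adjoin ℂ (Set.range y) = ⊤ := by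
    rw [eq_top_iff, ← adjoin_range_var, IntermediateField.adjoin_le_iff]
    rintro _ ⟨v, rfl⟩
    exact h v
  have halg : Algebra.IsAlgebraic (Algebra.adjoin ℂ (Set.range y)) (K N) := by
    refine ⟨fun z => ?_⟩
    have hz : z ∈ IntermediateField.adjoin ℂ (Set.range y) := htop ▸ IntermediateField.mem_top
    have h1 : IsAlgebraic (Algebra.adjoin ℂ (Set.range y))
        (⟨z, hz⟩ : IntermediateField.adjoin ℂ (Set.range y)) :=
      Algebra.IsAlgebraic.isAlgebraic _
    exact h1.algebraMap (A := K N)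
  -- The field is algebraic over the subalgebra generated by y, and y has no more members than the
  -- transcendence degree, so algebraic independence is automatic.
  have hy : IsTranscendenceBasis ℂ y :=
    Algebra.IsAlgebraic.isTranscendenceBasis_of_le_trdeg_of_finite ℂ y
      (isTranscendenceBasis_var N).cardinalMk_eq_trdeg.le
  let e := hy.1.aevalEquivField
  let e' : IntermediateField.adjoin ℂ (Set.range y) ≃ₐ[ℂ] K N :=
    (IntermediateField.equivOfEq htop).trans IntermediateField.topEquiv
  refine ⟨e.trans e', fun v => ?_⟩
  have : ((e (var v) : IntermediateField.adjoin ℂ (Set.range y)) : K N) = y v := by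
    simp [e, var]
  exact this

theorem bir_ext_var {N : ℕ} {φ ψ : Bir N} (h : ∀ v, φ (var v) = ψ (var v)) : φ = ψ := by
  refine AlgEquiv.ext fun x => ?_
  have hx : x ∈ IntermediateField.adjoin ℂ (Set.range (var : Var N → K N)) :=
    adjoin_range_var N ▸ IntermediateField.mem_top
  induction hx using IntermediateField.adjoin_induction with
  | mem x hx => obtain ⟨v, rfl⟩ := hx; exact h v
  | algebraMap z => simp
  | add x y _ _ hx hy => simp [hx, hy]
  | inv x _ hx => simp [hx]
  | mul x y _ _ hx hy => simp [hx, hy]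

theorem exists_scaling {N : ℕ} (z : Var N → ℂ) (hz : ∀ v, z v ≠ 0) :
    ∃ φ : Bir N, ∀ v, φ (var v) = algebraMap ℂ (K N) (z v) * var v := by
  refine exists_bir _ fun v => ?_
  have h1 := IntermediateField.subset_adjoin ℂ
    (Set.range fun v : Var N => algebraMap ℂ (K N) (z v) * var v) ⟨v, rfl⟩
  have h2 := mul_mem (IntermediateField.algebraMap_mem
    (IntermediateField.adjoin ℂ (Set.range fun v : Var N => algebraMap ℂ (K N) (z v) * var v))
      (z v)⁻¹) h1
  have h0 : algebraMap ℂ (K N) (z v) ≠ 0 := by simpa using hz v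
  simpa [← mul_assoc, h0] using h2

theorem var_ne_zero {N : ℕ} (v : Var N) : (var v : K N) ≠ 0 :=
  (isTranscendenceBasis_var N).1.ne_zero v

end Generation

/-! ### Faithfulness criteria for Coxeter groups. -/

section CoxeterGroups

variable {B : Type*} {M : CoxeterMatrix B}

/-- The image of the lift is the subgroup generated by the `s i`, so an injective lift transports
the tautological Coxeter system to it. -/
theorem isCoxeterGroup_of_injective {G : Type*} [Group G] (s : B → G) (h : M.IsLiftable s)
    (hinj : Function.Injective (M.toCoxeterSystem.lift ⟨s, h⟩)) : IsCoxeterGroup M s := by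
  set Φ := M.toCoxeterSystem.lift ⟨s, h⟩
  have hs : ∀ i, Φ (M.toCoxeterSystem.simple i) = s i := M.toCoxeterSystem.lift_apply_simple h
  have hrange : Φ.range = Subgroup.closure (Set.range s) := by
    rw [MonoidHom.range_eq_map, ← M.toCoxeterSystem.subgroup_closure_range_simple,
      MonoidHom.map_closure, ← Set.range_comp]
    congr 1
    exact congrArg Set.range (funext hs)
  let e : M.Group ≃* Subgroup.closure (Set.range s) :=
    (MonoidHom.ofInjective hinj).trans (MulEquiv.subgroupCongr hrange)
  refine ⟨M.toCoxeterSystem.map e, fun i => ?_⟩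
  exact hs i

variable {W : Type*} [Group W] (cs : CoxeterSystem M W)
  {k F : Type*} [Field k] [Field F] [Algebra k F] (ρ : W →* (F ≃ₐ[k] F)) (α : B → F)

/-- In a simply laced Coxeter group acting on "exponentiated simple roots" `α i`, an element `w`
with `ℓ w < ℓ (w s_i)` maps `α i` to a product of simple roots. -/
theorem map_root_mem_closure (hM : ∀ i j, i ≠ j → M i j = 2 ∨ M i j = 3)
    (h2 : ∀ i j, M i j = 2 → ρ (cs.simple i) (α j) = α j)
    (h3 : ∀ i j, M i j = 3 → ρ (cs.simple i) (α j) = α i * α j) :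
    ∀ (n : ℕ) (w : W) (i : B), cs.length w = n → ¬ cs.IsRightDescent w i →
      ρ w (α i) ∈ Submonoid.closure (Set.range α) := by
  intro n
  induction n using Nat.strong_induction_on with
  | _ n ih =>
  intro w i hn hi
  have hi' := (cs.not_isRightDescent_iff).1 hi
  by_cases hw : w = 1
  · subst hw
    simpa using Submonoid.subset_closure (Set.mem_range_self i)
  obtain ⟨j, hj⟩ := cs.exists_rightDescent_of_ne_one hw
  have hij : i ≠ j := by rintro rfl; exact hi hj
  have hj' := (cs.isRightDescent_iff).1 hj
  set v := w * cs.simple j with hv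
  have hwv : w = v * cs.simple j := by rw [hv, mul_assoc, cs.simple_mul_simple_self, mul_one]
  have hvj : ¬ cs.IsRightDescent v j := by
    rw [cs.not_isRightDescent_iff, ← hwv]; exact hj'.symm
  have ihv := ih (cs.length v) (by omega) v
  -- Rank-two reduction. If v has no descent at i either, then s_j α_i is a product of α_i and α_j,
  -- to which induction applies with v. Otherwise v = u s_i: the commuting case contradicts the
  -- lengths, and in the braid case w(α_i) = u(α_j), with u shorter by two.
  by_cases hvi : cs.IsRightDescent v i
  · have hvi' := (cs.isRightDescent_iff).1 hvi
    set u := v * cs.simple i with hu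
    have hvu : v = u * cs.simple i := by rw [hu, mul_assoc, cs.simple_mul_simple_self, mul_one]
    rcases hM i j hij with h | h
    · exfalso
      have hcomm : cs.simple i * cs.simple j * cs.simple i = cs.simple j := by
        have := cs.simple_mul_simple_pow i j
        rw [h, pow_two] at this
        calc cs.simple i * cs.simple j * cs.simple i
            = (cs.simple i * cs.simple j * (cs.simple i * cs.simple j)) * cs.simple j := by
              simp [mul_assoc]
          _ = cs.simple j := by rw [this, one_mul]
      have : w * cs.simple i = u * cs.simple j := by
        rw [hwv, hvu, mul_assoc, mul_assoc, ← mul_assoc (cs.simple i), hcomm]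
      have h1 := cs.length_mul_le u (cs.simple j)
      rw [cs.length_simple, ← this] at h1
      omega
    · have hbraid : cs.simple i * cs.simple j * cs.simple i =
          cs.simple j * cs.simple i * cs.simple j := by
        have := cs.simple_mul_simple_pow i j
        rw [h, pow_succ, pow_two] at this
        rw [← mul_inv_eq_one]
        simpa [mul_assoc] using this
      have hroot : ρ w (α i) = ρ u (α j) := by
        have h3' := h3 j i (by rw [M.symmetric]; exact h)
        have h3'' := h3 i j h
        have hself : ρ (cs.simple i) (ρ (cs.simple i) (α j)) = α j := by
          rw [← AlgEquiv.mul_apply, ← map_mul, cs.simple_mul_simple_self, map_one]; rfl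
        rw [hwv, hvu, map_mul, map_mul, AlgEquiv.mul_apply, AlgEquiv.mul_apply, h3', mul_comm,
          ← h3'', hself]
      rw [hroot]
      refine ih (cs.length u) (by omega) u j rfl ?_
      intro huj
      have huj' := (cs.isRightDescent_iff).1 huj
      have : w * cs.simple i = u * cs.simple j * (cs.simple i * cs.simple j) := by
        rw [hwv, hvu]
        calc u * cs.simple i * cs.simple j * cs.simple i
            = u * (cs.simple i * cs.simple j * cs.simple i) := by simp only [mul_assoc]
          _ = _ := by rw [hbraid]; simp only [mul_assoc]
      have h1 := cs.length_mul_le (u * cs.simple j) (cs.simple i * cs.simple j)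
      have h2 := cs.length_mul_le (cs.simple i) (cs.simple j)
      rw [cs.length_simple, cs.length_simple] at h2
      rw [← this] at h1
      omega
  · have m1 := ihv i rfl hvi
    have m2 := ihv j rfl hvj
    rw [hwv, map_mul, AlgEquiv.mul_apply]
    rcases hM j i hij.symm with h | h
    · rwa [h2 j i h]
    · rw [h3 j i h, map_mul]
      exact mul_mem m2 m1

/-- A nontrivial w has a right descent i, and then w s_i sends α_i to a product of simple roots. If
w fixes α_i, this product is α_i⁻¹, which `hα` excludes. -/
theorem eq_one_of_map_root_eq (hM : ∀ i j, i ≠ j → M i j = 2 ∨ M i j = 3)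
    (h1 : ∀ i, ρ (cs.simple i) (α i) = (α i)⁻¹)
    (h2 : ∀ i j, M i j = 2 → ρ (cs.simple i) (α j) = α j)
    (h3 : ∀ i j, M i j = 3 → ρ (cs.simple i) (α j) = α i * α j)
    (hα0 : ∀ i, α i ≠ 0) (hα : ∀ i, ∀ x ∈ Submonoid.closure (Set.range α), α i * x ≠ 1)
    (w : W) (hw : ∀ i, ρ w (α i) = α i) : w = 1 := by
  by_contra hne
  obtain ⟨i, hi⟩ := cs.exists_rightDescent_of_ne_one hne
  have hi' := (cs.isRightDescent_iff_not_isRightDescent_mul).1 hi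
  have hmem := map_root_mem_closure cs ρ α hM h2 h3 _ _ i rfl hi'
  rw [map_mul, AlgEquiv.mul_apply, h1, map_inv₀, hw] at hmem
  exact hα i _ hmem (mul_inv_cancel₀ (hα0 i))

theorem affineA1_apply_ne {i j : Fin 2} (h : i ≠ j) : affineA1 i j = 0 := by
  fin_cases i <;> fin_cases j <;> first | rfl | simp_all

/-- Two involutions whose product has infinite order generate an infinite dihedral group. -/
theorem isCoxeterGroup_affineA1 {G : Type*} [Group G] (s : Fin 2 → G) (hs : ∀ i, s i ^ 2 = 1)
    (hinf : ∀ n : ℕ, 0 < n → (s 0 * s 1) ^ n ≠ 1) : IsCoxeterGroup affineA1 s := by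
  have hlift : affineA1.IsLiftable s := by
    intro i j
    by_cases h : i = j
    · subst h
      rw [affineA1.diagonal, pow_one, ← pow_two, hs]
    · rw [affineA1_apply_ne h, pow_zero]
  refine isCoxeterGroup_of_injective s hlift ?_
  rw [injective_iff_map_eq_one]
  set cs := affineA1.toCoxeterSystem
  set Φ := cs.lift ⟨s, hlift⟩
  have hΦ : ∀ i, Φ (cs.simple i) = s i := cs.lift_apply_simple hlift
  set d := cs.simple 0 * cs.simple 1 with hd
  have hinv0 : cs.simple 0 * cs.simple 0 = 1 := cs.simple_mul_simple_self 0
  have hinv1 : cs.simple 1 * cs.simple 1 = 1 := cs.simple_mul_simple_self 1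
  have hconj : ∀ n : ℤ, cs.simple 0 * d ^ n = d ^ (-n) * cs.simple 0 := by
    intro n
    have h : cs.simple 0 * d * (cs.simple 0)⁻¹ = d⁻¹ := by
      rw [cs.inv_simple, hd, mul_inv_rev, cs.inv_simple, cs.inv_simple, ← mul_assoc, hinv0, one_mul]
    have := conj_zpow (a := cs.simple 0) (b := d) (i := n)
    rw [h, inv_zpow'] at this
    rw [this, cs.inv_simple, mul_assoc, hinv0, mul_one]
  -- Normal form in the infinite dihedral group: rotations d^n and reflections d^n s_0.
  have hform : ∀ w, (∃ n : ℤ, w = d ^ n) ∨ ∃ n : ℤ, w = d ^ n * cs.simple 0 := by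
    intro w
    have h1d : cs.simple 1 = d⁻¹ * cs.simple 0 := by
      rw [hd, mul_inv_rev, cs.inv_simple, cs.inv_simple, mul_assoc, hinv0, mul_one]
    induction w using cs.simple_induction_left with
    | one => exact .inl ⟨0, by simp⟩
    | mul_simple_left w i hw =>
      have key : (∃ n : ℤ, cs.simple 0 * w = d ^ n) ∨
          ∃ n : ℤ, cs.simple 0 * w = d ^ n * cs.simple 0 := by
        rcases hw with ⟨n, rfl⟩ | ⟨n, rfl⟩
        · exact .inr ⟨-n, hconj n⟩
        · exact .inl ⟨-n, by rw [← mul_assoc, hconj, mul_assoc, hinv0, mul_one]⟩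
      fin_cases i
      · exact key
      · change (∃ n : ℤ, cs.simple 1 * w = d ^ n) ∨
          ∃ n : ℤ, cs.simple 1 * w = d ^ n * cs.simple 0
        rw [h1d]
        rcases key with ⟨n, h⟩ | ⟨n, h⟩
        · exact .inl ⟨-1 + n, by rw [mul_assoc, h, zpow_add, zpow_neg_one]⟩
        · exact .inr ⟨-1 + n, by rw [mul_assoc, h, zpow_add, zpow_neg_one, mul_assoc]⟩
  have hzpow : ∀ n : ℤ, (s 0 * s 1) ^ n = 1 → n = 0 := by
    intro n h
    by_contra hn
    refine hinf n.natAbs (by omega) ?_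
    rcases Int.natAbs_eq n with h' | h' <;> rw [h'] at h
    · simpa using h
    · simpa using h
  intro w hw
  rcases hform w with ⟨n, rfl⟩ | ⟨n, rfl⟩
  · rw [map_zpow, hd, map_mul, hΦ, hΦ] at hw
    rw [hzpow n hw, zpow_zero]
  · exfalso
    rw [map_mul, map_zpow, hd, map_mul, hΦ, hΦ] at hw
    -- A reflection in the kernel would make `s 0` a power of the product; its square is 1, so n = 0
    -- and `s 0 = 1`. The product is then the involution `s 1`, of finite order.
    have h0 : s 0 = (s 0 * s 1) ^ (-n) := by
      rw [zpow_neg, eq_inv_iff_mul_eq_one]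
      rw [mul_eq_one_iff_eq_inv] at hw ⊢
      rw [hw, inv_inv]
    have h1 : (s 0 * s 1) ^ (-n * 2) = 1 := by
      rw [zpow_mul, ← h0]; exact_mod_cast hs 0
    have h2 := hzpow _ h1
    have hn : n = 0 := by omega
    rw [hn, neg_zero, zpow_zero] at h0
    refine hinf 2 two_pos ?_
    rw [h0, one_mul]
    exact hs 1

end CoxeterGroups

/-! ### Products, conjugation and commutation of generated subgroups. -/

section Subgroups

variable {G : Type*} [Group G]

theorem mem_sup_of_conj {H U : Subgroup G} (h : ∀ u ∈ U, ∀ x ∈ H, u * x * u⁻¹ ∈ H) {x : G}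
    (hx : x ∈ H ⊔ U) : ∃ y ∈ H, ∃ u ∈ U, y * u = x := by
  have hle : U ≤ Subgroup.normalizer (H : Set G) := by
    intro u hu
    rw [Subgroup.mem_normalizer_iff]
    refine fun x => ⟨h u hu x, fun hx => ?_⟩
    have := h u⁻¹ (inv_mem hu) _ hx
    simpa [mul_assoc] using this
  have := Subgroup.coe_mul_of_right_le_normalizer_left H U hle
  have hx' : x ∈ ((H ⊔ U : Subgroup G) : Set G) := hx
  rw [this] at hx'
  exact hx'

/-- Self-inverse generators in A make a separate check of conjugation by inverses unnecessary. -/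
theorem conj_mem_closure {A S : Set G} (hA : ∀ u ∈ A, u⁻¹ = u)
    (h : ∀ u ∈ A, ∀ x ∈ S, u * x * u⁻¹ ∈ Subgroup.closure S) :
    ∀ u ∈ Subgroup.closure A, ∀ x ∈ Subgroup.closure S, u * x * u⁻¹ ∈ Subgroup.closure S := by
  have hgen : ∀ u ∈ A, ∀ x ∈ Subgroup.closure S, u * x * u⁻¹ ∈ Subgroup.closure S := by
    intro u hu x hx
    have : (Subgroup.closure S).map (MulAut.conj u).toMonoidHom ≤ Subgroup.closure S := by
      rw [MonoidHom.map_closure, Subgroup.closure_le]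
      rintro _ ⟨y, hy, rfl⟩
      exact h u hu y hy
    exact this ⟨x, hx, rfl⟩
  intro u hu
  induction hu using Subgroup.closure_induction'' with
  | mem u hu => exact hgen u hu
  | inv_mem u hu => rw [hA u hu]; exact hgen u hu
  | one => intro x hx; simpa using hx
  | mul u v _ _ hu hv =>
    intro x hx
    have := hu _ (hv x hx)
    simpa [mul_assoc] using this

theorem commute_closure {A S : Set G} (h : ∀ u ∈ A, ∀ x ∈ S, u * x = x * u) :
    ∀ u ∈ Subgroup.closure A, ∀ x ∈ Subgroup.closure S, u * x = x * u := by
  have h1 : ∀ u ∈ A, ∀ x ∈ Subgroup.closure S, u * x = x * u := by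
    intro u hu x hx
    have : Subgroup.closure S ≤ Subgroup.centralizer {u} := by
      rw [Subgroup.closure_le]
      intro y hy
      rw [SetLike.mem_coe, Subgroup.mem_centralizer_singleton_iff]
      exact (h u hu y hy).symm
    exact (Subgroup.mem_centralizer_singleton_iff.1 (this hx)).symm
  intro u hu x hx
  have : Subgroup.closure A ≤ Subgroup.centralizer {x} := by
    rw [Subgroup.closure_le]
    intro y hy
    rw [SetLike.mem_coe, Subgroup.mem_centralizer_singleton_iff]
    exact h1 y hy x hx
  exact Subgroup.mem_centralizer_singleton_iff.1 (this hu)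

end Subgroups

/-! ### Normalized variables that remove c from the reflections. -/

section Coordinates

variable {N : ℕ}

/-- `a_i ^ (2N+1)`, with a natural number as index. -/
def A (N i : ℕ) : K N := a N (i : ZMod (2 * N + 1)) ^ (2 * N + 1)

/-- The normalized variables `f_m / λ(m-1)^2`. -/
def x (N m : ℕ) : K N := f N m / lam N (m - 1) ^ 2

theorem t_ne_zero : t N ≠ 0 := var_ne_zero _
theorem b_ne_zero : b N ≠ 0 := var_ne_zero _
theorem c_ne_zero : c N ≠ 0 := var_ne_zero _
theorem q_ne_zero : q N ≠ 0 := pow_ne_zero _ t_ne_zero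
theorem eps_ne_zero : eps N ≠ 0 := zpow_ne_zero _ t_ne_zero

theorem a_ne_zero (i : ZMod (2 * N + 1)) : a N i ≠ 0 := by
  unfold a
  split_ifs
  · exact div_ne_zero q_ne_zero (Finset.prod_ne_zero_iff.2 fun _ _ => var_ne_zero _)
  · exact var_ne_zero _

theorem f_ne_zero (j : ℕ) : f N j ≠ 0 := by
  unfold f
  split_ifs
  · exact var_ne_zero _
  · exact one_ne_zero

theorem lam_ne_zero (l : ℕ) : lam N l ≠ 0 := by
  unfold lam
  split_ifs
  · exact c_ne_zero
  · exact inv_ne_zero c_ne_zero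

theorem A_ne_zero (i : ℕ) : A N i ≠ 0 := pow_ne_zero _ (a_ne_zero _)

theorem x_ne_zero (m : ℕ) : x N m ≠ 0 := div_ne_zero (f_ne_zero m) (pow_ne_zero _ (lam_ne_zero _))

theorem f_eq (m : ℕ) : f N m = x N m * lam N (m - 1) ^ 2 := by
  rw [x, div_mul_cancel₀ _ (pow_ne_zero _ (lam_ne_zero _))]

theorem f_odd (l : ℕ) : f N (2 * l + 1) = x N (2 * l + 1) * c N ^ 2 := by
  rw [f_eq, lam, if_pos (by simp)]

theorem f_even (l : ℕ) : f N (2 * l + 2) = x N (2 * l + 2) / c N ^ 2 := by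
  rw [f_eq, lam, if_neg (by simp), inv_pow, div_eq_mul_inv]

theorem a_eq_var {i : ZMod (2 * N + 1)} (h : i ≠ 0) : a N i = var (Var.a ⟨i, h⟩) := dif_neg h

theorem a_zero_eq : a N 0 = q N / ∏ k : {k : ZMod (2 * N + 1) // k ≠ 0}, a N k := by
  conv_lhs => rw [a, dif_pos rfl]
  congr 1
  exact Finset.prod_congr rfl fun k _ => (a_eq_var k.2).symm

theorem prod_a : ∏ i : ZMod (2 * N + 1), a N i = q N := by
  rw [Fintype.prod_eq_mul_prod_compl 0, a_zero_eq]
  have : ∏ k ∈ ({0}ᶜ : Finset (ZMod (2 * N + 1))), a N k =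
      ∏ k : {k : ZMod (2 * N + 1) // k ≠ 0}, a N k := by
    refine (Finset.prod_subtype _ (fun k => by simp) _)
  rw [this, div_mul_cancel₀]
  exact Finset.prod_ne_zero_iff.2 fun _ _ => a_ne_zero _

theorem prod_zmod {R : Type*} [CommMonoid R] (n : ℕ) (F : ZMod (n + 1) → R) :
    ∏ i, F i = ∏ k ∈ Finset.range (n + 1), F (k : ZMod (n + 1)) := by
  rw [← Fin.prod_univ_eq_prod_range (fun k => F (k : ZMod (n + 1)))]
  refine Finset.prod_congr rfl fun i _ => ?_
  congr 1
  exact (ZMod.natCast_zmod_val (n := n + 1) i).symm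

/-- The value at `f_j` that corresponds to the value `y j` at `x_j` when `c` is mapped to `c'`. -/
def rescale {E : Type*} [Field E] (c' : E) (y : ℕ → E) (j : ℕ) : E :=
  y j * (if Even (j - 1) then c' else c'⁻¹) ^ 2

theorem map_lam (φ : Bir N) (l : ℕ) :
    φ (lam N l) = if Even l then φ (c N) else (φ (c N))⁻¹ := by
  unfold lam
  split_ifs
  · rfl
  · rw [map_inv₀]

theorem map_f_eq (φ : Bir N) (j : ℕ) : φ (f N j) = rescale (φ (c N)) (fun j => φ (x N j)) j := by
  rw [f_eq, map_mul, map_pow, map_lam, rescale]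

/-- An automorphism with prescribed values at the parameters and at the normalized variables. -/
theorem exists_bir_of_generate (t' b' c' : K N) (a' : ZMod (2 * N + 1) → K N) (x' : ℕ → K N)
    (hc : c' ≠ 0) (h0 : a' 0 = t' ^ (2 * N - 1) / ∏ k : {k : ZMod (2 * N + 1) // k ≠ 0}, a' k)
    (h : ∀ L : IntermediateField ℂ (K N), t' ∈ L → b' ∈ L → c' ∈ L → (∀ i, a' i ∈ L) →
      (∀ j, 1 ≤ j → j ≤ 2 * N → x' j ∈ L) →
      t N ∈ L ∧ b N ∈ L ∧ c N ∈ L ∧ (∀ i, a N i ∈ L) ∧ ∀ j, 1 ≤ j → j ≤ 2 * N → x N j ∈ L) :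
    ∃ φ : Bir N, φ (t N) = t' ∧ φ (b N) = b' ∧ φ (c N) = c' ∧ (∀ i, φ (a N i) = a' i) ∧
      ∀ j, 1 ≤ j → j ≤ 2 * N → φ (x N j) = x' j := by
  let y : Var N → K N
    | .a i => a' i
    | .b => b'
    | .c => c'
    | .t => t'
    | .f j => rescale c' x' j
  obtain ⟨φ, hφ⟩ := exists_bir y (by
    set L := IntermediateField.adjoin ℂ (Set.range y)
    have hy : ∀ v, y v ∈ L := fun v => IntermediateField.subset_adjoin _ _ ⟨v, rfl⟩
    have hlam : ∀ j : ℕ, ∀ d ∈ L, (if Even (j - 1) then d else d⁻¹) ∈ L := by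
      intro j d hd
      split_ifs
      exacts [hd, inv_mem hd]
    have ha : ∀ i, a' i ∈ L := by
      intro i
      by_cases hi : i = 0
      · subst hi
        rw [h0]
        exact div_mem (pow_mem (hy .t) _) (prod_mem fun k _ => hy (.a k))
      · exact hy (.a ⟨i, hi⟩)
    obtain ⟨ht, hb, hc', ha', hx⟩ := h L (hy .t) (hy .b) (hy .c) ha fun j h1 h2 => by
      have := div_mem (hy (.f ⟨j, h1, h2⟩)) (pow_mem (hlam j _ (hy .c)) 2)
      have hne : (if Even (j - 1) then c' else c'⁻¹) ^ 2 ≠ 0 := by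
        split_ifs <;> simp [hc]
      have h3 : y (.f ⟨j, h1, h2⟩) = x' j * (if Even (j - 1) then c' else c'⁻¹) ^ 2 := rfl
      rwa [h3, mul_div_cancel_right₀ _ hne] at this
    rintro (i | _ | _ | _ | ⟨j, h1, h2⟩)
    · rw [← a_eq_var i.2]; exact ha' _
    · exact hb
    · exact hc'
    · exact ht
    · have : f N j ∈ L := by
        rw [f_eq]
        exact mul_mem (hx j h1 h2) (pow_mem (hlam j _ hc') 2)
      rwa [f, dif_pos ⟨h1, h2⟩] at this)
  have ht : φ (t N) = t' := hφ _
  have hcc : φ (c N) = c' := hφ _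
  have ha : ∀ i, i ≠ 0 → φ (a N i) = a' i := fun i hi => by rw [a_eq_var hi]; exact hφ _
  refine ⟨φ, ht, hφ _, hcc, fun i => ?_, fun j h1 h2 => ?_⟩
  · by_cases hi : i = 0
    · subst hi
      rw [a_zero_eq, h0, map_div₀, q, map_pow, ht, map_prod]
      congr 1
      exact Finset.prod_congr rfl fun k _ => ha k k.2
    · exact ha i hi
  · have h3 : φ (f N j) = rescale c' x' j := by
      rw [f, dif_pos ⟨h1, h2⟩]; exact hφ _
    rw [x, map_div₀, map_pow, map_lam, h3, hcc, rescale, mul_div_assoc, div_self, mul_one]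
    split_ifs <;> simp [hc]

theorem bir_ext {φ ψ : Bir N} (ht : φ (t N) = ψ (t N)) (hb : φ (b N) = ψ (b N))
    (hc : φ (c N) = ψ (c N)) (ha : ∀ i, φ (a N i) = ψ (a N i))
    (hx : ∀ j, 1 ≤ j → j ≤ 2 * N → φ (x N j) = ψ (x N j)) : φ = ψ := by
  refine bir_ext_var ?_
  rintro (i | _ | _ | _ | ⟨j, h1, h2⟩)
  · rw [← a_eq_var i.2]; exact ha _
  · exact hb
  · exact hc
  · exact ht
  · have : φ (f N j) = ψ (f N j) := by
      rw [map_f_eq, map_f_eq, hc, rescale, rescale, hx j h1 h2]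
    rwa [f, dif_pos ⟨h1, h2⟩] at this

end Coordinates

/-! ### Rescaling automorphisms and the non-vanishing they detect. -/

section Scaling

variable {N : ℕ}

/-- Rescaling `b` by a factor `2`. -/
theorem exists_scaling_b (N : ℕ) : ∃ φ : Bir N, φ (t N) = t N ∧ φ (b N) = 2 * b N ∧ φ (c N) = c N ∧
    (∀ i, φ (a N i) = a N i) ∧ ∀ j, 1 ≤ j → j ≤ 2 * N → φ (x N j) = x N j := by
  refine exists_bir_of_generate _ _ _ _ _ c_ne_zero a_zero_eq fun L ht hb hc ha hx =>
    ⟨ht, ?_, hc, ha, hx⟩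
  have := mul_mem (inv_mem (natCast_mem L 2)) hb
  simpa using this

theorem exists_scaling_c (N : ℕ) : ∃ φ : Bir N, φ (t N) = t N ∧ φ (b N) = b N ∧ φ (c N) = 2 * c N ∧
    (∀ i, φ (a N i) = a N i) ∧ ∀ j, 1 ≤ j → j ≤ 2 * N → φ (x N j) = x N j := by
  refine exists_bir_of_generate _ _ _ _ _ (mul_ne_zero two_ne_zero c_ne_zero) a_zero_eq
    fun L ht hb hc ha hx => ⟨ht, hb, ?_, ha, hx⟩
  have := mul_mem (inv_mem (natCast_mem L 2)) hc
  simpa using this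

theorem exists_scaling_x (N : ℕ) : ∃ φ : Bir N, φ (t N) = t N ∧ φ (b N) = b N ∧ φ (c N) = c N ∧
    (∀ i, φ (a N i) = a N i) ∧ ∀ j, 1 ≤ j → j ≤ 2 * N → φ (x N j) = 2 * x N j := by
  refine exists_bir_of_generate _ _ _ _ _ c_ne_zero a_zero_eq
    fun L ht hb hc ha hx => ⟨ht, hb, hc, ha, fun j h1 h2 => ?_⟩
  have := mul_mem (inv_mem (natCast_mem L 2)) (hx j h1 h2)
  simpa using this

/-- The parameters `a_i` all have positive degree for a suitable grading. -/
theorem exists_scaling_a (hN : 1 ≤ N) : ∃ (φ : Bir N) (e : ZMod (2 * N + 1) → ℕ),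
    ∀ i, 0 < e i ∧ φ (a N i) = 2 ^ e i * a N i := by
  obtain ⟨φ, hφ⟩ := exists_scaling (N := N)
    (fun v => match v with
      | .a _ => 2
      -- With this weight q has weight (2N+1)(2N-1), which exceeds the total weight 2N of a_1, …,
      -- a_{2N}; hence a_0 = q/(a_1⋯a_{2N}) also has positive weight.
      | .t => 2 ^ (2 * N + 1)
      | _ => 1) (by rintro (_ | _ | _ | _ | _) <;> simp)
  have h1 : ∀ i, i ≠ 0 → φ (a N i) = 2 * a N i := fun i hi => by
    rw [a_eq_var hi, hφ]; exact congrArg (· * _) (map_ofNat _ 2)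
  have ht : φ (t N) = 2 ^ (2 * N + 1) * t N := by
    rw [t, hφ]; exact congrArg (· * _) ((map_pow _ _ _).trans (congrArg (· ^ _) (map_ofNat _ 2)))
  have hq : φ (q N) = 2 ^ ((2 * N + 1) * (2 * N - 1)) * q N := by
    rw [q, map_pow, ht, mul_pow, pow_mul]
  have hlt : 2 * N < (2 * N + 1) * (2 * N - 1) := by
    obtain ⟨k, rfl⟩ : ∃ k, N = k + 1 := ⟨N - 1, by omega⟩
    have : 2 * (k + 1) - 1 = 2 * k + 1 := by omega
    rw [this]; nlinarith
  have hcard : Fintype.card {k : ZMod (2 * N + 1) // k ≠ 0} = 2 * N := by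
    rw [Fintype.card_subtype_compl, Fintype.card_subtype_eq, ZMod.card, Nat.add_sub_cancel]
  have h0 : φ (a N 0) = 2 ^ ((2 * N + 1) * (2 * N - 1) - 2 * N) * a N 0 := by
    rw [a_zero_eq, map_div₀, hq, map_prod, Finset.prod_congr rfl fun k _ => h1 _ k.2,
      Finset.prod_mul_distrib, Finset.prod_const, Finset.card_univ, hcard]
    rw [pow_sub₀ _ two_ne_zero hlt.le]
    have := Finset.prod_ne_zero_iff.2 fun (k : {k : ZMod (2 * N + 1) // k ≠ 0})
      (_ : k ∈ Finset.univ) => a_ne_zero (N := N) k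
    field_simp
  refine ⟨φ, fun i => if i = 0 then (2 * N + 1) * (2 * N - 1) - 2 * N else 1, fun i => ?_⟩
  by_cases hi : i = 0
  · subst hi
    simp only [if_true]
    exact ⟨by omega, h0⟩
  · simp only [if_neg hi, pow_one]
    exact ⟨one_pos, h1 i hi⟩

/-- Every such product has positive weight for the grading, while 1 has weight zero. This is the
positivity of roots needed for faithfulness. -/
theorem a_mul_ne_one (hN : 1 ≤ N) (i : ZMod (2 * N + 1)) :
    ∀ y ∈ Submonoid.closure (Set.range (a N)), a N i * y ≠ 1 := by
  obtain ⟨φ, e, he⟩ := exists_scaling_a hN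
  intro y hy h
  have hdeg : ∃ d : ℕ, φ y = 2 ^ d * y := by
    clear h
    induction hy using Submonoid.closure_induction with
    | mem y hy => obtain ⟨j, rfl⟩ := hy; exact ⟨_, (he j).2⟩
    | one => exact ⟨0, by simp⟩
    | mul y z _ _ hy hz =>
      obtain ⟨d, hd⟩ := hy
      obtain ⟨d', hd'⟩ := hz
      exact ⟨d + d', by rw [map_mul, hd, hd', pow_add]; ring⟩
  obtain ⟨d, hd⟩ := hdeg
  have h2 := congrArg φ h
  rw [map_mul, map_one, hd, (he i).2] at h2
  have h3 : (2 : K N) ^ (e i + d) = 1 := by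
    rw [pow_add]; linear_combination h2 - 2 ^ (e i) * 2 ^ d * h
  have h4 : (2 : ℕ) ^ (e i + d) = 1 := by exact_mod_cast h3
  have := (he i).1
  rw [Nat.pow_eq_one] at h4
  omega

/-- Doubling all x_j while fixing the a_i would turn a relation A = x into A = 2x, forcing x = 0. -/
theorem A_sub_x_ne_zero {m : ℕ} (h1 : 1 ≤ m) (h2 : m ≤ 2 * N) (i : ℕ) : A N i - x N m ≠ 0 := by
  obtain ⟨φ, -, -, -, ha, hx⟩ := exists_scaling_x N
  intro h
  have := congrArg φ h
  rw [map_sub, A, map_pow, ha, hx m h1 h2, map_zero] at this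
  rw [A] at h
  exact x_ne_zero m (by linear_combination h - this)

theorem one_sub_A_mul_x_ne_zero {m : ℕ} (h1 : 1 ≤ m) (h2 : m ≤ 2 * N) (i : ℕ) :
    1 - A N i * x N m ≠ 0 := by
  obtain ⟨φ, -, -, -, ha, hx⟩ := exists_scaling_x N
  intro h
  have := congrArg φ h
  rw [map_sub, map_one, map_mul, A, map_pow, ha, hx m h1 h2, map_zero] at this
  rw [A] at h
  exact one_ne_zero (α := K N) (by linear_combination 2 * h - this)

end Scaling

/-! ### The reflections with index 1 to 2N and their relations. -/

section Reflections

/-- Rational core of the braid relation. Here u and v are the multipliers attached to nodes 1 and 2,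
X and Y are x_1 and x_2, and U is the image of u under s_2. The conclusion reads s_1(v) = v ·
s_2(s_1(v)), with B⁻¹(AB) left unreduced as it arises from the substitution. -/
theorem braid_identity_left {F : Type*} [Field F] {A B X Y u v U : F} (hB : B ≠ 0)
    (hX : A - X ≠ 0) (hY : B - Y ≠ 0) (hu0 : u ≠ 0) (hU0 : U ≠ 0)
    (hu : u = (1 - A * X) / (A - X)) (hv : v = (1 - B * Y) / (B - Y))
    (h2 : A * B - X * v ≠ 0) (hU : U = (1 - A * B * (X * v)) / (A * B - X * v))
    (h1 : B * A - Y * u⁻¹ ≠ 0)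
    (h3 : B⁻¹ * (A * B) - Y * U⁻¹ ≠ 0) :
    (1 - B * A * (Y * u⁻¹)) / (B * A - Y * u⁻¹) =
      v * ((1 - B⁻¹ * (A * B) * (Y * U⁻¹)) / (B⁻¹ * (A * B) - Y * U⁻¹)) := by
  have hBA : B⁻¹ * (A * B) = A := by field_simp
  rw [hBA] at h3 ⊢
  have e1 : (1 - B * A * (Y * u⁻¹)) / (B * A - Y * u⁻¹) = (u - B * A * Y) / (B * A * u - Y) := by
    rw [← mul_div_mul_right _ _ hu0]; congr 1 <;> field_simp
  have e2 : (1 - A * (Y * U⁻¹)) / (A - Y * U⁻¹) = (U - A * Y) / (A * U - Y) := by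
    rw [← mul_div_mul_right _ _ hU0]; congr 1 <;> field_simp
  have h1' : B * A * u - Y ≠ 0 := by
    intro h; apply h1; field_simp; simpa using h
  have h3' : A * U - Y ≠ 0 := by
    intro h; apply h3; field_simp; simpa using h
  rw [e1, e2, mul_div_assoc', div_eq_div_iff h1' h3']
  have hD : A * B * (B - Y) - X * (1 - B * Y) ≠ 0 := by
    intro h; apply h2; rw [hv]; field_simp; simpa using h
  have hU' : U = ((B - Y) - A * B * X * (1 - B * Y)) / (A * B * (B - Y) - X * (1 - B * Y)) := by
    rw [hU, hv, ← mul_div_mul_right _ _ hY]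
    congr 1 <;> field_simp
  rw [hU', hu, hv]
  field_simp
  ring

/-- The mirror identity s_2(u) = u · s_1(s_2(u)), where V is the image of v under s_1. -/
theorem braid_identity_right {F : Type*} [Field F] {A B X Y u v V : F} (hA : A ≠ 0)
    (hX : A - X ≠ 0) (hY : B - Y ≠ 0) (hu0 : u ≠ 0)
    (hu : u = (1 - A * X) / (A - X)) (hv : v = (1 - B * Y) / (B - Y))
    (h2 : B * A - Y * u⁻¹ ≠ 0) (hV : V = (1 - B * A * (Y * u⁻¹)) / (B * A - Y * u⁻¹))
    (h1 : A * B - X * v ≠ 0)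
    (h3 : A⁻¹ * (B * A) - X * V ≠ 0) :
    (1 - A * B * (X * v)) / (A * B - X * v) =
      u * ((1 - A⁻¹ * (B * A) * (X * V)) / (A⁻¹ * (B * A) - X * V)) := by
  have hBA : A⁻¹ * (B * A) = B := by field_simp
  rw [hBA] at h3 ⊢
  rw [mul_div_assoc', div_eq_div_iff h1 h3]
  have hu1 : 1 - A * X ≠ 0 := by
    intro h; rw [h, zero_div] at hu; exact hu0 hu
  have hD : A * B * (1 - A * X) - Y * (A - X) ≠ 0 := by
    intro h; apply h2; rw [hu]; field_simp; simpa [mul_comm A B] using h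
  have hV' : V = ((1 - A * X) - B * A * Y * (A - X)) / (A * B * (1 - A * X) - Y * (A - X)) := by
    rw [hV, hu, ← mul_div_mul_right _ _ hu1]
    congr 1 <;> field_simp
  rw [hV', hu, hv]
  field_simp
  ring

variable {N : ℕ}

theorem two_ne_zero_zmod (hN : 1 ≤ N) : (2 : ZMod (2 * N + 1)) ≠ 0 := by
  have : ((2 : ℕ) : ZMod (2 * N + 1)) ≠ 0 := by
    rw [Ne, ZMod.natCast_eq_zero_iff]
    intro h
    have := Nat.le_of_dvd two_pos h
    omega
  exact_mod_cast this

theorem one_ne_zero_zmod (hN : 1 ≤ N) : (1 : ZMod (2 * N + 1)) ≠ 0 := by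
  intro h
  exact two_ne_zero_zmod hN (by linear_combination 2 * h)

theorem natCast_zmod_inj {i j : ℕ} (hi : i ≤ 2 * N) (hj : j ≤ 2 * N) :
    (i : ZMod (2 * N + 1)) = j ↔ i = j := by
  rw [ZMod.natCast_eq_natCast_iff, Nat.ModEq, Nat.mod_eq_of_lt (by omega),
    Nat.mod_eq_of_lt (by omega)]

theorem natCast_zmod_ne_zero {i : ℕ} (h1 : 1 ≤ i) (h2 : i ≤ 2 * N) :
    (i : ZMod (2 * N + 1)) ≠ 0 := by
  have := (natCast_zmod_inj (N := N) h2 (Nat.zero_le _)).not.2 (by omega : i ≠ 0)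
  simpa using this

/-- Minus the entries of the Cartan matrix of type `A_{2N}^{(1)}`. -/
def cart (i j : ZMod (2 * N + 1)) : ℤ :=
  (if j = i + 1 then 1 else 0) + (if j = i - 1 then 1 else 0) - if j = i then 2 else 0

theorem sum_cart (i : ZMod (2 * N + 1)) (e : ZMod (2 * N + 1) → ℤ) :
    ∑ j, cart i j * e j = e (i + 1) + e (i - 1) - 2 * e i := by
  simp [cart, sub_mul, add_mul, Finset.sum_sub_distrib, Finset.sum_add_distrib]

theorem cart_self (hN : 1 ≤ N) (i : ZMod (2 * N + 1)) : cart i i = -2 := by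
  have h1 : i ≠ i + 1 := fun h => one_ne_zero_zmod hN (by linear_combination -h)
  have h2 : i ≠ i - 1 := fun h => one_ne_zero_zmod hN (by linear_combination h)
  simp [cart, h1, h2]

theorem cart_add_one (hN : 1 ≤ N) (i : ZMod (2 * N + 1)) : cart i (i + 1) = 1 := by
  have h1 : i + 1 ≠ i := fun h => one_ne_zero_zmod hN (by linear_combination h)
  have h2 : i + 1 ≠ i - 1 := fun h => two_ne_zero_zmod hN (by linear_combination h)
  simp [cart, h1, h2]

theorem cart_sub_one (hN : 1 ≤ N) (i : ZMod (2 * N + 1)) : cart i (i - 1) = 1 := by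
  have h1 : i - 1 ≠ i := fun h => one_ne_zero_zmod hN (by linear_combination -h)
  have h2 : i - 1 ≠ i + 1 := fun h => two_ne_zero_zmod hN (by linear_combination -h)
  simp [cart, h1, h2]

theorem cart_of_ne {i j : ZMod (2 * N + 1)} (h : j ≠ i) (h1 : j ≠ i + 1) (h2 : j ≠ i - 1) :
    cart i j = 0 := by
  simp [cart, h, h1, h2]

theorem cart_add (i j k : ZMod (2 * N + 1)) : cart (i + k) (j + k) = cart i j := by
  have h1 : j + k = i + k + 1 ↔ j = i + 1 :=
    ⟨fun h => by linear_combination h, fun h => by linear_combination h⟩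
  have h2 : j + k = i + k - 1 ↔ j = i - 1 :=
    ⟨fun h => by linear_combination h, fun h => by linear_combination h⟩
  simp [cart, h1, h2]

theorem cart_neg (i j : ZMod (2 * N + 1)) : cart (-i) (-j) = cart i j := by
  have h1 : -j = -i + 1 ↔ j = i - 1 :=
    ⟨fun h => by linear_combination -h, fun h => by linear_combination -h⟩
  have h2 : -j = -i - 1 ↔ j = i + 1 :=
    ⟨fun h => by linear_combination -h, fun h => by linear_combination -h⟩
  simp only [cart, h1, h2, neg_inj]
  ring

theorem prod_zpow_eq_zpow_sum {F ι : Type*} [Field F] {y : F} (hy : y ≠ 0) (s : Finset ι)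
    (e : ι → ℤ) : ∏ i ∈ s, y ^ e i = y ^ ∑ i ∈ s, e i := by
  classical
  induction s using Finset.induction_on with
  | empty => simp
  | insert i s hi ih => rw [Finset.prod_insert hi, Finset.sum_insert hi, ih, zpow_add₀ hy]

/-- The factor by which `s_i` multiplies `x_{i-1}`. -/
def ratio (N i : ℕ) : K N := (1 - A N i * x N i) / (A N i - x N i)

/-- The factor by which `s_i` multiplies `x_j`. -/
def factor (N i j : ℕ) : K N :=
  if j + 1 = i then ratio N i else if j = i + 1 then (ratio N i)⁻¹ else 1

theorem factor_of_ne {i j : ℕ} (h1 : j + 1 ≠ i) (h2 : j ≠ i + 1) : factor N i j = 1 := by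
  rw [factor, if_neg h1, if_neg h2]

theorem factor_pred (i : ℕ) : factor N (i + 1) i = ratio N (i + 1) := if_pos rfl

theorem factor_succ (i : ℕ) : factor N i (i + 1) = (ratio N i)⁻¹ := by
  rw [factor, if_neg (by omega), if_pos rfl]

/-- The transformation `s_i` in terms of the normalized variables. -/
structure Refl (N i : ℕ) (φ : Bir N) : Prop where
  map_t : φ (t N) = t N
  map_b : φ (b N) = b N
  map_c : φ (c N) = c N
  map_a : ∀ j, φ (a N j) = a N j * a N i ^ cart (i : ZMod (2 * N + 1)) j
  map_x : ∀ j, 1 ≤ j → j ≤ 2 * N → φ (x N j) = x N j * factor N i j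

/-- Converts preservation of the cyclic product into the value at a_0 that `exists_bir_of_generate`
asks for. -/
theorem eq_div_of_prod_eq {F : Type*} [Field F] (a' : ZMod (2 * N + 1) → F) (hne : ∀ i, a' i ≠ 0)
    {q' : F} (h : ∏ i, a' i = q') : a' 0 = q' / ∏ k : {k : ZMod (2 * N + 1) // k ≠ 0}, a' k := by
  have h1 : ∏ k ∈ ({0}ᶜ : Finset (ZMod (2 * N + 1))), a' k =
      ∏ k : {k : ZMod (2 * N + 1) // k ≠ 0}, a' k :=
    Finset.prod_subtype _ (fun k => by simp) _
  rw [eq_div_iff (Finset.prod_ne_zero_iff.2 fun _ _ => hne _), ← h, ← h1]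
  exact (Fintype.prod_eq_mul_prod_compl 0 a').symm

theorem exists_refl (hN : 1 ≤ N) (i : ℕ) (h1 : 1 ≤ i) (h2 : i ≤ 2 * N) :
    ∃ φ : Bir N, Refl N i φ := by
  have h0 : a N 0 * a N i ^ cart (i : ZMod (2 * N + 1)) 0 = t N ^ (2 * N - 1) /
      ∏ k : {k : ZMod (2 * N + 1) // k ≠ 0}, a N k * a N i ^ cart (i : ZMod (2 * N + 1)) k := by
    refine eq_div_of_prod_eq (fun j => a N j * a N i ^ cart (i : ZMod (2 * N + 1)) j)
      (fun j => mul_ne_zero (a_ne_zero _) (zpow_ne_zero _ (a_ne_zero _))) ?_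
    -- The rows of the affine Cartan matrix sum to zero, so the product of all a_j is unchanged.
    have h := sum_cart (i : ZMod (2 * N + 1)) fun _ => 1
    simp only [mul_one] at h
    rw [Finset.prod_mul_distrib, prod_a, prod_zpow_eq_zpow_sum (a_ne_zero _), h]
    simp [q]
  suffices hL : ∀ L : IntermediateField ℂ (K N), t N ∈ L → b N ∈ L → c N ∈ L →
      (∀ j, a N j * a N i ^ cart (i : ZMod (2 * N + 1)) j ∈ L) →
      (∀ j, 1 ≤ j → j ≤ 2 * N → x N j * factor N i j ∈ L) →
      t N ∈ L ∧ b N ∈ L ∧ c N ∈ L ∧ (∀ i, a N i ∈ L) ∧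
        ∀ j, 1 ≤ j → j ≤ 2 * N → x N j ∈ L by
    obtain ⟨φ, ht, hb, hc, ha, hx⟩ := exists_bir_of_generate (N := N) (t N) (b N) (c N)
      (fun j => a N j * a N i ^ cart (i : ZMod (2 * N + 1)) j) (fun j => x N j * factor N i j)
      c_ne_zero h0 hL
    exact ⟨φ, ht, hb, hc, ha, hx⟩
  · intro L ht hb hc ha hx
    have hai : a N i ∈ L := by
      have := ha i
      rw [cart_self hN] at this
      have h3 := inv_mem this
      convert h3 using 1
      have := a_ne_zero (N := N) i
      field_simp
    have ha' : ∀ j, a N j ∈ L := fun j => by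
      have := div_mem (ha j) (zpow_mem hai (cart (i : ZMod (2 * N + 1)) j))
      rwa [mul_div_cancel_right₀ _ (zpow_ne_zero _ (a_ne_zero _))] at this
    -- The variable x_i is not moved, so the multiplier, which involves only a_i and x_i, is
    -- available to undo the change at i-1 and i+1.
    have hxi : x N i ∈ L := by
      simpa [factor_of_ne (N := N) (i := i) (j := i) (by omega) (by omega)] using hx i h1 h2
    have hr : ratio N i ∈ L := by
      have hA : A N i ∈ L := pow_mem (ha' _) _
      exact div_mem (sub_mem (one_mem _) (mul_mem hA hxi)) (sub_mem hA hxi)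
    have hr0 : ratio N i ≠ 0 :=
      div_ne_zero (one_sub_A_mul_x_ne_zero h1 h2 i) (A_sub_x_ne_zero h1 h2 i)
    have hg : ∀ j, factor N i j ∈ L := by
      intro j; unfold factor; split_ifs
      exacts [hr, inv_mem hr, one_mem _]
    have hg0 : ∀ j, factor N i j ≠ 0 := by
      intro j; unfold factor; split_ifs
      exacts [hr0, inv_ne_zero hr0, one_ne_zero]
    refine ⟨ht, hb, hc, ha', fun j h3 h4 => ?_⟩
    have := div_mem (hx j h3 h4) (hg j)
    rwa [mul_div_cancel_right₀ _ (hg0 j)] at this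

namespace Refl

theorem map_q {i : ℕ} {φ : Bir N} (h : Refl N i φ) : φ (q N) = q N := by
  rw [q, map_pow, h.map_t]

theorem map_prod_zpow {i : ℕ} {φ : Bir N} (h : Refl N i φ) (e : ZMod (2 * N + 1) → ℤ) :
    φ (∏ k, a N k ^ e k) =
      (∏ k, a N k ^ e k) * a N i ^ (e (i + 1) + e (i - 1) - 2 * e i) := by
  rw [map_prod, ← sum_cart, ← prod_zpow_eq_zpow_sum (a_ne_zero _), ← Finset.prod_mul_distrib]
  refine Finset.prod_congr rfl fun k _ => ?_
  rw [map_zpow₀, h.map_a, mul_zpow, zpow_mul]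

theorem map_a_self (hN : 1 ≤ N) {i : ℕ} {φ : Bir N} (h : Refl N i φ) : φ (a N i) = (a N i)⁻¹ := by
  rw [h.map_a, cart_self hN, zpow_neg]
  have := a_ne_zero (N := N) i
  field_simp

theorem map_A_self (hN : 1 ≤ N) {i : ℕ} {φ : Bir N} (h : Refl N i φ) : φ (A N i) = (A N i)⁻¹ := by
  rw [A, map_pow, h.map_a_self hN, inv_pow]

theorem map_A_of_ne {i : ℕ} {φ : Bir N} (h : Refl N i φ) {j : ℕ}
    (h0 : cart (i : ZMod (2 * N + 1)) j = 0) : φ (A N j) = A N j := by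
  rw [A, map_pow, h.map_a, h0, zpow_zero, mul_one]

theorem map_A_adj {i : ℕ} {φ : Bir N} (h : Refl N i φ) {j : ℕ}
    (h0 : cart (i : ZMod (2 * N + 1)) j = 1) : φ (A N j) = A N j * A N i := by
  rw [A, map_pow, h.map_a, h0, zpow_one, mul_pow, A]

theorem map_A_succ (hN : 1 ≤ N) {i : ℕ} {φ : Bir N} (h : Refl N i φ) :
    φ (A N (i + 1)) = A N (i + 1) * A N i :=
  h.map_A_adj (by push_cast; exact cart_add_one hN _)

theorem map_A_pred (hN : 1 ≤ N) {i : ℕ} {φ : Bir N} (h : Refl N (i + 1) φ) :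
    φ (A N i) = A N i * A N (i + 1) :=
  h.map_A_adj (by
    have := cart_sub_one hN ((i + 1 : ℕ) : ZMod (2 * N + 1))
    rwa [show ((i + 1 : ℕ) : ZMod (2 * N + 1)) - 1 = i by push_cast; ring] at this)

theorem map_x_of_ne {i : ℕ} {φ : Bir N} (h : Refl N i φ) {j : ℕ} (h1 : 1 ≤ j) (h2 : j ≤ 2 * N)
    (h3 : j + 1 ≠ i) (h4 : j ≠ i + 1) : φ (x N j) = x N j := by
  rw [h.map_x j h1 h2, factor_of_ne h3 h4, mul_one]

/-- Inverting A_i with x_i fixed exchanges numerator and denominator up to the common factor A_i.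
This makes the reflection an involution. -/
theorem map_ratio (hN : 1 ≤ N) {i : ℕ} {φ : Bir N} (h : Refl N i φ) (h1 : 1 ≤ i)
    (h2 : i ≤ 2 * N) : φ (ratio N i) = (ratio N i)⁻¹ := by
  rw [ratio, map_div₀, map_sub, map_sub, map_mul, map_one, h.map_A_self hN,
    h.map_x_of_ne h1 h2 (by omega) (by omega), inv_div]
  have := A_ne_zero (N := N) i
  have := A_sub_x_ne_zero h1 h2 i
  have := one_sub_A_mul_x_ne_zero h1 h2 i
  have h5 : (A N i)⁻¹ - x N i = (1 - A N i * x N i) / A N i := by field_simp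
  have h6 : 1 - (A N i)⁻¹ * x N i = (A N i - x N i) / A N i := by field_simp
  rw [h5, h6]
  field_simp

theorem isS (hN : 1 ≤ N) {i : ℕ} {φ : Bir N} (h : Refl N i φ) : IsS N i φ where
  map_t := h.map_t
  map_b := h.map_b
  map_c := h.map_c
  map_a j := by
    split_ifs with h3 h4
    · rw [h3, h.map_a_self hN]
    · have : cart (i : ZMod (2 * N + 1)) j = 1 := by
        rcases h4 with rfl | rfl
        · exact cart_add_one hN _
        · exact cart_sub_one hN _
      rw [h.map_a, this, zpow_one, mul_comm]
    · rw [not_or] at h4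
      rw [h.map_a, cart_of_ne h3 h4.1 h4.2, zpow_zero, mul_one]
  map_f j h3 h4 := by
    have hr : ratio N i = (lam N (i - 1) ^ 2 - a N i ^ (2 * N + 1) * f N i) /
        (a N i ^ (2 * N + 1) * lam N (i - 1) ^ 2 - f N i) := by
      have h5 := pow_ne_zero 2 (lam_ne_zero (N := N) (i - 1))
      rw [ratio, ← mul_div_mul_right _ _ h5, f_eq, A]
      congr 1 <;> ring
    have hf : φ (f N j) = f N j * factor N i j := by
      rw [map_f_eq, rescale, h.map_x j h3 h4, h.map_c, f_eq, lam]
      ring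
    rw [hf, factor, hr, inv_div]
    split_ifs <;> simp

theorem mul_self (hN : 1 ≤ N) {i : ℕ} {φ : Bir N} (h : Refl N i φ) (h1 : 1 ≤ i)
    (h2 : i ≤ 2 * N) : φ * φ = 1 := by
  refine bir_ext ?_ ?_ ?_ (fun j => ?_) fun j h3 h4 => ?_ <;>
    rw [AlgEquiv.mul_apply, AlgEquiv.one_apply]
  · rw [h.map_t, h.map_t]
  · rw [h.map_b, h.map_b]
  · rw [h.map_c, h.map_c]
  · rw [h.map_a, map_mul, map_zpow₀, h.map_a_self hN, h.map_a, inv_zpow, mul_assoc,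
      mul_inv_cancel₀ (zpow_ne_zero _ (a_ne_zero _)), mul_one]
  · have hr0 : ratio N i ≠ 0 :=
      div_ne_zero (one_sub_A_mul_x_ne_zero h1 h2 i) (A_sub_x_ne_zero h1 h2 i)
    rw [h.map_x j h3 h4, map_mul, h.map_x j h3 h4, factor]
    split_ifs
    · rw [h.map_ratio hN h1 h2, mul_assoc, mul_inv_cancel₀ hr0, mul_one]
    · rw [map_inv₀, h.map_ratio hN h1 h2, inv_inv, mul_assoc, inv_mul_cancel₀ hr0, mul_one]
    · simp

theorem map_ratio_of_ne {i j : ℕ} {φ : Bir N} (h : Refl N i φ) (h1 : 1 ≤ j) (h2 : j ≤ 2 * N)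
    (h3 : j + 1 ≠ i) (h4 : j ≠ i + 1) (h0 : cart (i : ZMod (2 * N + 1)) j = 0) :
    φ (ratio N j) = ratio N j := by
  rw [ratio, map_div₀, map_sub, map_sub, map_mul, map_one, h.map_A_of_ne h0,
    h.map_x_of_ne h1 h2 h3 h4]

theorem map_factor_of_ne {i j : ℕ} {φ : Bir N} (h : Refl N i φ) (h1 : 1 ≤ j) (h2 : j ≤ 2 * N)
    (h3 : j + 1 ≠ i) (h4 : j ≠ i + 1) (h0 : cart (i : ZMod (2 * N + 1)) j = 0) (k : ℕ) :
    φ (factor N j k) = factor N j k := by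
  unfold factor
  split_ifs
  · rw [h.map_ratio_of_ne h1 h2 h3 h4 h0]
  · rw [map_inv₀, h.map_ratio_of_ne h1 h2 h3 h4 h0]
  · rw [map_one]

/-- Neither reflection touches the multiplier of the other. Adjacency is excluded twice because the
x_j are indexed linearly while the Cartan entries are cyclic. -/
theorem comm {i j : ℕ} {φ ψ : Bir N} (hφ : Refl N i φ) (hψ : Refl N j ψ) (h1 : 1 ≤ i)
    (h2 : i ≤ 2 * N) (h1' : 1 ≤ j) (h2' : j ≤ 2 * N) (h3 : j + 1 ≠ i) (h4 : j ≠ i + 1)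
    (h5 : cart (i : ZMod (2 * N + 1)) j = 0) (h6 : cart (j : ZMod (2 * N + 1)) i = 0) :
    φ * ψ = ψ * φ := by
  refine bir_ext ?_ ?_ ?_ (fun k => ?_) fun k h7 h8 => ?_ <;>
    rw [AlgEquiv.mul_apply, AlgEquiv.mul_apply]
  · rw [hψ.map_t, hφ.map_t, hψ.map_t]
  · rw [hψ.map_b, hφ.map_b, hψ.map_b]
  · rw [hψ.map_c, hφ.map_c, hψ.map_c]
  · simp only [hψ.map_a, hφ.map_a, map_mul, map_zpow₀, h5, h6, zpow_zero, mul_one]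
    ring
  · rw [hψ.map_x k h7 h8, hφ.map_x k h7 h8, map_mul, map_mul, hψ.map_x k h7 h8,
      hφ.map_x k h7 h8, hφ.map_factor_of_ne h1' h2' h3 h4 h5,
      hψ.map_factor_of_ne h1 h2 (by omega) (by omega) h6]
    ring

/-- One adjacent pair suffices, since conjugation by π carries it to all the others. -/
theorem braid (hN : 1 ≤ N) {φ ψ : Bir N} (hφ : Refl N 1 φ) (hψ : Refl N 2 ψ) :
    φ * ψ * φ = ψ * φ * ψ := by
  have hc12 : cart ((1 : ℕ) : ZMod (2 * N + 1)) ((2 : ℕ) : ZMod (2 * N + 1)) = 1 := by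
    have := cart_add_one hN ((1 : ℕ) : ZMod (2 * N + 1))
    rwa [show ((1 : ℕ) : ZMod (2 * N + 1)) + 1 = (2 : ℕ) by push_cast; ring] at this
  have hc21 : cart ((2 : ℕ) : ZMod (2 * N + 1)) ((1 : ℕ) : ZMod (2 * N + 1)) = 1 := by
    have := cart_sub_one hN ((2 : ℕ) : ZMod (2 * N + 1))
    rwa [show ((2 : ℕ) : ZMod (2 * N + 1)) - 1 = (1 : ℕ) by push_cast; ring] at this
  have hA1 := A_ne_zero (N := N) 1
  have hA2 := A_ne_zero (N := N) 2
  have φ1 := hφ.map_A_self hN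
  have φ2 := hφ.map_A_adj hc12
  have ψ2 := hψ.map_A_self hN
  have ψ1 := hψ.map_A_adj hc21
  have φx1 := hφ.map_x_of_ne (j := 1) le_rfl (by omega) (by omega) (by omega)
  have ψx2 := hψ.map_x_of_ne (j := 2) (by omega) (by omega) (by omega) (by omega)
  have φx2 : φ (x N 2) = x N 2 * (ratio N 1)⁻¹ := by
    rw [hφ.map_x 2 (by omega) (by omega), factor_succ]
  have ψx1 : ψ (x N 1) = x N 1 * ratio N 2 := by
    rw [hψ.map_x 1 (by omega) (by omega), factor_pred]
  have n1 : 1 - A N 1 * x N 1 ≠ 0 := one_sub_A_mul_x_ne_zero le_rfl (by omega) 1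
  have n2 : 1 - A N 2 * x N 2 ≠ 0 := one_sub_A_mul_x_ne_zero (by omega) (by omega) 2
  have n3 : A N 1 - x N 1 ≠ 0 := A_sub_x_ne_zero le_rfl (by omega) 1
  have n4 : A N 2 - x N 2 ≠ 0 := A_sub_x_ne_zero (by omega) (by omega) 2
  have hx1 := x_ne_zero (N := N) 1
  have hx2 := x_ne_zero (N := N) 2
  have φr1 := hφ.map_ratio hN le_rfl (by omega)
  have ψr2 := hψ.map_ratio hN (by omega) (by omega)
  have r1 : ratio N 1 ≠ 0 := div_ne_zero n1 n3
  have r2 : ratio N 2 ≠ 0 := div_ne_zero n2 n4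
  have e1 : φ (A N 2 - x N 2) ≠ 0 := (map_ne_zero φ).2 n4
  have e2 : ψ (A N 1 - x N 1) ≠ 0 := (map_ne_zero ψ).2 n3
  have φr2 : φ (ratio N 2) = (1 - A N 2 * A N 1 * (x N 2 * (ratio N 1)⁻¹)) /
      (A N 2 * A N 1 - x N 2 * (ratio N 1)⁻¹) := by
    rw [ratio, map_div₀, map_sub, map_sub, map_mul, map_one, φ2, φx2]
  have ψr1 : ψ (ratio N 1) = (1 - A N 1 * A N 2 * (x N 1 * ratio N 2)) /
      (A N 1 * A N 2 - x N 1 * ratio N 2) := by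
    rw [ratio, map_div₀, map_sub, map_sub, map_mul, map_one, ψ1, ψx1]
  rw [map_sub, φ2, φx2] at e1
  rw [map_sub, ψ1, ψx1] at e2
  have e3 := (map_ne_zero ψ).2 e1
  have e4 := (map_ne_zero φ).2 e2
  rw [map_sub, map_mul, map_mul, map_inv₀, ψ2, ψ1, ψx2] at e3
  rw [map_sub, map_mul, map_mul, φ1, φ2, φx1] at e4
  -- This identity settles both x_1 and x_3, which carry inverse multipliers; `key2` settles x_2.
  have key1 : φ (ratio N 2) = ratio N 2 * ψ (φ (ratio N 2)) := by
    rw [φr2]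
    simp only [map_div₀, map_sub, map_one, map_mul, map_inv₀, ψ2, ψ1, ψx2]
    exact braid_identity_left hA2 n3 n4 r1 ((map_ne_zero ψ).2 r1) rfl rfl e2 ψr1 e1 e3
  have key2 : ψ (ratio N 1) = ratio N 1 * φ (ψ (ratio N 1)) := by
    rw [ψr1]
    simp only [map_div₀, map_sub, map_one, map_mul, φ2, φ1, φx1]
    exact braid_identity_right hA1 n3 n4 r1 rfl rfl e1 φr2 e2 e4
  have φa1 := hφ.map_a_self hN
  have ψa2 := hψ.map_a_self hN
  have φa2 := hφ.map_a (2 : ℕ)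
  have ψa1 := hψ.map_a (1 : ℕ)
  rw [hc12, zpow_one] at φa2
  rw [hc21, zpow_one] at ψa1
  refine bir_ext ?_ ?_ ?_ (fun k => ?_) fun k h7 h8 => ?_ <;>
    simp only [AlgEquiv.mul_apply]
  · simp only [hψ.map_t, hφ.map_t]
  · simp only [hψ.map_b, hφ.map_b]
  · simp only [hψ.map_c, hφ.map_c]
  · have n5 := a_ne_zero (N := N) (1 : ℕ)
    have n6 := a_ne_zero (N := N) (2 : ℕ)
    simp only [hφ.map_a k, hψ.map_a k, map_mul, map_zpow₀, φa1, φa2, ψa1, ψa2, mul_zpow, inv_zpow]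
    have n7 := fun e : ℤ => zpow_ne_zero e n5
    have n8 := fun e : ℤ => zpow_ne_zero e n6
    field_simp
  · rcases (by omega : k = 1 ∨ k = 2 ∨ k = 3 ∨ 4 ≤ k) with rfl | rfl | rfl | hk
    · rw [φx1, ψx1, map_mul, φx1, map_mul, ψx1, mul_assoc, ← key1]
    · rw [ψx2, φx2, map_mul, map_mul, map_inv₀, map_inv₀, ψx2, φx2, mul_assoc, ← mul_inv, ← key2]
    · have φx3 := hφ.map_x_of_ne h7 h8 (by omega) (by omega)
      have ψx3 : ψ (x N 3) = x N 3 * (ratio N 2)⁻¹ := by rw [hψ.map_x 3 h7 h8, factor_succ]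
      rw [φx3, ψx3, map_mul, φx3, map_mul, map_inv₀, map_inv₀, ψx3, mul_assoc, ← mul_inv, ← key1]
    · rw [hφ.map_x_of_ne h7 h8 (by omega) (by omega), hψ.map_x_of_ne h7 h8 (by omega) (by omega),
        hφ.map_x_of_ne h7 h8 (by omega) (by omega), hψ.map_x_of_ne h7 h8 (by omega) (by omega)]

end Refl

end Reflections

/-! ### The rotation π and the continued sequence of variables. -/

section Shift

variable {N : ℕ}

/-- `q ^ (2N+1)`. -/
def Q (N : ℕ) : K N := q N ^ (2 * N + 1)

/-- `c ^ (2N-1)`. -/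
def p (N : ℕ) : K N := c N ^ (2 * N - 1)

/-- `(∏ a_k ^ k) b`. -/
def mm (N : ℕ) : K N := (∏ k : ZMod (2 * N + 1), a N k ^ (k.val : ℤ)) * b N

/-- `a_0 ^ (2N+1) (∏ a_k ^ k) b`. -/
def m (N : ℕ) : K N := A N 0 * mm N

/-- `x_1 x_3 ⋯ x_{2N-1}`. -/
def oddProd (N : ℕ) : K N := ∏ k ∈ Finset.range N, x N (2 * k + 1)

/-- `x_2 x_4 ⋯ x_{2N}`. -/
def evenProd (N : ℕ) : K N := ∏ k ∈ Finset.range N, x N (2 * k + 2)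

/-- The continuation of the sequence `x_1, …, x_{2N}` by two terms, `π x_{2N}` and `π² x_{2N}`. -/
def xx (N j : ℕ) : K N :=
  if j ≤ 2 * N then x N j
  else if j = 2 * N + 1 then -(m N * p N + evenProd N) / (p N ^ 2 * oddProd N)
  else (1 + m N * p N * (1 - A N 1 * x N 1) / evenProd N) / x N 1

theorem xx_of_le {j : ℕ} (h : j ≤ 2 * N) : xx N j = x N j := if_pos h

theorem xx_last : xx N (2 * N + 1) = -(m N * p N + evenProd N) / (p N ^ 2 * oddProd N) := by
  rw [xx, if_neg (by omega), if_pos rfl]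

theorem xx_last' :
    xx N (2 * N + 2) = (1 + m N * p N * (1 - A N 1 * x N 1) / evenProd N) / x N 1 := by
  rw [xx, if_neg (by omega), if_neg (by omega)]

theorem Q_ne_zero : Q N ≠ 0 := pow_ne_zero _ q_ne_zero
theorem p_ne_zero : p N ≠ 0 := pow_ne_zero _ c_ne_zero
theorem mm_ne_zero : mm N ≠ 0 :=
  mul_ne_zero (Finset.prod_ne_zero_iff.2 fun _ _ => zpow_ne_zero _ (a_ne_zero _)) b_ne_zero
theorem m_ne_zero : m N ≠ 0 := mul_ne_zero (A_ne_zero _) mm_ne_zero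
theorem oddProd_ne_zero : oddProd N ≠ 0 := Finset.prod_ne_zero_iff.2 fun _ _ => x_ne_zero _
theorem evenProd_ne_zero : evenProd N ≠ 0 := Finset.prod_ne_zero_iff.2 fun _ _ => x_ne_zero _

theorem oddProd_mul_xx_last :
    p N ^ 2 * (oddProd N * xx N (2 * N + 1)) = -(m N * p N + evenProd N) := by
  have := oddProd_ne_zero (N := N)
  have := p_ne_zero (N := N)
  rw [xx_last]
  field_simp

theorem xx_last'_mul : (x N 1 * xx N (2 * N + 2) - 1) * evenProd N =
    m N * p N * (1 - A N 1 * x N 1) := by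
  have := x_ne_zero (N := N) 1
  have := evenProd_ne_zero (N := N)
  rw [xx_last']
  field_simp
  ring

theorem prod_A : ∏ i ∈ Finset.range (2 * N + 1), A N i = Q N := by
  rw [Q, ← prod_a, ← Finset.prod_pow, prod_zmod (2 * N)]
  rfl

theorem map_x_scaling_m {φ : Bir N} (hb : φ (b N) = 2 * b N) (ha : ∀ i, φ (a N i) = a N i) :
    φ (m N) = 2 * m N := by
  simp only [m, mm, A, map_mul, map_pow, map_prod, map_zpow₀, ha, hb]
  ring

/-- Doubling b doubles the first summand and fixes the second, so a zero sum would force the first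
summand to vanish. -/
theorem m_mul_p_add_evenProd_ne_zero : m N * p N + evenProd N ≠ 0 := by
  obtain ⟨φ, ht, hb, hc, ha, hx⟩ := exists_scaling_b N
  intro h
  have h2 := congrArg φ h
  have hE : φ (evenProd N) = evenProd N := by
    rw [evenProd, map_prod]
    refine Finset.prod_congr rfl fun k hk => hx _ (by omega) ?_
    have := Finset.mem_range.1 hk
    omega
  rw [map_add, map_mul, map_x_scaling_m hb ha, p, map_pow, hc, ← p, hE, map_zero] at h2
  exact mul_ne_zero m_ne_zero p_ne_zero (by linear_combination h2 - h)

theorem xx_last_ne_zero : xx N (2 * N + 1) ≠ 0 := by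
  rw [xx_last]
  exact div_ne_zero (neg_ne_zero.2 m_mul_p_add_evenProd_ne_zero)
    (mul_ne_zero (pow_ne_zero _ p_ne_zero) oddProd_ne_zero)

/-- Both sides are x_1 x_3 ⋯ x_{2N+1}, split off at either end. Through this, the closing relation
determines x_1 from the later terms. -/
theorem oddProd_shift (hN : 1 ≤ N) :
    x N 1 * ∏ k ∈ Finset.range N, xx N (2 * k + 3) = oddProd N * xx N (2 * N + 1) := by
  have h := Finset.prod_range_succ (fun k => xx N (2 * k + 1)) N
  rw [Finset.prod_range_succ'] at h
  have h2 : ∏ k ∈ Finset.range N, xx N (2 * k + 1) = oddProd N :=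
    Finset.prod_congr rfl fun k hk => xx_of_le (by have := Finset.mem_range.1 hk; omega)
  have h3 : xx N 1 * ∏ k ∈ Finset.range N, xx N (2 * k + 3) = oddProd N * xx N (2 * N + 1) := by
    rw [← h2, ← h, mul_comm]
    rfl
  rwa [xx_of_le (by omega)] at h3

/-- The transformation `π` in terms of the normalized variables. -/
structure IsShift (N : ℕ) (φ : Bir N) : Prop where
  map_t : φ (t N) = t N
  map_b : φ (b N) = q N * b N
  map_c : φ (c N) = (c N)⁻¹
  map_a : ∀ j, φ (a N j) = a N (j + 1)
  map_x' : ∀ j, 1 ≤ j → j ≤ 2 * N → φ (x N j) = xx N (j + 1)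

theorem exists_isShift (hN : 1 ≤ N) : ∃ φ : Bir N, IsShift N φ := by
  suffices hL : ∀ L : IntermediateField ℂ (K N), t N ∈ L → q N * b N ∈ L → (c N)⁻¹ ∈ L →
      (∀ j, a N (j + 1) ∈ L) → (∀ j, 1 ≤ j → j ≤ 2 * N → xx N (j + 1) ∈ L) →
      t N ∈ L ∧ b N ∈ L ∧ c N ∈ L ∧ (∀ i, a N i ∈ L) ∧
        ∀ j, 1 ≤ j → j ≤ 2 * N → x N j ∈ L by
    obtain ⟨φ, ht, hb, hc, ha, hx⟩ := exists_bir_of_generate (N := N) (t N) (q N * b N) (c N)⁻¹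
      (fun j => a N (j + 1)) (fun j => xx N (j + 1)) (inv_ne_zero c_ne_zero)
      (eq_div_of_prod_eq (fun j => a N (j + 1)) (fun _ => a_ne_zero _) (by
        rw [← q, ← prod_a]
        exact Fintype.prod_equiv (Equiv.addRight 1) _ _ fun _ => rfl)) hL
    exact ⟨φ, ht, hb, hc, ha, hx⟩
  intro L ht hb hc ha hx
  have hq : q N ∈ L := pow_mem ht _
  have hb' : b N ∈ L := by
    have := div_mem hb hq
    rwa [mul_div_cancel_left₀ _ q_ne_zero] at this
  have hc' : c N ∈ L := by simpa using inv_mem hc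
  have ha' : ∀ j, a N j ∈ L := fun j => by simpa using ha (j - 1)
  have hx2 : ∀ j, 2 ≤ j → j ≤ 2 * N → x N j ∈ L := fun j h1 h2 => by
    have := hx (j - 1) (by omega) (by omega)
    rwa [Nat.sub_add_cancel (by omega), xx_of_le h2] at this
  have hE : evenProd N ∈ L := prod_mem fun k hk => hx2 _ (by omega) (by
    have := Finset.mem_range.1 hk; omega)
  have hm : m N ∈ L :=
    mul_mem (pow_mem (ha' _) _) (mul_mem (prod_mem fun k _ => zpow_mem (ha' _) _) hb')
  have hp : p N ∈ L := pow_mem hc' _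
  have hO : ∏ k ∈ Finset.range N, xx N (2 * k + 3) ∈ L := prod_mem fun k hk =>
    hx (2 * k + 2) (by omega) (by have := Finset.mem_range.1 hk; omega)
  -- Only x_1 is missing from the images; it is solved from the formula for x_{2N+1}.
  have hx1 : x N 1 ∈ L := by
    have h1 : p N ^ 2 * (x N 1 * ∏ k ∈ Finset.range N, xx N (2 * k + 3)) =
        -(m N * p N + evenProd N) := by rw [oddProd_shift hN, oddProd_mul_xx_last]
    have h2 : p N ^ 2 * ∏ k ∈ Finset.range N, xx N (2 * k + 3) ≠ 0 := by
      intro h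
      refine m_mul_p_add_evenProd_ne_zero (N := N) ?_
      linear_combination h1 - x N 1 * h
    have h3 : x N 1 = -(m N * p N + evenProd N) /
        (p N ^ 2 * ∏ k ∈ Finset.range N, xx N (2 * k + 3)) := by
      rw [eq_div_iff h2, ← h1]; ring
    rw [h3]
    exact div_mem (neg_mem (add_mem (mul_mem hm hp) hE)) (mul_mem (pow_mem hp _) hO)
  refine ⟨ht, hb', hc', ha', fun j h1 h2 => ?_⟩
  rcases (by omega : j = 1 ∨ 2 ≤ j) with rfl | h3
  · exact hx1
  · exact hx2 j h3 h2

theorem A_add (i : ℕ) : A N (i + (2 * N + 1)) = A N i := by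
  have : ((2 * N + 1 : ℕ) : ZMod (2 * N + 1)) = 0 := ZMod.natCast_self _
  rw [A, A, Nat.cast_add, this, add_zero]

/-- Lowering every exponent by one divides by the full product q. The exception is the index 0,
whose exponent becomes 2N instead of -1; the excess 2N+1 is the factor A_0. The division by q is
what π(b) = q b compensates. -/
theorem prod_pow_shift : ∏ k : ZMod (2 * N + 1), a N (k + 1) ^ (k.val : ℤ) =
    A N 0 * (∏ k : ZMod (2 * N + 1), a N k ^ (k.val : ℤ)) / q N := by
  rw [eq_div_iff q_ne_zero, ← prod_a]
  have h1 : ∏ i : ZMod (2 * N + 1), a N i = ∏ i : ZMod (2 * N + 1), a N (i + 1) :=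
    (Fintype.prod_equiv (Equiv.addRight 1) _ _ fun _ => rfl).symm
  rw [h1, ← Finset.prod_mul_distrib]
  have h2 : ∏ k : ZMod (2 * N + 1), a N k ^ (k.val : ℤ) =
      ∏ k : ZMod (2 * N + 1), a N (k + 1) ^ ((k + 1).val : ℤ) :=
    (Fintype.prod_equiv (Equiv.addRight 1) _ _ fun _ => rfl).symm
  rw [h2, prod_zmod (2 * N), prod_zmod (2 * N), Finset.prod_range_succ, Finset.prod_range_succ]
  have h3 : ((2 * N : ℕ) : ZMod (2 * N + 1)) + 1 = 0 := by
    have : ((2 * N + 1 : ℕ) : ZMod (2 * N + 1)) = 0 := ZMod.natCast_self _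
    rwa [Nat.cast_add, Nat.cast_one] at this
  have h4 : ∏ k ∈ Finset.range (2 * N), a N ((k : ZMod (2 * N + 1)) + 1) ^
        (((k : ZMod (2 * N + 1)).val : ℤ)) * a N ((k : ZMod (2 * N + 1)) + 1) =
      ∏ k ∈ Finset.range (2 * N), a N ((k : ZMod (2 * N + 1)) + 1) ^
        ((((k : ZMod (2 * N + 1)) + 1).val : ℤ)) := by
    refine Finset.prod_congr rfl fun k hk => ?_
    have hk := Finset.mem_range.1 hk
    have e1 : (k : ZMod (2 * N + 1)).val = k := ZMod.val_natCast_of_lt (by omega)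
    have e2 : ((k : ZMod (2 * N + 1)) + 1).val = k + 1 := by
      have := ZMod.val_natCast_of_lt (n := 2 * N + 1) (a := k + 1) (by omega)
      rwa [Nat.cast_add, Nat.cast_one] at this
    rw [e1, e2, Nat.cast_add, zpow_add₀ (a_ne_zero _), Nat.cast_one, zpow_one]
  rw [h4, h3, ZMod.val_zero, ZMod.val_natCast_of_lt (by omega), A, Nat.cast_zero]
  push_cast
  rw [zpow_zero, mul_one, mul_comm]
  congr 1

namespace IsShift

variable {φ : Bir N} (h : IsShift N φ)
include h

theorem map_q : φ (q N) = q N := by rw [q, map_pow, h.map_t]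

theorem map_Q : φ (Q N) = Q N := by rw [Q, map_pow, h.map_q]

theorem map_p : φ (p N) = (p N)⁻¹ := by rw [p, map_pow, h.map_c, inv_pow]

theorem map_A (i : ℕ) : φ (A N i) = A N (i + 1) := by
  rw [A, map_pow, h.map_a, A]; push_cast; rfl

theorem map_mm : φ (mm N) = m N := by
  have := q_ne_zero (N := N)
  simp only [m, mm, map_mul, map_prod, map_zpow₀, h.map_a, h.map_b, prod_pow_shift]
  field_simp

theorem map_m : φ (m N) = A N 1 * m N := by
  rw [m, map_mul, h.map_A, h.map_mm, m]

theorem map_x {j : ℕ} (h1 : 1 ≤ j) (h2 : j < 2 * N) : φ (x N j) = x N (j + 1) := by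
  rw [h.map_x' j h1 h2.le, xx_of_le h2]

theorem map_oddProd : φ (oddProd N) = evenProd N := by
  rw [oddProd, map_prod]
  refine Finset.prod_congr rfl fun k hk => ?_
  have hk := Finset.mem_range.1 hk
  exact h.map_x (by omega) (by omega)

theorem map_evenProd : φ (evenProd N) = ∏ k ∈ Finset.range N, xx N (2 * k + 3) := by
  rw [evenProd, map_prod]
  refine Finset.prod_congr rfl fun k hk => ?_
  have hk := Finset.mem_range.1 hk
  exact h.map_x' _ (by omega) (by omega)

/-- Under π the even product becomes x_3 x_5 ⋯ x_{2N+1}, which equals the odd product times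
x_{2N+1}/x_1, and the closing relation evaluates it. -/
theorem map_xx_last (hN : 1 ≤ N) : φ (xx N (2 * N + 1)) = xx N (2 * N + 2) := by
  have h1 := oddProd_ne_zero (N := N)
  have h2 := evenProd_ne_zero (N := N)
  have h3 := p_ne_zero (N := N)
  have h4 := x_ne_zero (N := N) 1
  have h5 : ∏ k ∈ Finset.range N, xx N (2 * k + 3) = oddProd N * xx N (2 * N + 1) / x N 1 := by
    rw [← oddProd_shift hN, mul_div_cancel_left₀ _ h4]
  have h6 := oddProd_mul_xx_last (N := N)
  rw [xx_last, map_div₀, map_neg, map_add, map_mul, map_mul, map_pow, h.map_m, h.map_p,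
    h.map_oddProd, h.map_evenProd, h5, xx_last']
  field_simp
  linear_combination -h6

theorem map_xx (hN : 1 ≤ N) {j : ℕ} (h1 : 1 ≤ j) (h2 : j ≤ 2 * N + 1) : φ (xx N j) = xx N (j + 1) := by
  rcases (by omega : j ≤ 2 * N ∨ j = 2 * N + 1) with h3 | rfl
  · rw [xx_of_le h3, h.map_x' j h1 h3]
  · exact h.map_xx_last hN

end IsShift

end Shift

/-! ### Conjugation of the reflections by the rotation. -/

section Conjugation

variable {N : ℕ}

/-- Written with two indicator factors, a product over one parity class collapses to at most two
terms. -/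
theorem factor_eq_mul (i j : ℕ) : factor N i j =
    (if j + 1 = i then ratio N i else 1) * (if j = i + 1 then (ratio N i)⁻¹ else 1) := by
  unfold factor
  split_ifs with h1 h2
  · omega
  all_goals simp

theorem ratio_ne_zero {i : ℕ} (h1 : 1 ≤ i) (h2 : i ≤ 2 * N) : ratio N i ≠ 0 :=
  div_ne_zero (one_sub_A_mul_x_ne_zero h1 h2 i) (A_sub_x_ne_zero h1 h2 i)

/-- The neighbours i-1 and i+1 have the same parity and carry inverse multipliers, so they cancel
unless i = 2N, when i+1 falls outside the range. -/
theorem prod_factor_even_odd (l : ℕ) (hl : l < N) :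
    ∏ k ∈ Finset.range N, factor N (2 * l + 2) (2 * k + 1) =
      if l + 1 = N then ratio N (2 * l + 2) else 1 := by
  have h1 : ∀ k, (2 * k + 1 + 1 = 2 * l + 2) = (k = l) := fun k => by ext; omega
  have h2 : ∀ k, (2 * k + 1 = 2 * l + 2 + 1) = (k = l + 1) := fun k => by ext; omega
  simp only [factor_eq_mul, Finset.prod_mul_distrib, h1, h2, Finset.prod_ite_eq', Finset.mem_range]
  rw [if_pos hl]
  have := ratio_ne_zero (N := N) (i := 2 * l + 2) (by omega) (by omega)
  split_ifs
  · omega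
  · field_simp
  · simp
  · omega

theorem prod_factor_even_even (l : ℕ) :
    ∏ k ∈ Finset.range N, factor N (2 * l + 2) (2 * k + 2) = 1 :=
  Finset.prod_eq_one fun k _ => factor_of_ne (by omega) (by omega)

theorem prod_factor_odd_odd (l : ℕ) :
    ∏ k ∈ Finset.range N, factor N (2 * l + 1) (2 * k + 1) = 1 :=
  Finset.prod_eq_one fun k _ => factor_of_ne (by omega) (by omega)

theorem prod_factor_one_even (hN : 1 ≤ N) :
    ∏ k ∈ Finset.range N, factor N 1 (2 * k + 2) = (ratio N 1)⁻¹ := by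
  have h1 : ∀ k, (2 * k + 2 + 1 = 1) = False := fun k => eq_false (by omega)
  have h2 : ∀ k, (2 * k + 2 = 1 + 1) = (k = 0) := fun k => by ext; omega
  simp only [factor_eq_mul, Finset.prod_mul_distrib, h1, h2, Finset.prod_ite_eq', Finset.mem_range]
  simp [show 0 < N by omega]

theorem prod_factor_odd_even (l : ℕ) (hl : l + 1 < N) :
    ∏ k ∈ Finset.range N, factor N (2 * l + 3) (2 * k + 2) = 1 := by
  have h1 : ∀ k, (2 * k + 2 + 1 = 2 * l + 3) = (k = l) := fun k => by ext; omega
  have h2 : ∀ k, (2 * k + 2 = 2 * l + 3 + 1) = (k = l + 1) := fun k => by ext; omega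
  simp only [factor_eq_mul, Finset.prod_mul_distrib, h1, h2, Finset.prod_ite_eq', Finset.mem_range]
  rw [if_pos (by omega), if_pos hl]
  exact mul_inv_cancel₀ (ratio_ne_zero (by omega) (by omega))

namespace Refl

variable {i : ℕ} {φ : Bir N} (h : Refl N i φ)
include h

theorem map_p : φ (p N) = p N := by rw [p, map_pow, h.map_c]

theorem map_Q : φ (Q N) = Q N := by rw [Q, map_pow, h.map_q]

/-- Along the cyclic order 1, 2, …, 2N, 0 the exponents in `m` are 1, 2, …, 2N, 2N+1. They are
linear there, and a reflection sees only the second difference, which vanishes for 2 ≤ i ≤ 2N. -/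
theorem map_m (h1 : 2 ≤ i) (h2 : i ≤ 2 * N) : φ (m N) = m N := by
  have hi := a_ne_zero (N := N) i
  have e0 : (i : ZMod (2 * N + 1)).val = i := ZMod.val_natCast_of_lt (by omega)
  have e1 : ((i : ZMod (2 * N + 1)) - 1).val = i - 1 := by
    have := ZMod.val_natCast_of_lt (n := 2 * N + 1) (a := i - 1) (by omega)
    rwa [Nat.cast_sub (by omega), Nat.cast_one] at this
  rw [m, mm, map_mul, map_mul, h.map_prod_zpow, h.map_b, A, map_pow, h.map_a, mul_pow,
    ← zpow_natCast (_ ^ _), ← zpow_mul, e0, e1]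
  have key : ∀ (y z u v : K N) (e e' : ℤ), e + e' = 0 →
      y * a N i ^ e * (z * a N i ^ e' * v) = y * (z * v) := by
    intro y z u v e e' he
    have : a N i ^ e * a N i ^ e' = 1 := by rw [← zpow_add₀ hi, he, zpow_zero]
    linear_combination y * z * v * this
  refine key _ _ 0 _ _ _ ?_
  rcases (by omega : i < 2 * N ∨ i = 2 * N) with h3 | h3
  · have e2 : ((i : ZMod (2 * N + 1)) + 1).val = i + 1 := by
      have := ZMod.val_natCast_of_lt (n := 2 * N + 1) (a := i + 1) (by omega)
      rwa [Nat.cast_add, Nat.cast_one] at this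
    have e3 : cart (i : ZMod (2 * N + 1)) ((0 : ℕ) : ZMod (2 * N + 1)) = 0 := by
      refine cart_of_ne ?_ ?_ ?_
      · rw [Ne, natCast_zmod_inj (by omega) (by omega)]; omega
      · have e : (i : ZMod (2 * N + 1)) + 1 = (i + 1 : ℕ) := by push_cast; rfl
        rw [e, Ne, natCast_zmod_inj (by omega) (by omega)]; omega
      · have e : (i : ZMod (2 * N + 1)) - 1 = (i - 1 : ℕ) := by
          rw [Nat.cast_sub (by omega), Nat.cast_one]
        rw [e, Ne, natCast_zmod_inj (by omega) (by omega)]; omega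
    rw [e2, e3]
    push_cast [Nat.cast_sub (by omega : 1 ≤ i)]
    ring
  · have e4 : (i : ZMod (2 * N + 1)) + 1 = 0 := by
      have := ZMod.natCast_self (2 * N + 1)
      rw [Nat.cast_add, Nat.cast_one] at this
      rwa [h3]
    have e3 : cart (i : ZMod (2 * N + 1)) ((0 : ℕ) : ZMod (2 * N + 1)) = 1 := by
      have := cart_add_one (by omega : 1 ≤ N) (i : ZMod (2 * N + 1))
      rwa [e4, ← Nat.cast_zero] at this
    rw [e4, e3, ZMod.val_zero, h3]
    push_cast [Nat.cast_sub (by omega : 1 ≤ 2 * N)]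
    ring

theorem map_oddProd_eq : φ (oddProd N) =
    oddProd N * ∏ k ∈ Finset.range N, factor N i (2 * k + 1) := by
  rw [oddProd, map_prod, ← Finset.prod_mul_distrib]
  refine Finset.prod_congr rfl fun k hk => ?_
  have := Finset.mem_range.1 hk
  exact h.map_x _ (by omega) (by omega)

theorem map_evenProd_eq : φ (evenProd N) =
    evenProd N * ∏ k ∈ Finset.range N, factor N i (2 * k + 2) := by
  rw [evenProd, map_prod, ← Finset.prod_mul_distrib]
  refine Finset.prod_congr rfl fun k hk => ?_
  have := Finset.mem_range.1 hk
  exact h.map_x _ (by omega) (by omega)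

/-- The local rule for reflections persists on the continued sequence: this is what makes π
conjugate one reflection to the next at the end of the range. -/
theorem map_xx_last (h1 : 2 ≤ i) (h2 : i ≤ 2 * N) :
    φ (xx N (2 * N + 1)) = xx N (2 * N + 1) * factor N i (2 * N + 1) := by
  rw [xx_last, map_div₀, map_neg, map_add, map_mul, map_mul, map_pow, h.map_m h1 h2, h.map_p,
    h.map_oddProd_eq, h.map_evenProd_eq]
  obtain ⟨l, rfl | rfl⟩ : ∃ l, i = 2 * l + 2 ∨ i = 2 * l + 3 := ⟨(i - 2) / 2, by omega⟩
  · rw [prod_factor_even_even, mul_one, prod_factor_even_odd l (by omega), factor_eq_mul,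
      if_neg (by omega : ¬ 2 * N + 1 + 1 = 2 * l + 2), one_mul]
    have hl : (2 * N + 1 = 2 * l + 2 + 1) = (l + 1 = N) := by ext; omega
    simp only [hl]
    split_ifs
    · rw [← mul_assoc, ← div_div, div_eq_mul_inv _ (ratio N _)]
    · rw [mul_one, mul_one]
  · rw [prod_factor_odd_even l (by omega), show 2 * l + 3 = 2 * (l + 1) + 1 by ring,
      prod_factor_odd_odd, factor_of_ne (by omega) (by omega), mul_one, mul_one, mul_one]

omit h in
-- At i = 1 the neighbouring exponents are 2 and 2N+1, so the second difference is 2N+1 instead of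
-- zero.
theorem map_m_one (hN : 1 ≤ N) (h : Refl N 1 φ) : φ (m N) = A N 1 * m N := by
  have hi := a_ne_zero (N := N) (1 : ℕ)
  have e0 : ((1 : ℕ) : ZMod (2 * N + 1)).val = 1 := ZMod.val_natCast_of_lt (by omega)
  have e1 : (((1 : ℕ) : ZMod (2 * N + 1)) - 1).val = 0 := by simp
  have e2 : (((1 : ℕ) : ZMod (2 * N + 1)) + 1).val = 2 := by
    have := ZMod.val_natCast_of_lt (n := 2 * N + 1) (a := 1 + 1) (by omega)
    rwa [Nat.cast_add, Nat.cast_one] at this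
  have e3 : cart ((1 : ℕ) : ZMod (2 * N + 1)) ((0 : ℕ) : ZMod (2 * N + 1)) = 1 := by
    have := cart_sub_one hN ((1 : ℕ) : ZMod (2 * N + 1))
    rwa [Nat.cast_one, sub_self] at this
  rw [m, mm, map_mul, map_mul, h.map_prod_zpow, h.map_b, A, map_pow, h.map_a, mul_pow,
    e0, e1, e2, e3, A]
  simp
  ring

omit h in
-- The reflection with index 1 acts near the end of the continued sequence as one with index 2N+2,
-- where A_{2N+2} = A_1.
theorem map_xx_last_one (hN : 1 ≤ N) (h : Refl N 1 φ) :
    φ (xx N (2 * N + 1)) = xx N (2 * N + 1) *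
      ((1 - A N 1 * xx N (2 * N + 2)) / (A N 1 - xx N (2 * N + 2))) := by
  have h1 := oddProd_ne_zero (N := N)
  have h2 := evenProd_ne_zero (N := N)
  have h3 := p_ne_zero (N := N)
  have h4 := x_ne_zero (N := N) 1
  have h5 := A_sub_x_ne_zero (N := N) le_rfl (by omega) 1
  have h6 := one_sub_A_mul_x_ne_zero (N := N) le_rfl (by omega) 1
  have h7 := m_mul_p_add_evenProd_ne_zero (N := N)
  have e1 : A N 1 - xx N (2 * N + 2) =
      -((1 - A N 1 * x N 1) * (m N * p N + evenProd N)) / (x N 1 * evenProd N) := by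
    rw [xx_last']; field_simp; ring
  have e2 : 1 - A N 1 * xx N (2 * N + 2) =
      -((A N 1 - x N 1) * evenProd N + A N 1 * m N * p N * (1 - A N 1 * x N 1)) /
        (x N 1 * evenProd N) := by
    rw [xx_last']; field_simp; ring
  rw [e1, e2, xx_last, map_div₀, map_neg, map_add, map_mul, map_mul, map_pow, h.map_m_one hN,
    h.map_p, h.map_oddProd_eq, h.map_evenProd_eq, prod_factor_one_even hN,
    show ∏ k ∈ Finset.range N, factor N 1 (2 * k + 1) = 1 from prod_factor_odd_odd 0, ratio]
  field_simp
  ring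

omit h in
-- In its role as the reflection with index 2N+2 it leaves its own central variable alone.
theorem map_xx_last'_one (hN : 1 ≤ N) (h : Refl N 1 φ) :
    φ (xx N (2 * N + 2)) = xx N (2 * N + 2) := by
  have h2 := evenProd_ne_zero (N := N)
  have h4 := x_ne_zero (N := N) 1
  have h5 := A_sub_x_ne_zero (N := N) le_rfl (by omega) 1
  have h6 := one_sub_A_mul_x_ne_zero (N := N) le_rfl (by omega) 1
  have h8 := A_ne_zero (N := N) 1
  rw [xx_last', map_div₀, map_add, map_one, map_div₀, map_mul, map_mul, map_sub, map_mul, map_one,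
    h.map_m_one hN, h.map_p, h.map_evenProd_eq, prod_factor_one_even hN,
    h.map_x_of_ne (j := 1) le_rfl (by omega) (by omega) (by omega), h.map_A_self hN, ratio]
  field_simp

end Refl

namespace IsShift

variable {π : Bir N} (h : IsShift N π)
include h

theorem map_ratio {i : ℕ} (h1 : 1 ≤ i) (h2 : i < 2 * N) : π (ratio N i) = ratio N (i + 1) := by
  rw [ratio, map_div₀, map_sub, map_sub, map_mul, map_one, h.map_A, h.map_x h1 h2, ratio]

theorem mul_refl {i : ℕ} {φ ψ : Bir N} (hφ : Refl N i φ) (hψ : Refl N (i + 1) ψ) (h1 : 1 ≤ i)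
    (h2 : i < 2 * N) : π * φ = ψ * π := by
  have hfac : ∀ j, π (factor N i j) = factor N (i + 1) (j + 1) := by
    intro j
    simp only [factor, add_left_inj]
    split_ifs
    · exact h.map_ratio h1 h2
    · rw [map_inv₀, h.map_ratio h1 h2]
    · exact map_one _
  refine bir_ext ?_ ?_ ?_ (fun k => ?_) fun k h7 h8 => ?_ <;>
    rw [AlgEquiv.mul_apply, AlgEquiv.mul_apply]
  · rw [hφ.map_t, h.map_t, hψ.map_t]
  · rw [hφ.map_b, h.map_b, map_mul, hψ.map_b, hψ.map_q]
  · rw [hφ.map_c, h.map_c, map_inv₀, hψ.map_c]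
  · rw [hφ.map_a, map_mul, map_zpow₀, h.map_a, h.map_a, hψ.map_a, Nat.cast_add, Nat.cast_one,
      cart_add]
  · rw [hφ.map_x k h7 h8, map_mul, hfac, h.map_x' k h7 h8]
    rcases (by omega : k < 2 * N ∨ k = 2 * N) with h9 | rfl
    · rw [xx_of_le h9, hψ.map_x _ (by omega) h9]
    · rw [hψ.map_xx_last (by omega) (by omega)]

/-- Since s_0 is defined as a conjugate of s_1, passing from 2N to 0 is expressed by two steps of π,
from 2N directly to 1. -/
theorem sq_mul_refl (hN : 1 ≤ N) {φ ψ : Bir N} (hφ : Refl N (2 * N) φ) (hψ : Refl N 1 ψ) :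
    π * π * φ = ψ * (π * π) := by
  have hlast : ((2 * N : ℕ) : ZMod (2 * N + 1)) + 1 = 0 := by
    have := ZMod.natCast_self (2 * N + 1)
    rwa [Nat.cast_add, Nat.cast_one] at this
  have hrat : π (π (ratio N (2 * N))) =
      (1 - A N 1 * xx N (2 * N + 2)) / (A N 1 - xx N (2 * N + 2)) := by
    simp only [ratio, map_div₀, map_sub, map_mul, map_one, h.map_A, h.map_x' (2 * N) (by omega) le_rfl,
      h.map_xx_last hN]
    rw [show 2 * N + 1 + 1 = 1 + (2 * N + 1) by ring, A_add]
  have hx : ∀ k, 1 ≤ k → k ≤ 2 * N → π (π (x N k)) = xx N (k + 2) := fun k h7 h8 => by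
    rw [h.map_x' k h7 h8, h.map_xx hN (by omega) (by omega)]
  refine bir_ext ?_ ?_ ?_ (fun k => ?_) fun k h7 h8 => ?_ <;>
    simp only [AlgEquiv.mul_apply]
  · simp only [hφ.map_t, h.map_t, hψ.map_t]
  · simp only [hφ.map_b, h.map_b, map_mul, hψ.map_b, hψ.map_q, h.map_q]
  · simp only [hφ.map_c, h.map_c, map_inv₀, hψ.map_c]
  · simp only [hφ.map_a, map_mul, map_zpow₀, h.map_a, hψ.map_a]
    have : ((2 * N : ℕ) : ZMod (2 * N + 1)) + 1 + 1 = (1 : ℕ) := by rw [hlast]; simp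
    rw [this, ← cart_add _ k (1 + 1), ← add_assoc, this, ← add_assoc]
  · rw [hφ.map_x k h7 h8, map_mul, map_mul, hx k h7 h8]
    rcases (by omega : k + 2 ≤ 2 * N ∨ k + 1 = 2 * N ∨ k = 2 * N) with h9 | h9 | rfl
    · rw [xx_of_le h9, factor_of_ne (by omega) (by omega), map_one, map_one, mul_one,
        hψ.map_x_of_ne (by omega) h9 (by omega) (by omega)]
    · rw [factor, if_pos h9, hrat, show k + 2 = 2 * N + 1 by omega, hψ.map_xx_last_one hN]
    · rw [factor_of_ne (by omega) (by omega), map_one, map_one, mul_one, hψ.map_xx_last'_one hN]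

end IsShift

end Conjugation

/-! ### The original formulas for π, and the reversal w_1. -/

section Flip

variable {N : ℕ}

/-- Inverting c and changing the parity of the index have opposite effects on the normalization, so
they compensate. -/
theorem map_f_eq_of_map_c_inv {φ : Bir N} (hc : φ (c N) = (c N)⁻¹) {j k : ℕ}
    (hjk : Even (j - 1) ↔ ¬ Even (k - 1)) : φ (f N j) = φ (x N j) * lam N (k - 1) ^ 2 := by
  rw [map_f_eq, rescale, hc, inv_inv, lam]
  by_cases h : Even (j - 1)
  · rw [if_pos h, if_neg (hjk.1 h)]
  · rw [if_neg h, if_pos (not_not.1 (fun h' => h (hjk.2 h')))]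

theorem prod_Icc_one {R : Type*} [CommMonoid R] (F : ℕ → R) (n : ℕ) :
    ∏ k ∈ Finset.Icc 1 n, F k = ∏ k ∈ Finset.range n, F (k + 1) := by
  rw [Finset.range_eq_Ico, Finset.prod_Ico_add' F 0 n 1]
  rfl

theorem prod_f_odd : ∏ k ∈ Finset.Icc 1 N, f N (2 * k - 1) = c N ^ (2 * N) * oddProd N := by
  rw [prod_Icc_one]
  have : ∀ k ∈ Finset.range N, f N (2 * (k + 1) - 1) = x N (2 * k + 1) * c N ^ 2 :=
    fun k _ => f_odd k
  rw [Finset.prod_congr rfl this, Finset.prod_mul_distrib, Finset.prod_const, Finset.card_range,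
    ← pow_mul, oddProd, mul_comm]

theorem prod_f_even : ∏ k ∈ Finset.Icc 1 N, f N (2 * k) = evenProd N / c N ^ (2 * N) := by
  rw [prod_Icc_one]
  have : ∀ k ∈ Finset.range N, f N (2 * (k + 1)) = x N (2 * k + 2) / c N ^ 2 :=
    fun k _ => f_even k
  rw [Finset.prod_congr rfl this, Finset.prod_div_distrib, Finset.prod_const, Finset.card_range,
    ← pow_mul, evenProd]

theorem prod_pow_eq : ∏ k : ZMod (2 * N + 1), a N k ^ (k.val : ℤ) =
    ∏ k ∈ Finset.range (2 * N + 1), a N k ^ k := by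
  rw [prod_zmod (2 * N)]
  refine Finset.prod_congr rfl fun k hk => ?_
  rw [ZMod.val_natCast_of_lt (Finset.mem_range.1 hk), zpow_natCast]

/-- The exponents k and 2N-k add up to 2N for every index, and the product of all a_k is q. -/
theorem mm_eq : mm N = q N ^ (2 * N) * b N / ∏ i ∈ Finset.range (2 * N), a N i ^ (2 * N - i) := by
  have hne : ∏ i ∈ Finset.range (2 * N), a N i ^ (2 * N - i) ≠ 0 :=
    Finset.prod_ne_zero_iff.2 fun _ _ => pow_ne_zero _ (a_ne_zero _)
  have h1 : ∏ i ∈ Finset.range (2 * N), a N i ^ (2 * N - i) =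
      ∏ i ∈ Finset.range (2 * N + 1), a N i ^ (2 * N - i) := by
    rw [Finset.prod_range_succ, Nat.sub_self, pow_zero, mul_one]
  rw [eq_div_iff hne, h1, mm, prod_pow_eq, mul_right_comm, ← Finset.prod_mul_distrib, ← prod_a,
    prod_zmod (2 * N), ← Finset.prod_pow]
  congr 1
  refine Finset.prod_congr rfl fun k hk => ?_
  have := Finset.mem_range.1 hk
  rw [← pow_add]
  congr 1
  omega

theorem mm_eq_prod_Icc : mm N = (∏ k ∈ Finset.Icc 1 (2 * N), a N k ^ k) * b N := by
  rw [mm, prod_pow_eq, prod_Icc_one (fun k : ℕ => a N k ^ k), Finset.prod_range_succ', pow_zero,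
    mul_one]

theorem m_eq (hN : 1 ≤ N) : m N = q N ^ (2 * N) * a N 0 * b N /
    ∏ k ∈ Finset.Icc 1 (2 * N - 1), a N k ^ (2 * N - k) := by
  have h1 : ∏ i ∈ Finset.range (2 * N), a N i ^ (2 * N - i) =
      (∏ k ∈ Finset.Icc 1 (2 * N - 1), a N k ^ (2 * N - k)) * a N 0 ^ (2 * N) := by
    have h := Finset.prod_range_succ' (fun i : ℕ => a N i ^ (2 * N - i)) (2 * N - 1)
    rw [Nat.sub_add_cancel (by omega : 1 ≤ 2 * N), Nat.cast_zero, Nat.sub_zero] at h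
    rw [h, prod_Icc_one (fun k : ℕ => a N k ^ (2 * N - k))]
  have h2 : ∏ k ∈ Finset.Icc 1 (2 * N - 1), a N k ^ (2 * N - k) ≠ 0 :=
    Finset.prod_ne_zero_iff.2 fun _ _ => pow_ne_zero _ (a_ne_zero _)
  have h3 := a_ne_zero (N := N) 0
  rw [m, mm_eq, h1, A, Nat.cast_zero, pow_succ]
  field_simp

theorem IsShift.isPi (hN : 1 ≤ N) {φ : Bir N} (h : IsShift N φ) : IsPi N φ where
  map_t := h.map_t
  map_b := h.map_b
  map_c := h.map_c
  map_a := h.map_a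
  map_f j h1 h2 := by
    rw [map_f_eq_of_map_c_inv h.map_c (k := j + 1) (by
      rw [Nat.even_iff, Nat.even_iff]; omega), h.map_x h1 (by omega), f_eq]
  map_f_last := by
    have e1 := oddProd_ne_zero (N := N)
    have e2 := c_ne_zero (N := N)
    have e3 : c N ^ (2 * N) = p N * c N := by
      rw [p, ← pow_succ]; congr 1; omega
    have e4 := p_ne_zero (N := N)
    obtain ⟨l, hl⟩ : ∃ l, N = l + 1 := ⟨N - 1, by omega⟩
    have e5 : f N (2 * N) = x N (2 * N) / c N ^ 2 := by
      have := f_even (N := N) l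
      rwa [show 2 * l + 2 = 2 * N by omega] at this
    rw [← div_div, ← m_eq hN, prod_f_odd, prod_f_even, e5, map_div₀, map_pow, h.map_c,
      h.map_x' _ (by omega) le_rfl, xx_last, e3]
    field_simp
    ring

/-- The transformation `w_1` in terms of the normalized variables. -/
structure IsFlip (N : ℕ) (φ : Bir N) : Prop where
  map_t : φ (t N) = (t N)⁻¹
  map_b : φ (b N) = Q N * b N
  map_c : φ (c N) = (c N)⁻¹
  map_a : ∀ j, φ (a N j) = (a N (-j))⁻¹
  map_x : ∀ j, 1 ≤ j → j ≤ 2 * N → φ (x N j) = x N (2 * N + 1 - j)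

theorem exists_isFlip (N : ℕ) : ∃ φ : Bir N, IsFlip N φ := by
  suffices hL : ∀ L : IntermediateField ℂ (K N), (t N)⁻¹ ∈ L → Q N * b N ∈ L → (c N)⁻¹ ∈ L →
      (∀ j, (a N (-j))⁻¹ ∈ L) → (∀ j, 1 ≤ j → j ≤ 2 * N → x N (2 * N + 1 - j) ∈ L) →
      t N ∈ L ∧ b N ∈ L ∧ c N ∈ L ∧ (∀ i, a N i ∈ L) ∧
        ∀ j, 1 ≤ j → j ≤ 2 * N → x N j ∈ L by
    obtain ⟨φ, ht, hb, hc, ha, hx⟩ := exists_bir_of_generate (N := N) (t N)⁻¹ (Q N * b N) (c N)⁻¹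
      (fun j => (a N (-j))⁻¹) (fun j => x N (2 * N + 1 - j)) (inv_ne_zero c_ne_zero)
      (eq_div_of_prod_eq (fun j => (a N (-j))⁻¹) (fun _ => inv_ne_zero (a_ne_zero _)) (by
        rw [Finset.prod_inv_distrib, inv_pow, ← q, ← prod_a]
        congr 1
        exact Fintype.prod_equiv (Equiv.neg _) _ _ fun _ => rfl)) hL
    exact ⟨φ, ht, hb, hc, ha, hx⟩
  intro L ht hb hc ha hx
  have ht' : t N ∈ L := by simpa using inv_mem ht
  have hQ : Q N ∈ L := pow_mem (pow_mem ht' _) _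
  refine ⟨ht', ?_, by simpa using inv_mem hc, fun i => by simpa using inv_mem (ha (-i)),
    fun j h1 h2 => ?_⟩
  · have := div_mem hb hQ
    rwa [mul_div_cancel_left₀ _ Q_ne_zero] at this
  · have := hx (2 * N + 1 - j) (by omega) (by omega)
    rwa [Nat.sub_sub_self (by omega)] at this

theorem prod_range_reflect' {R : Type*} [CommMonoid R] (F G : ℕ → R) (n : ℕ)
    (h : ∀ k, k < n → F k = G (n - 1 - k)) :
    ∏ k ∈ Finset.range n, F k = ∏ k ∈ Finset.range n, G k := by
  rw [← Finset.prod_range_reflect]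
  exact Finset.prod_congr rfl fun k hk => by
    have hk := Finset.mem_range.1 hk
    rw [h _ (by omega)]; congr 1; omega

namespace IsFlip

variable {φ : Bir N} (h : IsFlip N φ)
include h

theorem isW1 : IsW1 N φ where
  map_t := h.map_t
  map_b := h.map_b
  map_c := h.map_c
  map_a j := by rw [h.map_a, ZMod.natCast_self, zero_sub]
  map_f j h1 h2 := by
    rw [map_f_eq_of_map_c_inv h.map_c (k := 2 * N + 1 - j) ?_, h.map_x j h1 h2, f_eq]
    rw [Nat.even_iff, Nat.even_iff]
    omega

theorem map_q : φ (q N) = (q N)⁻¹ := by rw [q, map_pow, h.map_t, inv_pow]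

theorem map_Q : φ (Q N) = (Q N)⁻¹ := by rw [Q, map_pow, h.map_q, inv_pow]

theorem map_p : φ (p N) = (p N)⁻¹ := by rw [p, map_pow, h.map_c, inv_pow]

theorem map_A {i : ℕ} (hi : i ≤ 2 * N + 1) : φ (A N i) = (A N (2 * N + 1 - i))⁻¹ := by
  rw [A, map_pow, h.map_a, A, inv_pow, Nat.cast_sub hi, ZMod.natCast_self, zero_sub]

theorem map_A_zero : φ (A N 0) = (A N 0)⁻¹ := by
  rw [h.map_A (Nat.zero_le _), Nat.sub_zero]
  congr 1
  simpa using A_add (N := N) 0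

/-- For k ≠ 0 the representative of -k is 2N+1-k, so inversion reproduces the exponents up to the
factor 1/Q, which w_1(b) = Q b cancels. The index 0, where the representative is 0, leaves the extra
A_0. -/
theorem map_mm : φ (mm N) = m N := by
  have hQ := Q_ne_zero (N := N)
  have e1 : φ (∏ k : ZMod (2 * N + 1), a N k ^ (k.val : ℤ)) =
      ∏ k : ZMod (2 * N + 1), a N k ^ (-((-k).val : ℤ)) := by
    rw [map_prod]
    refine Fintype.prod_equiv (Equiv.neg _) _ _ fun k => ?_
    simp [h.map_a]
  have e2 : ∀ k : ZMod (2 * N + 1), a N k ^ (-((-k).val : ℤ)) =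
      a N k ^ (k.val : ℤ) * (a N k ^ (2 * N + 1))⁻¹ * if k = 0 then A N 0 else 1 := by
    intro k
    have hk := a_ne_zero (N := N) k
    split_ifs with h0
    · subst h0
      rw [A, Nat.cast_zero, mul_assoc, inv_mul_cancel₀ (pow_ne_zero _ hk)]
      simp
    · have : NeZero k := ⟨h0⟩
      rw [ZMod.val_neg_of_ne_zero, mul_one, ← zpow_natCast, ← zpow_neg, ← zpow_add₀ hk,
        Nat.cast_sub (ZMod.val_lt k).le]
      congr 1
      ring
  rw [mm, map_mul, e1, h.map_b, Finset.prod_congr rfl fun k _ => e2 k, Finset.prod_mul_distrib,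
    Finset.prod_mul_distrib, Finset.prod_inv_distrib, Finset.prod_pow, prod_a, ← Q,
    Finset.prod_ite_eq' , m, mm, if_pos (Finset.mem_univ _)]
  field_simp

theorem map_m : φ (m N) = mm N := by
  rw [m, map_mul, h.map_A_zero, h.map_mm, m, inv_mul_cancel_left₀ (A_ne_zero _)]

theorem mul_self : φ * φ = 1 := by
  refine bir_ext ?_ ?_ ?_ (fun j => ?_) fun j h3 h4 => ?_ <;>
    rw [AlgEquiv.mul_apply, AlgEquiv.one_apply]
  · rw [h.map_t, map_inv₀, h.map_t, inv_inv]
  · rw [h.map_b, map_mul, h.map_Q, h.map_b, inv_mul_cancel_left₀ Q_ne_zero]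
  · rw [h.map_c, map_inv₀, h.map_c, inv_inv]
  · rw [h.map_a, map_inv₀, h.map_a, inv_inv, neg_neg]
  · rw [h.map_x j h3 h4, h.map_x _ (by omega) (by omega), Nat.sub_sub_self (by omega)]

theorem map_ratio {i : ℕ} (h1 : 1 ≤ i) (h2 : i ≤ 2 * N) :
    φ (ratio N i) = (ratio N (2 * N + 1 - i))⁻¹ := by
  have e1 := A_ne_zero (N := N) (2 * N + 1 - i)
  have e2 := A_sub_x_ne_zero (N := N) (m := 2 * N + 1 - i) (by omega) (by omega) (2 * N + 1 - i)
  have e3 := one_sub_A_mul_x_ne_zero (N := N) (m := 2 * N + 1 - i) (by omega) (by omega)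
    (2 * N + 1 - i)
  rw [ratio, map_div₀, map_sub, map_sub, map_mul, map_one, h.map_A (by omega), h.map_x i h1 h2,
    ratio, inv_div, ← mul_div_mul_left _ _ e1]
  congr 1 <;> field_simp

theorem mul_refl {i : ℕ} {σ τ : Bir N} (hσ : Refl N i σ) (hτ : Refl N (2 * N + 1 - i) τ)
    (h1 : 1 ≤ i) (h2 : i ≤ 2 * N) : φ * σ = τ * φ := by
  refine bir_ext ?_ ?_ ?_ (fun k => ?_) fun k h7 h8 => ?_ <;>
    rw [AlgEquiv.mul_apply, AlgEquiv.mul_apply]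
  · rw [hσ.map_t, h.map_t, map_inv₀, hτ.map_t]
  · rw [hσ.map_b, h.map_b, map_mul, hτ.map_b, hτ.map_Q]
  · rw [hσ.map_c, h.map_c, map_inv₀, hτ.map_c]
  · have e : ((2 * N + 1 - i : ℕ) : ZMod (2 * N + 1)) = -i := by
      rw [Nat.cast_sub (by omega), ZMod.natCast_self, zero_sub]
    rw [hσ.map_a, map_mul, map_zpow₀, h.map_a, h.map_a, map_inv₀, hτ.map_a, e, cart_neg,
      mul_inv, inv_zpow]
  · rw [hσ.map_x k h7 h8, map_mul, h.map_x k h7 h8, hτ.map_x _ (by omega) (by omega)]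
    congr 1
    unfold factor
    split_ifs
    any_goals omega
    · rw [h.map_ratio h1 h2]
    · rw [map_inv₀, h.map_ratio h1 h2, inv_inv]
    · exact map_one _

omit h in
-- The composite sends x_j to x_{2N+2-j}; only j = 1, whose image is the continued term x_{2N+1},
-- requires a computation.
theorem shift_mul_flip_sq (hN : 1 ≤ N) {π w : Bir N} (hπ : IsShift N π) (hw : IsFlip N w) :
    π * w * (π * w) = 1 := by
  have hx : ∀ j, 1 ≤ j → j ≤ 2 * N → π (w (x N j)) = xx N (2 * N + 2 - j) := by
    intro j h1 h2
    rw [hw.map_x j h1 h2, hπ.map_x' _ (by omega) (by omega)]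
    congr 1; omega
  refine bir_ext ?_ ?_ ?_ (fun j => ?_) fun j h3 h4 => ?_ <;>
    simp only [AlgEquiv.mul_apply, AlgEquiv.one_apply]
  · simp [hw.map_t, hπ.map_t]
  · have := q_ne_zero (N := N)
    have := Q_ne_zero (N := N)
    simp only [hw.map_b, hπ.map_b, hw.map_q, hw.map_Q, hπ.map_q, hπ.map_Q, map_mul, map_inv₀]
    field_simp
  · simp [hw.map_c, hπ.map_c]
  · simp [hw.map_a, hπ.map_a]
  · rw [hx j h3 h4]
    rcases (by omega : j = 1 ∨ 2 ≤ j) with rfl | h5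
    · have e1 : π (w (oddProd N)) = ∏ k ∈ Finset.range N, xx N (2 * k + 3) := by
        rw [oddProd, map_prod, map_prod]
        refine prod_range_reflect' _ _ _ fun k hk => ?_
        rw [hx _ (by omega) (by omega)]
        congr 1; omega
      have e2 : π (w (evenProd N)) = evenProd N := by
        rw [evenProd, map_prod, map_prod]
        refine prod_range_reflect' _ _ _ fun k hk => ?_
        rw [hx _ (by omega) (by omega), xx_of_le (by omega)]
        congr 1; omega
      have e3 := oddProd_mul_xx_last (N := N)
      rw [← oddProd_shift hN] at e3
      have e4 : ∏ k ∈ Finset.range N, xx N (2 * k + 3) ≠ 0 := by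
        intro h0
        rw [h0] at e3
        exact m_mul_p_add_evenProd_ne_zero (N := N) (by linear_combination e3)
      have e5 := p_ne_zero (N := N)
      rw [show 2 * N + 2 - 1 = 2 * N + 1 by omega, xx_last]
      simp only [map_div₀, map_neg, map_add, map_mul, map_pow, hw.map_p, hw.map_m, hπ.map_mm,
        hπ.map_p, map_inv₀, inv_inv, e1, e2]
      rw [← e3]
      field_simp
    · rw [xx_of_le (by omega), hx _ (by omega) (by omega), xx_of_le (by omega)]
      congr 1; omega

end IsFlip

end Flip

/-! ### The chain θ and the explicit form of μ. -/

section Chain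

variable {N : ℕ}

/-- The multiplier `1 / (q ^ (2N+1) c ^ (4N-2))`. -/
def kappa (N : ℕ) : K N := (Q N * p N ^ 2)⁻¹

/-- `m / (q ^ (2N+1) c ^ (2N-1) x_2 x_4 ⋯ x_{2N})`. -/
def beta (N : ℕ) : K N := m N / (p N * Q N * evenProd N)

/-- `x_j / a_j ^ (2N+1)` for odd `j`, and `1 / (a_j ^ (2N+1) x_j)` for even `j`. -/
def rho (N j : ℕ) : K N := if Even j then (A N j * xx N j)⁻¹ else xx N j / A N j

/-- The product of `rho N 1, …, rho N j`. -/
def E (N j : ℕ) : K N := ∏ i ∈ Finset.range j, rho N (i + 1)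

/-- The alternating sum of `E N 0, …, E N (j - 1)`. -/
def S (N j : ℕ) : K N := ∑ i ∈ Finset.range j, (-1) ^ i * E N i

/-- The shift of `S N j` that satisfies `theta N (2N+2) = kappa N * theta N 1`. -/
def theta (N j : ℕ) : K N := -(S N (2 * N + 1) + beta N) / (1 - kappa N) + S N j

theorem rho_odd (k : ℕ) : rho N (2 * k + 1) = xx N (2 * k + 1) / A N (2 * k + 1) := by
  rw [rho, if_neg (by simp)]

theorem rho_even (k : ℕ) : rho N (2 * k + 2) = (A N (2 * k + 2) * xx N (2 * k + 2))⁻¹ := by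
  rw [rho, if_pos (by simp [Nat.even_add])]

theorem xx_ne_zero {j : ℕ} (hj : j ≤ 2 * N + 1) : xx N j ≠ 0 := by
  rcases (by omega : j ≤ 2 * N ∨ j = 2 * N + 1) with h | rfl
  · rw [xx_of_le h]; exact x_ne_zero j
  · exact xx_last_ne_zero

theorem rho_ne_zero {j : ℕ} (hj : j ≤ 2 * N + 1) : rho N j ≠ 0 := by
  unfold rho
  split_ifs
  · exact inv_ne_zero (mul_ne_zero (A_ne_zero _) (xx_ne_zero hj))
  · exact div_ne_zero (xx_ne_zero hj) (A_ne_zero _)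

theorem E_zero : E N 0 = 1 := rfl

theorem E_succ (j : ℕ) : E N (j + 1) = E N j * rho N (j + 1) := Finset.prod_range_succ _ _

theorem E_ne_zero {j : ℕ} (hj : j ≤ 2 * N + 1) : E N j ≠ 0 :=
  Finset.prod_ne_zero_iff.2 fun i hi => rho_ne_zero (by have := Finset.mem_range.1 hi; omega)

theorem S_zero : S N 0 = 0 := rfl

theorem S_succ (j : ℕ) : S N (j + 1) = S N j + (-1) ^ j * E N j := Finset.sum_range_succ _ _

theorem theta_succ (j : ℕ) : theta N (j + 1) = theta N j + (-1) ^ j * E N j := by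
  rw [theta, theta, S_succ j, add_assoc]

theorem theta_one : theta N 1 = theta N 0 + 1 := by
  rw [theta_succ, E_zero]; ring

theorem theta_eq (j : ℕ) : theta N j = theta N 0 + S N j := by
  simp [theta, S_zero]

theorem theta_succ_odd (k : ℕ) : theta N (2 * k + 2) = theta N (2 * k + 1) - E N (2 * k + 1) := by
  rw [theta_succ, pow_succ, pow_mul]; ring

theorem theta_succ_even (k : ℕ) : theta N (2 * k + 1) = theta N (2 * k) + E N (2 * k) := by
  rw [theta_succ, pow_mul]; ring

theorem kappa_ne_zero : kappa N ≠ 0 := inv_ne_zero (mul_ne_zero Q_ne_zero (pow_ne_zero _ p_ne_zero))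

theorem beta_ne_zero : beta N ≠ 0 :=
  div_ne_zero m_ne_zero (mul_ne_zero (mul_ne_zero p_ne_zero Q_ne_zero) evenProd_ne_zero)

theorem one_sub_kappa_ne_zero (hN : 1 ≤ N) : 1 - kappa N ≠ 0 := by
  intro h
  have h1 : Q N * p N ^ 2 = 1 := by
    have : kappa N = 1 := by linear_combination -h
    rwa [kappa, inv_eq_one] at this
  obtain ⟨φ, ht, -, hc, -, -⟩ := exists_scaling_c N
  have h2 := congrArg φ h1
  have h3 : φ (Q N * p N ^ 2) = Q N * p N ^ 2 * 2 ^ ((2 * N - 1) * 2) := by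
    simp only [Q, p, q, map_mul, map_pow, ht, hc, mul_pow]
    ring
  rw [h3, h1, one_mul, map_one] at h2
  have h4 : (2 : ℕ) ^ ((2 * N - 1) * 2) = 1 := by exact_mod_cast h2
  rw [Nat.pow_eq_one] at h4
  omega

theorem E_two_mul_aux {n : ℕ} (hn : n ≤ N) : E N (2 * n) * ((∏ i ∈ Finset.range (2 * n), A N (i + 1)) *
    ∏ k ∈ Finset.range n, x N (2 * k + 2)) = ∏ k ∈ Finset.range n, x N (2 * k + 1) := by
  induction n with
  | zero => simp [E_zero]
  | succ n ih =>
    have h1 := A_ne_zero (N := N) (2 * n + 1)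
    have h2 := A_ne_zero (N := N) (2 * n + 2)
    have h3 := x_ne_zero (N := N) (2 * n + 2)
    rw [Finset.prod_range_succ, Finset.prod_range_succ, ← ih (by omega),
      show 2 * (n + 1) = 2 * n + 1 + 1 by ring, E_succ, E_succ, rho_odd, rho_even,
      Finset.prod_range_succ, Finset.prod_range_succ, xx_of_le (by omega), xx_of_le (by omega)]
    field_simp

theorem prod_A_succ : (∏ i ∈ Finset.range (2 * N), A N (i + 1)) * A N 0 = Q N := by
  rw [← prod_A, Finset.prod_range_succ']

theorem E_two_mul : E N (2 * N) * (Q N * evenProd N) = oddProd N * A N 0 := by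
  rw [oddProd, ← E_two_mul_aux le_rfl, ← prod_A_succ, evenProd]
  ring

/-- The closing formula for x_{2N+1} evaluates the product of all 2N+1 links. This is where b enters
the chain. -/
theorem E_last : E N (2 * N + 1) = -kappa N - beta N := by
  have h1 := oddProd_ne_zero (N := N)
  have h2 := evenProd_ne_zero (N := N)
  have h3 := p_ne_zero (N := N)
  have h4 := Q_ne_zero (N := N)
  have h5 := A_ne_zero (N := N) 0
  have h6 := E_two_mul (N := N)
  have h7 : A N (2 * N + 1) = A N 0 := by simpa using A_add (N := N) 0
  have h8 : E N (2 * N) = oddProd N * A N 0 / (Q N * evenProd N) := by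
    rw [eq_div_iff (mul_ne_zero h4 h2), h6]
  rw [E_succ, rho_odd, h7, h8, xx_last, kappa, beta]
  field_simp
  ring

theorem kappa_mul_theta_zero (hN : 1 ≤ N) :
    kappa N * theta N 0 = theta N (2 * N + 1) + beta N := by
  have h := one_sub_kappa_ne_zero hN
  rw [theta, theta, S_zero]
  field_simp
  ring

/-- This quasi-periodicity is the reason for the choice of the additive constant in `theta`. -/
theorem theta_last (hN : 1 ≤ N) : theta N (2 * N + 2) = kappa N * theta N 1 := by
  rw [theta_succ_odd, E_last, theta_one, mul_add, kappa_mul_theta_zero hN]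
  ring

/-- Up to j = 2N+1 the sums S_j are free of b, whereas β is proportional to b; so θ_j is affine in b
with nonzero slope. The last index, whose sum does involve b, is reduced to θ_1 by
quasi-periodicity. -/
theorem theta_ne_zero (hN : 1 ≤ N) {j : ℕ} (hj : j ≤ 2 * N + 2) : theta N j ≠ 0 := by
  suffices h : ∀ j, j ≤ 2 * N + 1 → theta N j ≠ 0 by
    rcases (by omega : j ≤ 2 * N + 1 ∨ j = 2 * N + 2) with h1 | rfl
    · exact h j h1
    · rw [theta_last hN]
      exact mul_ne_zero kappa_ne_zero (h 1 (by omega))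
  clear hj j
  intro j hj h0
  obtain ⟨φ, ht, hb, hc, ha, hx⟩ := exists_scaling_b N
  have hρ : ∀ i, 1 ≤ i → i ≤ 2 * N → φ (rho N i) = rho N i := by
    intro i h1 h2
    unfold rho
    rw [xx_of_le h2]
    split_ifs <;> simp [A, ha, hx i h1 h2]
  have hE : ∀ i, i ≤ 2 * N → φ (E N i) = E N i := by
    intro i hi
    rw [E, map_prod]
    exact Finset.prod_congr rfl fun k hk => hρ _ (by omega) (by
      have := Finset.mem_range.1 hk; omega)
  have hS : ∀ i, i ≤ 2 * N + 1 → φ (S N i) = S N i := by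
    intro i hi
    rw [S, map_sum]
    refine Finset.sum_congr rfl fun k hk => ?_
    rw [map_mul, map_pow, map_neg, map_one, hE k (by have := Finset.mem_range.1 hk; omega)]
  have hp : φ (p N) = p N := by rw [p, map_pow, hc]
  have hQ : φ (Q N) = Q N := by rw [Q, q, map_pow, map_pow, ht]
  have hEv : φ (evenProd N) = evenProd N := by
    rw [evenProd, map_prod]
    exact Finset.prod_congr rfl fun k hk => hx _ (by omega) (by
      have := Finset.mem_range.1 hk; omega)
  have hβ : φ (beta N) = 2 * beta N := by
    rw [beta, map_div₀, map_x_scaling_m hb ha, map_mul, map_mul, hp, hQ, hEv, mul_div_assoc]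
  have h1 := one_sub_kappa_ne_zero hN
  have h2 := congrArg φ h0
  rw [theta, map_add, map_div₀, map_neg, map_add, hS _ le_rfl, hβ, hS _ hj, map_sub, map_one, kappa,
    map_inv₀, map_mul, map_pow, hQ, hp, ← kappa, map_zero] at h2
  rw [theta] at h0
  refine beta_ne_zero (N := N) ?_
  field_simp at h0 h2
  linear_combination h0 - h2

/-- The image of `x_j` under `μ`, for `1 ≤ j ≤ 2N`. -/
def muX (N j : ℕ) : K N :=
  xx N j * if Even j then theta N (j + 1) / theta N (j - 1) else theta N (j - 1) / theta N (j + 1)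

theorem muX_odd (k : ℕ) :
    muX N (2 * k + 1) = xx N (2 * k + 1) * (theta N (2 * k) / theta N (2 * k + 2)) := by
  rw [muX, if_neg (by simp)]; rfl

theorem muX_even (k : ℕ) :
    muX N (2 * k + 2) = xx N (2 * k + 2) * (theta N (2 * k + 3) / theta N (2 * k + 1)) := by
  rw [muX, if_pos (by simp [Nat.even_add])]; rfl

/-- Since (-1)^i E_i = θ_{i+1} - θ_i, each summand is θ_0 θ_1 (1/θ_i - 1/θ_{i+1}) and the sum
telescopes. -/
theorem sum_E_div_theta (hN : 1 ≤ N) {j : ℕ} (hj : j ≤ 2 * N + 1) :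
    ∑ i ∈ Finset.range j, (-1) ^ i * (E N i * (theta N 0 * theta N 1 / (theta N i * theta N (i + 1))))
      = theta N 1 - theta N 0 * theta N 1 / theta N j := by
  induction j with
  | zero =>
    have := theta_ne_zero hN (Nat.zero_le (2 * N + 2))
    simp; field_simp; ring
  | succ j ih =>
    have h1 := theta_ne_zero hN (by omega : j ≤ 2 * N + 2)
    have h2 := theta_ne_zero hN (by omega : j + 1 ≤ 2 * N + 2)
    rw [Finset.sum_range_succ, ih (by omega)]
    have h3 := theta_succ (N := N) j
    have h4 : (-1) ^ j * E N j = theta N (j + 1) - theta N j := by rw [h3]; ring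
    rw [← mul_assoc, h4]
    field_simp
    ring

/-- The two summands on the right will be μ(S_{2N+1}) and μ(β), and κ goes to its inverse; this
identity therefore yields μ(θ_0) = -θ_1. -/
theorem one_sub_kappa_inv_mul_theta_one (hN : 1 ≤ N) : (1 - (kappa N)⁻¹) * theta N 1 =
    (theta N 1 - theta N 0 * theta N 1 / theta N (2 * N + 1)) +
      (kappa N)⁻¹ * beta N * theta N 1 / theta N (2 * N + 1) := by
  have h1 := theta_ne_zero hN (by omega : 2 * N + 1 ≤ 2 * N + 2)
  have h2 := kappa_ne_zero (N := N)
  have h3 := kappa_mul_theta_zero hN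
  have h4 : beta N = kappa N * theta N 0 - theta N (2 * N + 1) := by rw [h3]; ring
  rw [h4]
  field_simp
  ring

theorem prod_theta_even (hN : 1 ≤ N) {n : ℕ} (hn : n ≤ N) :
    ∏ k ∈ Finset.range n, (theta N (2 * k + 3) / theta N (2 * k + 1)) =
      theta N (2 * n + 1) / theta N 1 := by
  induction n with
  | zero => simp [div_self (theta_ne_zero hN (by omega : 1 ≤ 2 * N + 2))]
  | succ n ih =>
    have h1 := theta_ne_zero hN (by omega : 1 ≤ 2 * N + 2)
    have h2 := theta_ne_zero hN (by omega : 2 * n + 1 ≤ 2 * N + 2)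
    rw [Finset.prod_range_succ, ih (by omega), show 2 * (n + 1) + 1 = 2 * n + 3 by ring]
    field_simp

theorem prod_muX_even (hN : 1 ≤ N) : ∏ k ∈ Finset.range N, muX N (2 * k + 2) =
    evenProd N * (theta N (2 * N + 1) / theta N 1) := by
  rw [← prod_theta_even hN le_rfl, evenProd, ← Finset.prod_mul_distrib]
  refine Finset.prod_congr rfl fun k hk => ?_
  have := Finset.mem_range.1 hk
  rw [muX_even, xx_of_le (by omega)]

/-- The ratios θ_i/θ_{i+2} telescope in steps of two, leaving two factors at each end. -/
theorem prod_rho_theta (hN : 1 ≤ N) {j : ℕ} (hj : j ≤ 2 * N + 1) :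
    ∏ i ∈ Finset.range j, (rho N (i + 1) * (theta N i / theta N (i + 2))) =
      E N j * (theta N 0 * theta N 1 / (theta N j * theta N (j + 1))) := by
  induction j with
  | zero =>
    have h1 := theta_ne_zero hN (by omega : 1 ≤ 2 * N + 2)
    have h2 := theta_ne_zero hN (by omega : 0 ≤ 2 * N + 2)
    simp [E_zero]; field_simp
  | succ j ih =>
    have h1 := theta_ne_zero hN (by omega : j ≤ 2 * N + 2)
    have h2 := theta_ne_zero hN (by omega : j + 1 ≤ 2 * N + 2)
    rw [Finset.prod_range_succ, ih (by omega), E_succ]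
    by_cases h3 : theta N (j + 2) = 0
    · rw [show j + 1 + 1 = j + 2 by ring, h3]; simp
    · rw [show j + 1 + 1 = j + 2 by ring]
      field_simp

/-- The modified link is the old link formula with x_{j+1} replaced by its image under μ, hence a
rational function of the images. -/
theorem rho_theta_eq (j : ℕ) : rho N (j + 1) * (theta N j / theta N (j + 2)) =
    if Even (j + 1) then (A N (j + 1) * muX N (j + 1))⁻¹ else muX N (j + 1) / A N (j + 1) := by
  unfold rho muX
  split_ifs
  · rw [mul_inv, mul_inv, mul_inv, inv_div, Nat.add_sub_cancel]; ring
  · rw [Nat.add_sub_cancel]; ring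

/-- The transformation `μ` in terms of the normalized variables. -/
structure IsInversion (N : ℕ) (φ : Bir N) : Prop where
  map_t : φ (t N) = t N
  map_b : φ (b N) = b N
  map_c : φ (c N) = eps N / c N
  map_a : ∀ j, φ (a N j) = a N j
  map_x' : ∀ j, 1 ≤ j → j ≤ 2 * N → φ (x N j) = muX N j

theorem exists_isInversion (hN : 1 ≤ N) : ∃ φ : Bir N, IsInversion N φ := by
  suffices hL : ∀ L : IntermediateField ℂ (K N), t N ∈ L → b N ∈ L → eps N / c N ∈ L →
      (∀ j, a N j ∈ L) → (∀ j, 1 ≤ j → j ≤ 2 * N → muX N j ∈ L) →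
      t N ∈ L ∧ b N ∈ L ∧ c N ∈ L ∧ (∀ i, a N i ∈ L) ∧
        ∀ j, 1 ≤ j → j ≤ 2 * N → x N j ∈ L by
    obtain ⟨φ, ht, hb, hc, ha, hx⟩ := exists_bir_of_generate (N := N) (t N) (b N) (eps N / c N)
      (a N) (muX N) (div_ne_zero eps_ne_zero c_ne_zero) a_zero_eq hL
    exact ⟨φ, ht, hb, hc, ha, hx⟩
  intro L ht hb hc ha hx
  have hε : eps N ∈ L := zpow_mem ht _
  have hc' : c N ∈ L := by
    have := div_mem hε hc
    rwa [div_div_cancel₀ eps_ne_zero] at this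
  have hA : ∀ i, A N i ∈ L := fun i => pow_mem (ha _) _
  have hQ : Q N ∈ L := pow_mem (pow_mem ht _) _
  have hp : p N ∈ L := pow_mem hc' _
  have hκ : kappa N ∈ L := inv_mem (mul_mem hQ (pow_mem hp _))
  have hm : m N ∈ L := mul_mem (hA _) (mul_mem (prod_mem fun k _ => zpow_mem (ha _) _) hb)
  -- The telescoped sums are built from modified links alone, so they lie in L before any individual
  -- θ_j is known to do so.
  have hs : ∀ j, j ≤ 2 * N + 1 → theta N 1 - theta N 0 * theta N 1 / theta N j ∈ L := by
    intro j hj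
    rw [← sum_E_div_theta hN hj]
    refine sum_mem fun i hi => mul_mem (pow_mem (neg_mem (one_mem _)) _) ?_
    have hi := Finset.mem_range.1 hi
    rw [← prod_rho_theta hN (by omega)]
    refine prod_mem fun k hk => ?_
    have hk := Finset.mem_range.1 hk
    rw [rho_theta_eq]
    split_ifs
    · exact inv_mem (mul_mem (hA _) (hx _ (by omega) (by omega)))
    · exact div_mem (hx _ (by omega) (by omega)) (hA _)
  have hθ : ∀ j, j ≤ 2 * N + 2 → theta N j ≠ 0 := fun j hj => theta_ne_zero hN hj
  -- The future image of β can be written with the product of the even images; together with the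
  -- full telescoped sum it gives (1 - 1/κ) θ_1, hence θ_1. Then θ_0 = θ_1 - 1, and the other θ_j
  -- follow from the telescoped sums.
  have hθ1 : theta N 1 ∈ L := by
    have h1 : (kappa N)⁻¹ * beta N * theta N 1 / theta N (2 * N + 1) ∈ L := by
      have h2 : (kappa N)⁻¹ * beta N * theta N 1 / theta N (2 * N + 1) =
          m N * p N / ∏ k ∈ Finset.range N, muX N (2 * k + 2) := by
        have := hθ 1 (by omega)
        have := hθ (2 * N + 1) (by omega)
        have := Q_ne_zero (N := N)
        have := p_ne_zero (N := N)
        have := evenProd_ne_zero (N := N)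
        rw [prod_muX_even hN, kappa, beta]
        field_simp
      rw [h2]
      exact div_mem (mul_mem hm hp) (prod_mem fun k hk => hx _ (by omega) (by
        have := Finset.mem_range.1 hk; omega))
    have h3 := add_mem (hs _ le_rfl) h1
    rw [← one_sub_kappa_inv_mul_theta_one hN] at h3
    have h4 : 1 - (kappa N)⁻¹ ≠ 0 := by
      have h5 := one_sub_kappa_ne_zero hN
      have h6 := kappa_ne_zero (N := N)
      intro h
      refine h5 ?_
      field_simp at h
      linear_combination -h
    have h7 := div_mem h3 (sub_mem (one_mem L) (inv_mem hκ))
    rwa [mul_div_cancel_left₀ _ h4] at h7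
  have hθ0 : theta N 0 ∈ L := by
    have := sub_mem hθ1 (one_mem L)
    rwa [theta_one, add_sub_cancel_right] at this
  have hθL : ∀ j, j ≤ 2 * N + 1 → theta N j ∈ L := by
    intro j hj
    have h1 := sub_mem hθ1 (hs j hj)
    rw [sub_sub_cancel] at h1
    have h2 := div_mem (mul_mem hθ0 hθ1) h1
    rwa [div_div_cancel₀ (mul_ne_zero (hθ 0 (by omega)) (hθ 1 (by omega)))] at h2
  refine ⟨ht, hb, hc', ha, fun j h1 h2 => ?_⟩
  have h3 := hx j h1 h2
  have h4 : ∀ u ∈ L, u ≠ 0 → xx N j * u ∈ L → x N j ∈ L := by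
    intro u hu hu0 h
    have := div_mem h hu
    rwa [mul_div_cancel_right₀ _ hu0, xx_of_le h2] at this
  rw [muX] at h3
  refine h4 _ ?_ ?_ h3
  · split_ifs
    · exact div_mem (hθL _ (by omega)) (hθL _ (by omega))
    · exact div_mem (hθL _ (by omega)) (hθL _ (by omega))
  · split_ifs
    · exact div_ne_zero (hθ _ (by omega)) (hθ _ (by omega))
    · exact div_ne_zero (hθ _ (by omega)) (hθ _ (by omega))

namespace IsInversion

variable {φ : Bir N} (h : IsInversion N φ)
include h

theorem map_q : φ (q N) = q N := by rw [q, map_pow, h.map_t]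

theorem map_Q : φ (Q N) = Q N := by rw [Q, map_pow, h.map_q]

theorem map_eps : φ (eps N) = eps N := by rw [eps, map_zpow₀, h.map_t]

theorem map_A (i : ℕ) : φ (A N i) = A N i := by rw [A, map_pow, h.map_a]

theorem map_m : φ (m N) = m N := by
  simp only [m, mm, map_mul, map_prod, map_zpow₀, h.map_A, h.map_a, h.map_b]

/-- The constant ε is the one with ε^{2N-1} = 1/Q, which is exactly what makes μ invert κ. -/
theorem map_p : φ (p N) = (Q N * p N)⁻¹ := by
  have : eps N ^ (2 * N - 1) = (Q N)⁻¹ := by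
    rw [eps, Q, q, ← pow_mul, ← zpow_natCast, ← zpow_natCast, ← zpow_mul, ← zpow_neg]
    congr 1
    push_cast
    ring
  rw [p, map_pow, h.map_c, div_pow, this, mul_inv, div_eq_mul_inv]

theorem map_kappa : φ (kappa N) = (kappa N)⁻¹ := by
  have := Q_ne_zero (N := N)
  have := p_ne_zero (N := N)
  rw [kappa, map_inv₀, map_mul, map_pow, h.map_p, h.map_Q]
  field_simp

theorem map_rho {j : ℕ} (hj : j < 2 * N) :
    φ (rho N (j + 1)) = rho N (j + 1) * (theta N j / theta N (j + 2)) := by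
  rw [rho_theta_eq, rho, xx_of_le (by omega), apply_ite φ]
  simp only [map_inv₀, map_mul, map_div₀, h.map_A, h.map_x' (j + 1) (by omega) (by omega)]

theorem map_E (hN : 1 ≤ N) {j : ℕ} (hj : j ≤ 2 * N) :
    φ (E N j) = E N j * (theta N 0 * theta N 1 / (theta N j * theta N (j + 1))) := by
  rw [← prod_rho_theta hN (by omega), E, map_prod]
  exact Finset.prod_congr rfl fun i hi => h.map_rho (by have := Finset.mem_range.1 hi; omega)

theorem map_S (hN : 1 ≤ N) {j : ℕ} (hj : j ≤ 2 * N + 1) :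
    φ (S N j) = theta N 1 - theta N 0 * theta N 1 / theta N j := by
  rw [← sum_E_div_theta hN hj, S, map_sum]
  refine Finset.sum_congr rfl fun i hi => ?_
  rw [map_mul, map_pow, map_neg, map_one, h.map_E hN (by have := Finset.mem_range.1 hi; omega)]

theorem map_evenProd (hN : 1 ≤ N) :
    φ (evenProd N) = evenProd N * (theta N (2 * N + 1) / theta N 1) := by
  rw [← prod_muX_even hN, evenProd, map_prod]
  exact Finset.prod_congr rfl fun k hk => h.map_x' _ (by omega) (by
    have := Finset.mem_range.1 hk; omega)

theorem map_beta (hN : 1 ≤ N) :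
    φ (beta N) = (kappa N)⁻¹ * beta N * theta N 1 / theta N (2 * N + 1) := by
  have := theta_ne_zero hN (by omega : 1 ≤ 2 * N + 2)
  have := theta_ne_zero hN (by omega : 2 * N + 1 ≤ 2 * N + 2)
  have := Q_ne_zero (N := N)
  have := p_ne_zero (N := N)
  have := evenProd_ne_zero (N := N)
  rw [beta, map_div₀, map_mul, map_mul, h.map_m, h.map_p, h.map_Q, h.map_evenProd hN, kappa]
  field_simp

theorem map_theta_zero (hN : 1 ≤ N) : φ (theta N 0) = -theta N 1 := by
  have h5 := one_sub_kappa_ne_zero hN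
  have h6 := kappa_ne_zero (N := N)
  have h7 : 1 - (kappa N)⁻¹ ≠ 0 := by
    intro h0
    refine h5 ?_
    field_simp at h0
    linear_combination -h0
  rw [theta, map_add, map_div₀, map_neg, map_add, h.map_S hN le_rfl, h.map_beta hN,
    ← one_sub_kappa_inv_mul_theta_one hN, map_sub, map_one, h.map_kappa, S_zero, map_zero,
    add_zero, ← mul_neg, mul_div_cancel_left₀ _ h7]

/-- In a quotient θ_{j+1}/θ_{j-1} the common factor drops out and the quotient is inverted; applying
μ twice to x_j therefore restores it. -/
theorem map_theta (hN : 1 ≤ N) {j : ℕ} (hj : j ≤ 2 * N + 1) :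
    φ (theta N j) = -(theta N 0 * theta N 1 / theta N j) := by
  rw [theta_eq, map_add, h.map_theta_zero hN, h.map_S hN hj, ← theta_eq]
  ring

theorem mul_self (hN : 1 ≤ N) : φ * φ = 1 := by
  refine bir_ext ?_ ?_ ?_ (fun j => ?_) fun j h3 h4 => ?_ <;>
    rw [AlgEquiv.mul_apply, AlgEquiv.one_apply]
  · rw [h.map_t, h.map_t]
  · rw [h.map_b, h.map_b]
  · rw [h.map_c, map_div₀, h.map_eps, h.map_c, div_div_cancel₀ eps_ne_zero]
  · rw [h.map_a, h.map_a]
  · have e0 := theta_ne_zero hN (by omega : 0 ≤ 2 * N + 2)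
    have e1 := theta_ne_zero hN (by omega : 1 ≤ 2 * N + 2)
    have e2 := theta_ne_zero hN (by omega : j - 1 ≤ 2 * N + 2)
    have e3 := theta_ne_zero hN (by omega : j + 1 ≤ 2 * N + 2)
    rw [h.map_x' j h3 h4, muX, map_mul, xx_of_le h4, h.map_x' j h3 h4, muX, xx_of_le h4]
    split_ifs
    · rw [map_div₀, h.map_theta hN (by omega), h.map_theta hN (by omega)]
      field_simp
    · rw [map_div₀, h.map_theta hN (by omega), h.map_theta hN (by omega)]
      field_simp

end IsInversion

end Chain

/-! ### The implicit relations defining μ, and their unique solution. -/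

section Relations

variable {N : ℕ}

/-- Consecutive θ differ by E_{2k} and by E_{2k} x_{2k+1}/A_{2k+1}; eliminating E_{2k} factors the
difference. In the even relation the θ quotients from the odd and even factorizations cancel each
other. -/
theorem A_odd_sub_muX (hN : 1 ≤ N) {k : ℕ} (hk : k < N) :
    A N (2 * k + 1) - muX N (2 * k + 1) =
      theta N (2 * k + 1) * (A N (2 * k + 1) - x N (2 * k + 1)) / theta N (2 * k + 2) := by
  have h1 := theta_ne_zero hN (by omega : 2 * k + 2 ≤ 2 * N + 2)
  have h2 := A_ne_zero (N := N) (2 * k + 1)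
  have h3 : theta N (2 * k) = theta N (2 * k + 1) - E N (2 * k) := by rw [theta_succ_even]; ring
  have h4 := theta_succ_odd (N := N) k
  rw [E_succ, rho_odd, xx_of_le (by omega)] at h4
  rw [eq_div_iff h1, muX_odd, xx_of_le (by omega), sub_mul, mul_assoc, div_mul_cancel₀ _ h1, h3, h4]
  field_simp
  ring

theorem one_sub_A_mul_muX_even (hN : 1 ≤ N) {k : ℕ} (hk : k < N) :
    1 - A N (2 * k + 2) * muX N (2 * k + 2) =
      theta N (2 * k + 2) * (1 - A N (2 * k + 2) * x N (2 * k + 2)) / theta N (2 * k + 1) := by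
  have h1 := theta_ne_zero hN (by omega : 2 * k + 1 ≤ 2 * N + 2)
  have h2 := A_ne_zero (N := N) (2 * k + 2)
  have h5 := x_ne_zero (N := N) (2 * k + 2)
  have h3 : theta N (2 * k + 1) = theta N (2 * k + 2) + E N (2 * k + 1) := by
    rw [theta_succ_odd]; ring
  have h4 : theta N (2 * k + 3) = theta N (2 * k + 2) + E N (2 * k + 2) := theta_succ_even (k + 1)
  rw [E_succ, rho_even, xx_of_le (by omega)] at h4
  rw [eq_div_iff h1, muX_even, xx_of_le (by omega), sub_mul, mul_assoc, mul_assoc,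
    div_mul_cancel₀ _ h1, h3, h4]
  field_simp
  ring

theorem x_odd_sub_muX (hN : 1 ≤ N) {k : ℕ} (hk : k < N) :
    x N (2 * k + 1) - muX N (2 * k + 1) = x N (2 * k + 1) * E N (2 * k) *
      (A N (2 * k + 1) - x N (2 * k + 1)) / (A N (2 * k + 1) * theta N (2 * k + 2)) := by
  have h1 := theta_ne_zero hN (by omega : 2 * k + 2 ≤ 2 * N + 2)
  have h2 := A_ne_zero (N := N) (2 * k + 1)
  have h3 : theta N (2 * k) = theta N (2 * k + 1) - E N (2 * k) := by rw [theta_succ_even]; ring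
  have h4 := theta_succ_odd (N := N) k
  rw [E_succ, rho_odd, xx_of_le (by omega)] at h4
  rw [eq_div_iff (mul_ne_zero h2 h1), muX_odd, xx_of_le (by omega), mul_comm (A N _), ← mul_assoc,
    sub_mul, mul_assoc, div_mul_cancel₀ _ h1, h3, h4]
  field_simp
  ring

/-- The relations between `x_j` and `y_j = μ(x_j)` that determine the latter. -/
structure NormalRelations (N : ℕ) (y : ℕ → K N) : Prop where
  sub_ne_zero : ∀ l, l < N → x N (2 * l + 1) - y (2 * l + 1) ≠ 0
  rel_one : (1 - x N 1 / A N 1) * (x N 1 - kappa N * y 1) +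
    (x N 1 - y 1) * (S N (2 * N + 1) + beta N - (1 - x N 1 / A N 1)) = 0
  rel_odd : ∀ l, l + 2 ≤ N →
    y (2 * l + 3) * (x N (2 * l + 1) - y (2 * l + 1)) * (A N (2 * l + 3) - x N (2 * l + 3)) =
      A N (2 * l + 2) * A N (2 * l + 3) * x N (2 * l + 2) * (x N (2 * l + 3) - y (2 * l + 3)) *
        (A N (2 * l + 1) - x N (2 * l + 1))
  rel_even : ∀ l, l < N →
    (1 - A N (2 * l + 2) * y (2 * l + 2)) * (A N (2 * l + 1) - y (2 * l + 1)) =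
      (1 - A N (2 * l + 2) * x N (2 * l + 2)) * (A N (2 * l + 1) - x N (2 * l + 1))

theorem normalRelations_muX (hN : 1 ≤ N) : NormalRelations N (muX N) where
  sub_ne_zero l hl := by
    rw [x_odd_sub_muX hN hl]
    exact div_ne_zero (mul_ne_zero (mul_ne_zero (x_ne_zero _) (E_ne_zero (by omega)))
      (A_sub_x_ne_zero (by omega) (by omega) _))
      (mul_ne_zero (A_ne_zero _) (theta_ne_zero hN (by omega)))
  rel_one := by
    have h2 := theta_ne_zero hN (by omega : 2 ≤ 2 * N + 2)
    have h1 := one_sub_kappa_ne_zero hN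
    have h3 := A_ne_zero (N := N) 1
    have h4 : theta N 2 = theta N 1 - E N 1 := theta_succ_odd 0
    have h5 : E N 1 = x N 1 / A N 1 := by
      rw [E_succ, E_zero, one_mul]
      have := rho_odd (N := N) 0
      rw [xx_of_le (by omega)] at this
      exact this
    have h6 : muX N 1 = x N 1 * (theta N 0 / theta N 2) := by
      have := muX_odd (N := N) 0
      rw [xx_of_le (by omega)] at this
      exact this
    -- This is the definition of θ_0, which turns the long first relation into one in θ_0, θ_1 and
    -- θ_2 only.
    have h7 : S N (2 * N + 1) + beta N = -((1 - kappa N) * theta N 0) := by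
      rw [theta, S_zero]; field_simp; ring
    have h8 : x N 1 / A N 1 = theta N 0 + 1 - theta N 2 := by
      rw [← h5, h4, theta_one]; ring
    rw [h7, h6, h8]
    field_simp
    ring
  rel_odd l hl := by
    have h2 := theta_ne_zero hN (by omega : 2 * l + 2 ≤ 2 * N + 2)
    have h4 := theta_ne_zero hN (by omega : 2 * l + 4 ≤ 2 * N + 2)
    have h5 := x_odd_sub_muX hN (k := l + 1) (by omega)
    have h6 := muX_odd (N := N) (l + 1)
    have h7 := A_ne_zero (N := N) (2 * l + 1)
    have h8 := A_ne_zero (N := N) (2 * l + 2)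
    have h9 := A_ne_zero (N := N) (2 * l + 3)
    have h0 := x_ne_zero (N := N) (2 * l + 2)
    rw [show 2 * (l + 1) = 2 * l + 1 + 1 by ring, xx_of_le (by omega)] at h6
    rw [show 2 * (l + 1) = 2 * l + 1 + 1 by ring, E_succ, E_succ, rho_odd, rho_even,
      xx_of_le (by omega), xx_of_le (by omega)] at h5
    rw [h5, h6, x_odd_sub_muX hN (by omega)]
    field_simp
  rel_even l hl := by
    have h2 := theta_ne_zero hN (by omega : 2 * l + 2 ≤ 2 * N + 2)
    have h4 := theta_ne_zero hN (by omega : 2 * l + 1 ≤ 2 * N + 2)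
    rw [A_odd_sub_muX hN hl, one_sub_A_mul_muX_even hN hl]
    field_simp

/-- The system is triangular: the first relation is linear in y_1, each odd relation is linear in
the next odd unknown, and each even relation then gives an even unknown. -/
theorem NormalRelations.unique {y z : ℕ → K N} (hN : 1 ≤ N) (hy : NormalRelations N y)
    (hz : NormalRelations N z) {j : ℕ} (h1 : 1 ≤ j) (h2 : j ≤ 2 * N) : y j = z j := by
  have hodd : ∀ l, l < N → y (2 * l + 1) = z (2 * l + 1) := by
    intro l
    induction l with
    | zero =>
      intro _
      have e1 := hy.rel_one
      have e2 := hz.rel_one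
      have e3 := A_sub_x_ne_zero (N := N) le_rfl (by omega) 1
      have e4 := A_ne_zero (N := N) 1
      have e5 := x_ne_zero (N := N) 1
      have e6 := one_sub_kappa_ne_zero hN
      set R := S N (2 * N + 1) + beta N - (1 - x N 1 / A N 1)
      have e7 : 1 - x N 1 / A N 1 ≠ 0 := by
        rw [one_sub_div e4]; exact div_ne_zero e3 e4
      -- The coefficient of y_1. If it vanished, the equation would lose its unknown and state that
      -- a product of nonzero factors is zero; the later coefficients are treated in the same way.
      have e8 : kappa N * (1 - x N 1 / A N 1) + R ≠ 0 := by
        intro h0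
        have h3 : x N 1 * ((1 - kappa N) * (1 - x N 1 / A N 1)) = 0 := by
          linear_combination e1 + (y 1 - x N 1) * h0
        exact mul_ne_zero e5 (mul_ne_zero e6 e7) h3
      refine mul_left_cancel₀ e8 ?_
      linear_combination e2 - e1
    | succ l ih =>
      intro hl
      have e1 := hy.rel_odd l (by omega)
      have e2 := hz.rel_odd l (by omega)
      rw [ih (by omega)] at e1
      have e3 : A N (2 * l + 2) * A N (2 * l + 3) * x N (2 * l + 2) * x N (2 * l + 3) *
          (A N (2 * l + 1) - x N (2 * l + 1)) ≠ 0 :=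
        mul_ne_zero (mul_ne_zero (mul_ne_zero (mul_ne_zero (A_ne_zero _) (A_ne_zero _))
          (x_ne_zero _)) (x_ne_zero _)) (A_sub_x_ne_zero (by omega) (by omega) _)
      refine mul_right_cancel₀ (b := (x N (2 * l + 1) - z (2 * l + 1)) *
        (A N (2 * l + 3) - x N (2 * l + 3)) + A N (2 * l + 2) * A N (2 * l + 3) *
          x N (2 * l + 2) * (A N (2 * l + 1) - x N (2 * l + 1))) ?_ ?_
      · intro h0
        refine e3 ?_
        linear_combination z (2 * l + 3) * h0 - e2
      · rw [show 2 * (l + 1) + 1 = 2 * l + 3 by ring]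
        linear_combination e1 - e2
  rcases Nat.even_or_odd' j with ⟨k, rfl | rfl⟩
  · obtain ⟨l, rfl⟩ : ∃ l, k = l + 1 := ⟨k - 1, by omega⟩
    have e1 := hy.rel_even l (by omega)
    have e2 := hz.rel_even l (by omega)
    rw [hodd l (by omega)] at e1
    have e3 : A N (2 * l + 1) - z (2 * l + 1) ≠ 0 := by
      intro h0
      rw [h0, mul_zero] at e2
      exact mul_ne_zero (one_sub_A_mul_x_ne_zero (by omega) (by omega) _)
        (A_sub_x_ne_zero (by omega) (by omega) _) e2.symm
    refine mul_right_cancel₀ (mul_ne_zero (A_ne_zero (N := N) (2 * l + 2)) e3) ?_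
    rw [show 2 * (l + 1) = 2 * l + 2 by ring]
    linear_combination e2 - e1
  · exact hodd k (by omega)

theorem eps_zpow (hN : 1 ≤ N) : eps N ^ (2 * (N : ℤ) - 1) = (Q N)⁻¹ := by
  rw [eps, Q, q, ← pow_mul, ← zpow_natCast, ← zpow_mul, ← zpow_neg]
  congr 1
  push_cast [Nat.cast_sub (by omega : 1 ≤ 2 * N)]
  ring

theorem kappa_eq (hN : 1 ≤ N) :
    kappa N = eps N ^ (2 * (N : ℤ) - 1) * c N ^ (2 - 4 * (N : ℤ)) := by
  have h2 : c N ^ (2 - 4 * (N : ℤ)) = (p N ^ 2)⁻¹ := by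
    rw [p, ← pow_mul, ← zpow_natCast, ← zpow_neg]
    congr 1
    push_cast [Nat.cast_sub (by omega : 1 ≤ 2 * N)]
    ring
  rw [eps_zpow hN, h2, kappa, mul_inv]

theorem Q_mul_eps_zpow (hN : 1 ≤ N) : Q N * eps N ^ (2 * (N : ℤ) - 1) = 1 := by
  rw [eps_zpow hN, mul_inv_cancel₀ Q_ne_zero]

theorem rescale_odd (d : K N) (y : ℕ → K N) (l : ℕ) :
    rescale d y (2 * l + 1) = y (2 * l + 1) * d ^ 2 := by
  rw [rescale, if_pos (by simp)]

theorem rescale_even (d : K N) (y : ℕ → K N) (l : ℕ) :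
    rescale d y (2 * l + 2) = y (2 * l + 2) / d ^ 2 := by
  rw [rescale, if_neg (by simp), inv_pow, div_eq_mul_inv]

/-- The powers of c introduced by normalizing numerator and denominator cancel against c^{4k}; the
coefficients of the first relation are the even E's. -/
theorem prod_f_div_prod_f {k : ℕ} (hk : k ≤ N) : (∏ i ∈ Finset.Icc 1 k, f N (2 * i - 1)) /
    ((∏ i ∈ Finset.Icc 1 (2 * k), a N i ^ (2 * N + 1)) * c N ^ (4 * k) *
      ∏ i ∈ Finset.Icc 1 k, f N (2 * i)) = E N (2 * k) := by
  have e1 : ∏ i ∈ Finset.Icc 1 k, f N (2 * i - 1) =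
      c N ^ (2 * k) * ∏ i ∈ Finset.range k, x N (2 * i + 1) := by
    have : ∀ i ∈ Finset.range k, f N (2 * (i + 1) - 1) = x N (2 * i + 1) * c N ^ 2 :=
      fun i _ => f_odd i
    rw [prod_Icc_one, Finset.prod_congr rfl this, Finset.prod_mul_distrib, Finset.prod_const,
      Finset.card_range, ← pow_mul, mul_comm]
  have e2 : ∏ i ∈ Finset.Icc 1 k, f N (2 * i) =
      (∏ i ∈ Finset.range k, x N (2 * i + 2)) / c N ^ (2 * k) := by
    have : ∀ i ∈ Finset.range k, f N (2 * (i + 1)) = x N (2 * i + 2) / c N ^ 2 :=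
      fun i _ => f_even i
    rw [prod_Icc_one, Finset.prod_congr rfl this, Finset.prod_div_distrib, Finset.prod_const,
      Finset.card_range, ← pow_mul]
  have e3 : ∏ i ∈ Finset.Icc 1 (2 * k), a N i ^ (2 * N + 1) =
      ∏ i ∈ Finset.range (2 * k), A N (i + 1) :=
    prod_Icc_one (fun i : ℕ => a N i ^ (2 * N + 1)) _
  have e4 : ∏ i ∈ Finset.range (2 * k), A N (i + 1) ≠ 0 :=
    Finset.prod_ne_zero_iff.2 fun _ _ => A_ne_zero _
  have e5 : ∏ i ∈ Finset.range k, x N (2 * i + 2) ≠ 0 :=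
    Finset.prod_ne_zero_iff.2 fun _ _ => x_ne_zero _
  have e6 := c_ne_zero (N := N)
  rw [e1, e2, e3, ← E_two_mul_aux hk, show 4 * k = 2 * k + 2 * k by ring, pow_add]
  field_simp

theorem sum_pairs (F : ℕ → K N) (n : ℕ) : ∑ k ∈ Finset.Icc 1 n, (F (2 * k) - F (2 * k + 1)) =
    ∑ i ∈ Finset.range (2 * n + 2), (-1) ^ i * F i - (F 0 - F 1) := by
  induction n with
  | zero => simp [Finset.sum_range_succ, sub_eq_add_neg]
  | succ n ih =>
    rw [Finset.sum_Icc_succ_top (by omega), ih, show 2 * (n + 1) + 2 = 2 * n + 2 + 1 + 1 by ring,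
      Finset.sum_range_succ _ (2 * n + 2 + 1), Finset.sum_range_succ _ (2 * n + 2)]
    rw [show 2 * n + 2 = 2 * (n + 1) by ring, pow_succ, pow_mul]
    ring

theorem sum_E_sub (hN : 1 ≤ N) : ∑ k ∈ Finset.Icc 1 (N - 1), (E N (2 * k) - E N (2 * k + 1)) =
    S N (2 * N) - (1 - E N 1) := by
  rw [sum_pairs, E_zero, show 2 * (N - 1) + 2 = 2 * N by omega]
  rfl

section

variable (y : ℕ → K N)

/-- The factor (ε/c)^2 from renormalizing g_1 completes the prefactor to ε^{2N-1} c^{2-4N} times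
c^2, that is, to κ c^2. -/
theorem f_one_sub (hN : 1 ≤ N) : f N 1 - eps N ^ (2 * (N : ℤ) - 3) * c N ^ (6 - 4 * (N : ℤ)) *
    rescale (eps N / c N) y 1 = c N ^ 2 * (x N 1 - kappa N * y 1) := by
  have h1 := rescale_odd (eps N / c N) y 0
  have h2 := f_odd (N := N) 0
  have h3 := eps_ne_zero (N := N)
  have h4 := c_ne_zero (N := N)
  have h5 : eps N ^ (2 * (N : ℤ) - 1) = eps N ^ (2 * (N : ℤ) - 3) * eps N ^ 2 := by
    rw [← zpow_natCast, ← zpow_add₀ h3]; congr 1; push_cast; ring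
  have h6 : c N ^ (6 - 4 * (N : ℤ)) = c N ^ (2 - 4 * (N : ℤ)) * c N ^ 4 := by
    rw [← zpow_natCast, ← zpow_add₀ h4]; congr 1; push_cast; ring
  simp only [mul_zero, zero_add] at h1 h2
  rw [h1, h2, kappa_eq hN, h5, h6]
  field_simp

/-- Here the prefactor collapses to c^2, because Q ε^{2N-1} = 1. -/
theorem f_one_sub' (hN : 1 ≤ N) : f N 1 - q N ^ (2 * N + 1) * eps N ^ (2 * (N : ℤ) - 3) * c N ^ 4 *
    rescale (eps N / c N) y 1 = c N ^ 2 * (x N 1 - y 1) := by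
  have h1 := rescale_odd (eps N / c N) y 0
  have h2 := f_odd (N := N) 0
  have h3 := eps_ne_zero (N := N)
  have h4 := c_ne_zero (N := N)
  have h5 : eps N ^ (2 * (N : ℤ) - 1) = eps N ^ (2 * (N : ℤ) - 3) * eps N ^ 2 := by
    rw [← zpow_natCast, ← zpow_add₀ h3]; congr 1; push_cast; ring
  have h6 := Q_mul_eps_zpow hN
  rw [h5] at h6
  simp only [mul_zero, zero_add] at h1 h2
  rw [h1, h2, ← Q]
  field_simp
  linear_combination -y 1 * h6

theorem eps_mul_f_sub (l : ℕ) : eps N ^ 2 * f N (2 * l + 1) - c N ^ 4 *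
    rescale (eps N / c N) y (2 * l + 1) = eps N ^ 2 * c N ^ 2 * (x N (2 * l + 1) - y (2 * l + 1)) := by
  have h4 := c_ne_zero (N := N)
  rw [rescale_odd, f_odd]
  field_simp

theorem A_mul_sub_f (l : ℕ) : a N ((2 * l + 1 : ℕ) : ZMod (2 * N + 1)) ^ (2 * N + 1) * c N ^ 2 -
    f N (2 * l + 1) = c N ^ 2 * (A N (2 * l + 1) - x N (2 * l + 1)) := by
  rw [f_odd, A]; ring

theorem one_sub_A_mul_f (l : ℕ) : 1 - a N ((2 * l + 2 : ℕ) : ZMod (2 * N + 1)) ^ (2 * N + 1) *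
    c N ^ 2 * f N (2 * l + 2) = 1 - A N (2 * l + 2) * x N (2 * l + 2) := by
  have h4 := c_ne_zero (N := N)
  rw [f_even, A]
  field_simp

/-- The sum over k pairs consecutive terms of the alternating sum, lacking its first pair, and the
last summand is β + E_{2N}. Together they are S_{2N+1} + β - (1 - x_1/A_1), and multiplication by
x_1 - y_1 clears the remaining denominator. -/
theorem rel_one_iff (hN : 1 ≤ N) (h0 : x N 1 - y 1 ≠ 0) :
    ((1 - f N 1 / (a N 1 ^ (2 * N + 1) * c N ^ 2)) *
        ((f N 1 - eps N ^ (2 * (N : ℤ) - 3) * c N ^ (6 - 4 * (N : ℤ)) *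
            rescale (eps N / c N) y 1) /
          (f N 1 - q N ^ (2 * N + 1) * eps N ^ (2 * (N : ℤ) - 3) * c N ^ 4 *
            rescale (eps N / c N) y 1))
      + ∑ k ∈ Finset.Icc 1 (N - 1),
          (∏ i ∈ Finset.Icc 1 k, f N (2 * i - 1)) /
            ((∏ i ∈ Finset.Icc 1 (2 * k), a N i ^ (2 * N + 1)) * c N ^ (4 * k) *
              ∏ i ∈ Finset.Icc 1 k, f N (2 * i)) *
          (1 - f N (2 * k + 1) / (a N ((2 * k + 1 : ℕ) : ZMod (2 * N + 1)) ^ (2 * N + 1) * c N ^ 2))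
      + a N 0 ^ (2 * N + 1) /
          (q N ^ (2 * N + 1) * c N ^ (4 * N) * ∏ i ∈ Finset.Icc 1 N, f N (2 * i)) *
          (q N ^ (2 * N) * b N * c N / (∏ i ∈ Finset.range (2 * N), a N i ^ (2 * N - i))
            + ∏ i ∈ Finset.Icc 1 N, f N (2 * i - 1)) = 0) ↔
    (1 - x N 1 / A N 1) * (x N 1 - kappa N * y 1) +
      (x N 1 - y 1) * (S N (2 * N + 1) + beta N - (1 - x N 1 / A N 1)) = 0 := by
  have h4 := c_ne_zero (N := N)
  have hA := A_ne_zero (N := N)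
  have e1 : E N 1 = x N 1 / A N 1 := by
    rw [E_succ, E_zero, one_mul]
    have := rho_odd (N := N) 0
    rw [xx_of_le (by omega)] at this
    exact this
  have e2 : ∀ k, 1 - f N (2 * k + 1) /
      (a N ((2 * k + 1 : ℕ) : ZMod (2 * N + 1)) ^ (2 * N + 1) * c N ^ 2) =
      1 - x N (2 * k + 1) / A N (2 * k + 1) := fun k => by
    rw [f_odd, ← A, mul_div_mul_right _ _ (pow_ne_zero 2 h4)]
  have e3 : ∀ k ∈ Finset.Icc 1 (N - 1), (∏ i ∈ Finset.Icc 1 k, f N (2 * i - 1)) /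
      ((∏ i ∈ Finset.Icc 1 (2 * k), a N i ^ (2 * N + 1)) * c N ^ (4 * k) *
        ∏ i ∈ Finset.Icc 1 k, f N (2 * i)) * (1 - f N (2 * k + 1) /
      (a N ((2 * k + 1 : ℕ) : ZMod (2 * N + 1)) ^ (2 * N + 1) * c N ^ 2)) =
      E N (2 * k) - E N (2 * k + 1) := fun k hk => by
    have hk := Finset.mem_Icc.1 hk
    rw [prod_f_div_prod_f (by omega), e2, E_succ, rho_odd, xx_of_le (by omega)]
    ring
  have e4 : a N 0 ^ (2 * N + 1) /
      (q N ^ (2 * N + 1) * c N ^ (4 * N) * ∏ i ∈ Finset.Icc 1 N, f N (2 * i)) *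
      (q N ^ (2 * N) * b N * c N / (∏ i ∈ Finset.range (2 * N), a N i ^ (2 * N - i))
        + ∏ i ∈ Finset.Icc 1 N, f N (2 * i - 1)) = beta N + E N (2 * N) := by
    have h1 : a N 0 ^ (2 * N + 1) = A N 0 := by rw [A, Nat.cast_zero]
    have h2 : q N ^ (2 * N) * b N * c N / (∏ i ∈ Finset.range (2 * N), a N i ^ (2 * N - i)) =
        mm N * c N := by
      rw [mm_eq]; ring
    have h3 : c N ^ (2 * N) = p N * c N := by
      rw [p, ← pow_succ]; congr 1; omega
    have h5 := p_ne_zero (N := N)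
    have h6 := Q_ne_zero (N := N)
    have h7 := evenProd_ne_zero (N := N)
    have h8 : E N (2 * N) = oddProd N * A N 0 / (Q N * evenProd N) := by
      rw [eq_div_iff (mul_ne_zero h6 h7), E_two_mul]
    rw [h1, h2, prod_f_odd, prod_f_even, h8, beta, ← Q, m, show 4 * N = 2 * N + 2 * N by ring,
      pow_add, h3]
    field_simp
  have e5 := e2 0
  simp only [mul_zero, zero_add, Nat.cast_one] at e5
  rw [Finset.sum_congr rfl e3, sum_E_sub hN, e4, e5, f_one_sub y hN, f_one_sub' y hN,
    mul_div_mul_left _ _ (pow_ne_zero 2 h4), e1]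
  have e6 : S N (2 * N + 1) = S N (2 * N) + E N (2 * N) := by
    rw [S_succ, pow_mul]; ring
  rw [e6, ← mul_left_inj' h0, zero_mul]
  refine Eq.congr_left ?_
  field_simp
  ring

end

/-- The only denominators that depend on the unknowns are the odd differences x_j - y_j, up to
nonzero factors; all others are nonzero unconditionally. -/
theorem gRelations_iff (hN : 1 ≤ N) (y : ℕ → K N) :
    GRelations N (rescale (eps N / c N) y) ↔ NormalRelations N y := by
  have h3 := eps_ne_zero (N := N)
  have h4 := c_ne_zero (N := N)
  have hx : ∀ j, 1 ≤ j → j ≤ 2 * N → A N j - x N j ≠ 0 :=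
    fun j h1 h2 => A_sub_x_ne_zero h1 h2 j
  have hA := A_ne_zero (N := N)
  have hx' := x_ne_zero (N := N)
  have hodd : ∀ l, l + 2 ≤ N → x N (2 * l + 3) - y (2 * l + 3) ≠ 0 →
      ((rescale (eps N / c N) y (2 * l + 3) *
        (eps N ^ 2 * f N (2 * l + 1) - c N ^ 4 * rescale (eps N / c N) y (2 * l + 1)) *
        (a N ((2 * l + 3 : ℕ) : ZMod (2 * N + 1)) ^ (2 * N + 1) * c N ^ 2 - f N (2 * l + 3))) /
      (f N (2 * l + 2) *
        (eps N ^ 2 * f N (2 * l + 3) - c N ^ 4 * rescale (eps N / c N) y (2 * l + 3)) *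
        (a N ((2 * l + 1 : ℕ) : ZMod (2 * N + 1)) ^ (2 * N + 1) * c N ^ 2 - f N (2 * l + 1)))
      = eps N ^ 2 * a N ((2 * l + 2 : ℕ) : ZMod (2 * N + 1)) ^ (2 * N + 1) *
          a N ((2 * l + 3 : ℕ) : ZMod (2 * N + 1)) ^ (2 * N + 1) ↔
      y (2 * l + 3) * (x N (2 * l + 1) - y (2 * l + 1)) * (A N (2 * l + 3) - x N (2 * l + 3)) =
        A N (2 * l + 2) * A N (2 * l + 3) * x N (2 * l + 2) * (x N (2 * l + 3) - y (2 * l + 3)) *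
          (A N (2 * l + 1) - x N (2 * l + 1))) := by
    intro l hl h0
    have h5 := hx (2 * l + 1) (by omega) (by omega)
    have h6 := hx' (2 * l + 2)
    have e1 := eps_mul_f_sub y (l + 1)
    have e2 := A_mul_sub_f (N := N) (l + 1)
    have e3 := rescale_odd (eps N / c N) y (l + 1)
    rw [show 2 * (l + 1) + 1 = 2 * l + 3 by ring] at e1 e2 e3
    rw [e1, e2, e3, eps_mul_f_sub, A_mul_sub_f, f_even, ← A, ← A]
    field_simp
  have heven : ∀ l, l < N →
      (((c N ^ 2 - eps N ^ 2 * a N ((2 * l + 2 : ℕ) : ZMod (2 * N + 1)) ^ (2 * N + 1) *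
            rescale (eps N / c N) y (2 * l + 2)) *
        (eps N ^ 2 * a N ((2 * l + 1 : ℕ) : ZMod (2 * N + 1)) ^ (2 * N + 1) -
            c N ^ 2 * rescale (eps N / c N) y (2 * l + 1))) /
      ((1 - a N ((2 * l + 2 : ℕ) : ZMod (2 * N + 1)) ^ (2 * N + 1) * c N ^ 2 * f N (2 * l + 2)) *
        (a N ((2 * l + 1 : ℕ) : ZMod (2 * N + 1)) ^ (2 * N + 1) * c N ^ 2 - f N (2 * l + 1)))
      = eps N ^ 2 ↔
      (1 - A N (2 * l + 2) * y (2 * l + 2)) * (A N (2 * l + 1) - y (2 * l + 1)) =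
        (1 - A N (2 * l + 2) * x N (2 * l + 2)) * (A N (2 * l + 1) - x N (2 * l + 1))) := by
    intro l hl
    have h5 := hx (2 * l + 1) (by omega) (by omega)
    have h6 := one_sub_A_mul_x_ne_zero (N := N) (m := 2 * l + 2) (by omega) (by omega) (2 * l + 2)
    rw [one_sub_A_mul_f, A_mul_sub_f, rescale_even, rescale_odd, ← A, ← A,
      div_eq_iff (mul_ne_zero h6 (mul_ne_zero (pow_ne_zero 2 h4) h5)),
      ← mul_right_inj' (mul_ne_zero (pow_ne_zero 2 h3) (pow_ne_zero 2 h4))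
        (b := (1 - A N (2 * l + 2) * y (2 * l + 2)) * (A N (2 * l + 1) - y (2 * l + 1)))]
    refine Eq.congr ?_ ?_
    · field_simp
    · ring
  have hne : ∀ l, l + 2 ≤ N → (f N (2 * l + 2) *
      (eps N ^ 2 * f N (2 * l + 3) - c N ^ 4 * rescale (eps N / c N) y (2 * l + 3)) *
      (a N ((2 * l + 1 : ℕ) : ZMod (2 * N + 1)) ^ (2 * N + 1) * c N ^ 2 - f N (2 * l + 1)) ≠ 0 ↔
      x N (2 * l + 3) - y (2 * l + 3) ≠ 0) := by
    intro l hl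
    have h5 := hx (2 * l + 1) (by omega) (by omega)
    have e1 := eps_mul_f_sub y (l + 1)
    rw [show 2 * (l + 1) + 1 = 2 * l + 3 by ring] at e1
    rw [e1, A_mul_sub_f]
    simp [h3, h4, h5, f_ne_zero]
  constructor
  · intro h
    have h0 : x N 1 - y 1 ≠ 0 := by
      have := h.den_one
      rw [f_one_sub' y hN] at this
      exact right_ne_zero_of_mul this
    have h1 : ∀ l, l + 2 ≤ N → x N (2 * l + 3) - y (2 * l + 3) ≠ 0 :=
      fun l hl => (hne l hl).1 (h.den_odd l hl)
    refine ⟨fun l hl => ?_, (rel_one_iff y hN h0).1 h.rel_one,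
      fun l hl => (hodd l hl (h1 l hl)).1 (h.rel_odd l hl),
      fun l hl => (heven l hl).1 (h.rel_even l hl)⟩
    cases l with
    | zero => exact h0
    | succ l => exact h1 l (by omega)
  · intro h
    have h0 : x N 1 - y 1 ≠ 0 := h.sub_ne_zero 0 (by omega)
    have h1 : ∀ l, l + 2 ≤ N → x N (2 * l + 3) - y (2 * l + 3) ≠ 0 :=
      fun l hl => h.sub_ne_zero (l + 1) (by omega)
    refine ⟨?_, (rel_one_iff y hN h0).2 h.rel_one, fun l hl => (hne l hl).2 (h1 l hl),
      fun l hl => (hodd l hl (h1 l hl)).2 (h.rel_odd l hl), fun l hl => ?_,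
      fun l hl => (heven l hl).2 (h.rel_even l hl)⟩
    · rw [f_one_sub' y hN]
      exact mul_ne_zero (pow_ne_zero 2 h4) h0
    · rw [one_sub_A_mul_f, A_mul_sub_f]
      exact mul_ne_zero (one_sub_A_mul_x_ne_zero (by omega) (by omega) _)
        (mul_ne_zero (pow_ne_zero 2 h4) (hx _ (by omega) (by omega)))

theorem IsInversion.isMu (hN : 1 ≤ N) {φ : Bir N} (h : IsInversion N φ) : IsMu N φ where
  map_t := h.map_t
  map_b := h.map_b
  map_c := h.map_c
  map_a := h.map_a
  map_f := by
    have h1 : (fun j => φ (f N j)) = rescale (eps N / c N) fun j => φ (x N j) := by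
      funext j
      rw [map_f_eq, h.map_c]
    rw [h1, gRelations_iff hN]
    have h2 := normalRelations_muX hN
    constructor
    · intro l hl
      rw [h.map_x' _ (by omega) (by omega)]
      exact h2.sub_ne_zero l hl
    · rw [h.map_x' _ (by omega) (by omega)]
      exact h2.rel_one
    · intro l hl
      rw [h.map_x' _ (by omega) (by omega), h.map_x' _ (by omega) (by omega)]
      exact h2.rel_odd l hl
    · intro l hl
      rw [h.map_x' _ (by omega) (by omega), h.map_x' _ (by omega) (by omega)]
      exact h2.rel_even l hl

theorem IsMu.unique (hN : 1 ≤ N) {φ ψ : Bir N} (hφ : IsMu N φ) (hψ : IsMu N ψ) : φ = ψ := by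
  have h1 : ∀ χ : Bir N, IsMu N χ → NormalRelations N fun j => χ (x N j) := by
    intro χ hχ
    have h1 : (fun j => χ (f N j)) = rescale (eps N / c N) fun j => χ (x N j) := by
      funext j
      rw [map_f_eq, hχ.map_c]
    rw [← gRelations_iff hN, ← h1]
    exact hχ.map_f
  refine bir_ext ?_ ?_ ?_ (fun j => ?_) fun j h3 h4 => (h1 φ hφ).unique hN (h1 ψ hψ) h3 h4
  · rw [hφ.map_t, hψ.map_t]
  · rw [hφ.map_b, hψ.map_b]
  · rw [hφ.map_c, hψ.map_c]
  · rw [hφ.map_a, hψ.map_a]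

end Relations

/-! ### Commutation of μ with s_2 and with w_1. -/

section Commutation

variable {N : ℕ}

namespace Refl

variable {σ : Bir N} (h : Refl N 2 σ)
include h

theorem map_E_one (hN : 1 ≤ N) : σ (E N 1) = E N 1 * (ratio N 2 / A N 2) := by
  have e1 : E N 1 = x N 1 / A N 1 := by
    rw [E_succ, E_zero, one_mul, ← xx_of_le (by omega : 1 ≤ 2 * N)]
    exact rho_odd 0
  have h1 := h.map_x 1 le_rfl (by omega)
  rw [factor_pred] at h1
  have h2 := A_ne_zero (N := N) 1
  have h3 := A_ne_zero (N := N) 2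
  rw [e1, map_div₀, h1, map_A_pred hN h]
  field_simp

theorem map_rho_two (hN : 1 ≤ N) : σ (rho N 2) = A N 2 / x N 2 := by
  have e1 : rho N 2 = (A N 2 * x N 2)⁻¹ := by
    rw [← xx_of_le (by omega : 2 ≤ 2 * N)]
    exact rho_even 0
  rw [e1, map_inv₀, map_mul, h.map_A_self hN, h.map_x_of_ne (by omega) (by omega) (by omega)
    (by omega), mul_inv, inv_inv, div_eq_mul_inv]

/-- E_1 and E_2 both change, but their difference does not; with E_j fixed for j ≥ 3, only the
partial sum ending between them is affected. This is why s_2 moves θ_2 alone. -/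
theorem map_E_one_sub (hN : 1 ≤ N) : σ (E N 1 - E N 2) = E N 1 - E N 2 := by
  have e1 : rho N 2 = (A N 2 * x N 2)⁻¹ := by
    rw [← xx_of_le (by omega : 2 ≤ 2 * N)]
    exact rho_even 0
  have h2 := x_ne_zero (N := N) 2
  have h3 := A_ne_zero (N := N) 2
  have h4 := A_sub_x_ne_zero (N := N) (m := 2) (by omega) (by omega) 2
  rw [map_sub, E_succ 1, map_mul, h.map_E_one hN, h.map_rho_two hN, ratio, e1]
  field_simp
  ring

theorem map_E_of_le (hN : 1 ≤ N) {j : ℕ} (h3 : 3 ≤ j) (hj : j ≤ 2 * N) : σ (E N j) = E N j := by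
  induction j, h3 using Nat.le_induction with
  | base =>
    have e1 : rho N 2 = (A N 2 * x N 2)⁻¹ := by
      rw [← xx_of_le (by omega : 2 ≤ 2 * N)]
      exact rho_even 0
    have e2 : rho N 3 = x N 3 / A N 3 := by
      rw [← xx_of_le (by omega : 3 ≤ 2 * N)]
      exact rho_odd 1
    have h1 := h.map_x 3 (by omega) hj
    rw [factor_succ] at h1
    have h2 := x_ne_zero (N := N) 2
    have h3 := A_ne_zero (N := N) 2
    have h4 := A_ne_zero (N := N) 3
    have h5 := ratio_ne_zero (N := N) (i := 2) (by omega) (by omega)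
    rw [E_succ 2, E_succ 1, map_mul, map_mul, h.map_E_one hN, h.map_rho_two hN, e1, e2, map_div₀, h1,
      map_A_succ hN h]
    field_simp
  | succ j h3 ih =>
    have h1 : σ (A N (j + 1)) = A N (j + 1) := by
      refine h.map_A_of_ne (cart_of_ne ?_ ?_ ?_)
      · rw [Ne, natCast_zmod_inj (by omega) (by omega)]; omega
      · have := (natCast_zmod_inj (N := N) (i := j + 1) (j := 2 + 1) (by omega) (by omega)).not.2
          (by omega)
        rwa [Nat.cast_add 2] at this
      · have := (natCast_zmod_inj (N := N) (i := j + 1) (j := 1) (by omega) (by omega)).not.2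
          (by omega)
        rwa [show ((2 : ℕ) : ZMod (2 * N + 1)) - 1 = (1 : ℕ) by push_cast; ring]
    have h2 := h.map_x_of_ne (j := j + 1) (by omega) hj (by omega) (by omega)
    have h4 : σ (rho N (j + 1)) = rho N (j + 1) := by
      rw [rho, xx_of_le hj, apply_ite σ, map_inv₀, map_mul, map_div₀, h1, h2]
    rw [E_succ, map_mul, ih (by omega), h4]

theorem map_S_of_ne (hN : 1 ≤ N) {j : ℕ} (h2 : j ≠ 2) (hj : j ≤ 2 * N + 1) :
    σ (S N j) = S N j := by
  rcases (by omega : j = 0 ∨ j = 1 ∨ 3 ≤ j) with rfl | rfl | h3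
  · rw [S_zero, map_zero]
  · rw [S_succ, S_zero, E_zero]; simp
  · induction j, h3 using Nat.le_induction with
    | base =>
      have : S N 3 = 1 - (E N 1 - E N 2) := by
        rw [S_succ, S_succ, S_succ, S_zero, E_zero]; ring
      rw [this, map_sub, h.map_E_one_sub hN, map_one]
    | succ j h3 ih =>
      rw [S_succ, map_add, ih (by omega) (by omega), map_mul, h.map_E_of_le hN h3 (by omega), map_pow,
        map_neg, map_one]

theorem map_kappa : σ (kappa N) = kappa N := by
  rw [kappa, map_inv₀, map_mul, map_pow, h.map_Q, h.map_p]

theorem map_evenProd : σ (evenProd N) = evenProd N := by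
  have := prod_factor_even_even (N := N) 0
  rw [h.map_evenProd_eq, this, mul_one]

theorem map_beta (hN : 1 ≤ N) : σ (beta N) = beta N := by
  rw [beta, map_div₀, map_mul, map_mul, h.map_Q, h.map_p, h.map_evenProd,
    h.map_m le_rfl (by omega)]

theorem map_theta_zero (hN : 1 ≤ N) : σ (theta N 0) = theta N 0 := by
  rw [theta, S_zero, add_zero, map_div₀, map_neg, map_add, map_sub, map_one, h.map_beta hN,
    h.map_kappa, h.map_S_of_ne hN (by omega) le_rfl]

theorem map_theta_of_ne (hN : 1 ≤ N) {j : ℕ} (h2 : j ≠ 2) (hj : j ≤ 2 * N + 1) :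
    σ (theta N j) = theta N j := by
  rw [theta_eq, map_add, h.map_theta_zero hN, h.map_S_of_ne hN h2 hj]

theorem map_theta_two (hN : 1 ≤ N) : σ (theta N 2) =
    (A N 2 * theta N 1 - x N 2 * theta N 3) / (A N 2 - x N 2) := by
  have e1 : rho N 2 = (A N 2 * x N 2)⁻¹ := by
    rw [← xx_of_le (by omega : 2 ≤ 2 * N)]
    exact rho_even 0
  have h2 := x_ne_zero (N := N) 2
  have h3 := A_ne_zero (N := N) 2
  have h4 := A_sub_x_ne_zero (N := N) (m := 2) (by omega) (by omega) 2
  have e2 : theta N 2 = theta N 1 - E N 1 := theta_succ_odd 0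
  have e3 : theta N 3 = theta N 2 + E N 2 := theta_succ_even 1
  rw [e3, e2, map_sub, h.map_theta_of_ne hN (by omega) (by omega), h.map_E_one hN, E_succ 1, e1, ratio]
  field_simp
  ring

/-- Among the multipliers of μ, only those of x_1 and x_3 contain θ_2, the single θ that s_2 moves.
Their change matches that of the multiplier of s_2 under μ, computed in `hr`. -/
theorem inversion_mul (hN : 1 ≤ N) {μ : Bir N} (hμ : IsInversion N μ) : μ * σ = σ * μ := by
  have hA := hμ.map_A 2
  have e0 := theta_ne_zero hN (by omega : 1 ≤ 2 * N + 2)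
  have e1 := theta_ne_zero hN (by omega : 2 ≤ 2 * N + 2)
  have e2 := A_sub_x_ne_zero (N := N) (m := 2) (by omega) (by omega) 2
  have e3 := one_sub_A_mul_x_ne_zero (N := N) (m := 2) (by omega) (by omega) 2
  have e4 : σ (theta N 2) ≠ 0 := by simpa using e1
  have hr : μ (ratio N 2) = ratio N 2 * theta N 2 / σ (theta N 2) := by
    have h1 : 1 - A N 2 * muX N 2 = theta N 2 * (1 - A N 2 * x N 2) / theta N 1 :=
      one_sub_A_mul_muX_even hN (k := 0) (by omega)
    have h2 : muX N 2 = x N 2 * (theta N 3 / theta N 1) := by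
      have := muX_even (N := N) 0
      rw [xx_of_le (by omega)] at this
      exact this
    have h3 : A N 2 - muX N 2 = σ (theta N 2) * (A N 2 - x N 2) / theta N 1 := by
      rw [h2, h.map_theta_two hN]
      field_simp
    rw [ratio, map_div₀, map_sub, map_sub, map_mul, map_one, hA, hμ.map_x' 2 (by omega) (by omega), h1,
      h3]
    field_simp
  have hr0 := ratio_ne_zero (N := N) (i := 2) (by omega) (by omega)
  refine bir_ext ?_ ?_ ?_ (fun j => ?_) fun j h3 h4 => ?_ <;>
    rw [AlgEquiv.mul_apply, AlgEquiv.mul_apply]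
  · rw [h.map_t, hμ.map_t, h.map_t]
  · rw [h.map_b, hμ.map_b, h.map_b]
  · rw [h.map_c, hμ.map_c, map_div₀, eps, map_zpow₀, h.map_t, h.map_c]
  · rw [h.map_a, hμ.map_a, h.map_a, map_mul, map_zpow₀, hμ.map_a, hμ.map_a]
  · rw [h.map_x j h3 h4, map_mul, hμ.map_x' j h3 h4]
    rcases (by omega : j = 1 ∨ j = 3 ∨ (j + 1 ≠ 2 ∧ j ≠ 2 + 1)) with rfl | rfl | ⟨h5, h6⟩
    · have e5 : muX N 1 = x N 1 * (theta N 0 / theta N 2) := by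
        have := muX_odd (N := N) 0
        rw [xx_of_le (by omega)] at this
        exact this
      have := h.map_x 1 h3 h4
      rw [factor_pred] at this
      rw [factor_pred, hr, e5, map_mul, map_div₀, this, h.map_theta_zero hN]
      field_simp
    · have e5 : muX N 3 = x N 3 * (theta N 2 / theta N 4) := by
        have := muX_odd (N := N) 1
        rw [xx_of_le (by omega)] at this
        exact this
      have e6 := theta_ne_zero hN (by omega : 4 ≤ 2 * N + 2)
      have := h.map_x 3 h3 h4
      rw [factor_succ] at this
      rw [factor_succ, map_inv₀, hr, e5, map_mul, map_div₀, this,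
        h.map_theta_of_ne hN (j := 4) (by omega) (by omega)]
      field_simp
    · rw [factor_of_ne h5 h6, map_one, mul_one, muX, xx_of_le h4, map_mul, h.map_x_of_ne h3 h4 h5 h6,
        apply_ite σ, map_div₀, map_div₀, h.map_theta_of_ne hN (by omega) (by omega),
        h.map_theta_of_ne hN (by omega) (by omega)]

end Refl

namespace IsFlip

variable {w : Bir N} (h : IsFlip N w)
include h

/-- Reversal changes the parity of the index, hence the type of link, while w_1 inverts the A's:
together the links are reversed and inverted. -/
theorem map_rho {j : ℕ} (hj : j < 2 * N) : w (rho N (j + 1)) = (rho N (2 * N - j))⁻¹ := by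
  have h1 := h.map_x (j + 1) (by omega) (by omega)
  rw [show 2 * N + 1 - (j + 1) = 2 * N - j by omega] at h1
  have h2 : w (A N (j + 1)) = (A N (2 * N - j))⁻¹ := by
    rw [h.map_A (by omega), show 2 * N + 1 - (j + 1) = 2 * N - j by omega]
  have h3 : Even (2 * N - j) ↔ ¬ Even (j + 1) := by
    rw [Nat.even_iff, Nat.even_iff]; omega
  rw [rho, rho, xx_of_le (by omega), xx_of_le (by omega)]
  by_cases h4 : Even (j + 1)
  · rw [if_pos h4, if_neg (by tauto), map_inv₀, map_mul, h1, h2]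
    field_simp
  · rw [if_neg h4, if_pos (by tauto), map_div₀, h1, h2]
    field_simp

theorem map_E {j : ℕ} (hj : j ≤ 2 * N) : w (E N j) = E N (2 * N - j) / E N (2 * N) := by
  induction j with
  | zero => rw [E_zero, map_one, Nat.sub_zero, div_self (E_ne_zero (by omega))]
  | succ j ih =>
    have h1 : E N (2 * N - j) = E N (2 * N - (j + 1)) * rho N (2 * N - j) := by
      rw [show 2 * N - j = 2 * N - (j + 1) + 1 by omega]; exact E_succ _
    have h2 := rho_ne_zero (N := N) (j := 2 * N - j) (by omega)
    rw [E_succ, map_mul, ih (by omega), h.map_rho (by omega), h1]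
    field_simp

theorem map_S {j : ℕ} (hj : j ≤ 2 * N + 1) :
    w (S N j) = (S N (2 * N + 1) - S N (2 * N + 1 - j)) / E N (2 * N) := by
  induction j with
  | zero => simp [S_zero]
  | succ j ih =>
    have h1 : S N (2 * N + 1 - j) =
        S N (2 * N + 1 - (j + 1)) + (-1) ^ (2 * N - j) * E N (2 * N - j) := by
      rw [show 2 * N + 1 - j = 2 * N - j + 1 by omega, S_succ,
        show 2 * N + 1 - (j + 1) = 2 * N - j by omega]
    have h2 : (-1 : K N) ^ (2 * N - j) = (-1) ^ j :=
      neg_one_pow_congr (by rw [Nat.even_iff, Nat.even_iff]; omega)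
    rw [S_succ, map_add, ih (by omega), map_mul, h.map_E (by omega), h1, h2, map_pow, map_neg, map_one]
    ring

theorem map_kappa : w (kappa N) = (kappa N)⁻¹ := by
  rw [kappa, map_inv₀, map_mul, map_pow, h.map_Q, h.map_p, inv_pow, ← mul_inv]

theorem map_evenProd : w (evenProd N) = oddProd N := by
  rw [evenProd, map_prod]
  refine prod_range_reflect' _ _ _ fun k hk => ?_
  rw [h.map_x _ (by omega) (by omega)]
  congr 1; omega

theorem map_beta : w (beta N) = beta N / (kappa N * E N (2 * N)) := by
  have h1 := p_ne_zero (N := N)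
  have h2 := Q_ne_zero (N := N)
  have h3 := oddProd_ne_zero (N := N)
  have h4 := evenProd_ne_zero (N := N)
  have h5 := A_ne_zero (N := N) 0
  have h6 := E_two_mul (N := N)
  have h8 : E N (2 * N) = oddProd N * A N 0 / (Q N * evenProd N) := by
    rw [eq_div_iff (mul_ne_zero h2 h4), h6]
  rw [beta, map_div₀, map_mul, map_mul, h.map_m, h.map_p, h.map_Q, h.map_evenProd, h8, kappa, m]
  field_simp

/-- Summing reversed and inverted links reverses the chain; the factor -1/E_{2N} does not depend on
j and disappears from the quotients that define μ. -/
theorem map_theta (hN : 1 ≤ N) {j : ℕ} (hj : j ≤ 2 * N + 1) :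
    w (theta N j) = -theta N (2 * N + 1 - j) / E N (2 * N) := by
  have h1 := one_sub_kappa_ne_zero hN
  have h2 := kappa_ne_zero (N := N)
  have h3 := E_ne_zero (N := N) (j := 2 * N) (by omega)
  have h4 : 1 - (kappa N)⁻¹ ≠ 0 := by
    intro h
    refine h1 ?_
    field_simp at h
    linear_combination -h
  have h5 : w (theta N 0) = -theta N (2 * N + 1) / E N (2 * N) := by
    rw [theta, theta, S_zero, add_zero, map_div₀, map_neg, map_add, map_sub, map_one, h.map_kappa,
      h.map_beta, h.map_S le_rfl, Nat.sub_self, S_zero, div_eq_div_iff h4 h3]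
    field_simp
    ring
  rw [theta_eq, map_add, h5, h.map_S hj, theta_eq (2 * N + 1), theta_eq (2 * N + 1 - j)]
  ring

theorem inversion_mul (hN : 1 ≤ N) {μ : Bir N} (hμ : IsInversion N μ) : μ * w = w * μ := by
  have he : w (eps N) = (eps N)⁻¹ := by rw [eps, map_zpow₀, h.map_t, inv_zpow]
  refine bir_ext ?_ ?_ ?_ (fun j => ?_) fun j h3 h4 => ?_ <;>
    rw [AlgEquiv.mul_apply, AlgEquiv.mul_apply]
  · rw [h.map_t, map_inv₀, hμ.map_t, h.map_t]
  · rw [h.map_b, hμ.map_b, h.map_b, map_mul, hμ.map_b, hμ.map_Q]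
  · rw [h.map_c, hμ.map_c, map_div₀, he, h.map_c, map_inv₀, hμ.map_c, inv_div, div_inv_eq_mul,
      div_eq_mul_inv, mul_comm]
  · rw [h.map_a, hμ.map_a, h.map_a, map_inv₀, hμ.map_a]
  · have hE := E_ne_zero (N := N) (j := 2 * N) (by omega)
    have t1 := theta_ne_zero hN (by omega : 2 * N - j ≤ 2 * N + 2)
    have t2 := theta_ne_zero hN (by omega : 2 * N + 2 - j ≤ 2 * N + 2)
    have hpar : Even (2 * N + 1 - j) ↔ ¬ Even j := by
      rw [Nat.even_iff, Nat.even_iff]; omega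
    rw [h.map_x j h3 h4, hμ.map_x' _ (by omega) (by omega), hμ.map_x' j h3 h4, muX, muX, map_mul,
      xx_of_le h4, xx_of_le (by omega), h.map_x j h3 h4, apply_ite w, map_div₀, map_div₀,
      h.map_theta hN (by omega), h.map_theta hN (by omega),
      show 2 * N + 1 - (j + 1) = 2 * N - j by omega,
      show 2 * N + 1 - (j - 1) = 2 * N + 2 - j by omega,
      show 2 * N + 1 - j + 1 = 2 * N + 2 - j by omega,
      show 2 * N + 1 - j - 1 = 2 * N - j by omega]
    by_cases h5 : Even j
    · rw [if_pos h5, if_neg (by tauto)]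
      field_simp
    · rw [if_neg h5, if_pos (by tauto)]
      field_simp

end IsFlip

end Commutation

/-! ### Commutation of μ with π². -/

section ShiftCommutation

variable {N : ℕ}

theorem E_one_eq (hN : 1 ≤ N) : E N 1 = x N 1 / A N 1 := by
  rw [E_succ, E_zero, one_mul, ← xx_of_le (by omega : 1 ≤ 2 * N)]
  exact rho_odd 0

theorem xx_last'_ne_zero (hN : 1 ≤ N) : xx N (2 * N + 2) ≠ 0 := by
  obtain ⟨π, hπ⟩ := exists_isShift hN
  rw [← hπ.map_xx_last hN]
  simpa using xx_last_ne_zero (N := N)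

theorem E_last' :
    E N (2 * N + 2) = -(kappa N + beta N) / (A N 1 * xx N (2 * N + 2)) := by
  have h1 : A N (2 * N + 2) = A N 1 := by
    rw [← A_add 1]; congr 1; ring
  rw [E_succ, E_last, rho_even, h1]
  ring

theorem kappa_mul_xx_last' :
    kappa N * (x N 1 * xx N (2 * N + 2) - 1) = beta N * (1 - A N 1 * x N 1) := by
  have h1 := p_ne_zero (N := N)
  have h2 := Q_ne_zero (N := N)
  have h3 := evenProd_ne_zero (N := N)
  have h4 := xx_last'_mul (N := N)
  rw [kappa, beta]
  field_simp
  linear_combination h4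

namespace IsShift

variable {π : Bir N} (h : IsShift N π)
include h

theorem sq_map_rho (hN : 1 ≤ N) {j : ℕ} (h1 : 1 ≤ j) (h2 : j ≤ 2 * N) :
    π (π (rho N j)) = rho N (j + 2) := by
  have h3 : π (π (xx N j)) = xx N (j + 2) := by
    rw [h.map_xx hN h1 (by omega), h.map_xx hN (by omega) (by omega)]
  have h4 : π (π (A N j)) = A N (j + 2) := by rw [h.map_A, h.map_A]
  have h5 : Even (j + 2) ↔ Even j := by rw [Nat.even_iff, Nat.even_iff]; omega
  rw [rho, rho, apply_ite π, apply_ite π]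
  simp only [map_inv₀, map_mul, map_div₀, h3, h4, h5]

/-- The links are shifted by two, so the first two are lost; division by E_2 accounts for them. -/
theorem sq_map_E (hN : 1 ≤ N) {j : ℕ} (hj : j ≤ 2 * N) :
    π (π (E N j)) = E N (j + 2) / E N 2 := by
  induction j with
  | zero => rw [E_zero, map_one, map_one, div_self (E_ne_zero (by omega))]
  | succ j ih =>
    rw [E_succ, map_mul, map_mul, ih (by omega), h.sq_map_rho hN (by omega) hj,
      show j + 1 + 2 = j + 2 + 1 by ring, E_succ (j + 2)]
    ring

theorem sq_map_S (hN : 1 ≤ N) {j : ℕ} (hj : j ≤ 2 * N + 1) :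
    π (π (S N j)) = (S N (j + 2) - S N 2) / E N 2 := by
  induction j with
  | zero => simp [S_zero]
  | succ j ih =>
    rw [S_succ, map_add, map_add, ih (by omega), map_mul, map_mul, h.sq_map_E hN (by omega),
      show j + 1 + 2 = j + 2 + 1 by ring, S_succ (j + 2), pow_add]
    simp only [map_pow, map_neg, map_one]
    ring

theorem sq_map_p : π (π (p N)) = p N := by rw [h.map_p, map_inv₀, h.map_p, inv_inv]

theorem sq_map_kappa : π (π (kappa N)) = kappa N := by
  have h1 := h.sq_map_p
  rw [kappa, map_inv₀, map_inv₀, map_mul, map_mul, map_pow, map_pow, h1, h.map_Q, h.map_Q]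

theorem sq_map_evenProd (hN : 1 ≤ N) :
    π (π (evenProd N)) * x N 2 = evenProd N * xx N (2 * N + 2) := by
  have h1 : π (π (evenProd N)) = ∏ k ∈ Finset.range N, xx N (2 * k + 4) := by
    rw [h.map_evenProd, map_prod]
    refine Finset.prod_congr rfl fun k hk => ?_
    have := Finset.mem_range.1 hk
    rw [h.map_xx hN (by omega) (by omega)]
  have h2 : evenProd N = ∏ k ∈ Finset.range N, xx N (2 * k + 2) :=
    Finset.prod_congr rfl fun k hk => by
      have := Finset.mem_range.1 hk
      rw [xx_of_le (by omega)]
  rw [h1, h2, ← Finset.prod_range_succ (fun k => xx N (2 * k + 2)), Finset.prod_range_succ',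
    xx_of_le (by omega)]
  rfl

theorem sq_map_beta (hN : 1 ≤ N) :
    π (π (beta N)) = beta N * (A N 1 * A N 2 * x N 2 / xx N (2 * N + 2)) := by
  have h1 := p_ne_zero (N := N)
  have h2 := Q_ne_zero (N := N)
  have h3 := evenProd_ne_zero (N := N)
  have h4 := xx_last'_ne_zero hN
  have h5 := x_ne_zero (N := N) 2
  have h6 : π (π (evenProd N)) = evenProd N * xx N (2 * N + 2) / x N 2 := by
    rw [eq_div_iff h5, h.sq_map_evenProd hN]
  have h7 := h.sq_map_p
  rw [beta, map_div₀, map_div₀, map_mul, map_mul, map_mul, map_mul, h6, h7, h.map_Q, h.map_Q, h.map_m,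
    map_mul, h.map_m, h.map_A]
  field_simp

theorem sq_map_theta_zero (hN : 1 ≤ N) : π (π (theta N 0)) = theta N 2 / E N 2 := by
  have h0 := one_sub_kappa_ne_zero hN
  have h1 := A_ne_zero (N := N) 1
  have h2 := A_ne_zero (N := N) 2
  have h3 := x_ne_zero (N := N) 1
  have h4 := x_ne_zero (N := N) 2
  have h5 := xx_last'_ne_zero hN
  have h6 := kappa_mul_xx_last' (N := N)
  have h7 : E N 2 = E N 1 / (A N 2 * x N 2) := by
    rw [E_succ 1, div_eq_mul_inv, ← xx_of_le (by omega : 2 ≤ 2 * N), ← rho_even 0]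
  have h8 : E N 2 ≠ 0 := E_ne_zero (by omega)
  have h9 : S N 2 = 1 - E N 1 := by
    rw [S_succ, S_succ, S_zero, E_zero]; ring
  have h10 : S N (2 * N + 3) = S N (2 * N + 1) + kappa N + beta N + E N (2 * N + 2) := by
    have e1 : (-1 : K N) ^ (2 * N + 2) = 1 := by rw [pow_add, pow_mul]; simp
    have e2 : (-1 : K N) ^ (2 * N + 1) = -1 := by rw [pow_succ, pow_mul]; simp
    rw [S_succ (2 * N + 2), S_succ (2 * N + 1), E_last, e1, e2]
    ring
  have h11 : π (π (S N (2 * N + 1))) = (S N (2 * N + 3) - S N 2) / E N 2 := h.sq_map_S hN le_rfl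
  -- With E_{2N+1} = -κ - β, this makes the total change of S_{2N+1} + β, after multiplication by
  -- E_2, equal to -(1-κ)(1 - E_1). Division by -(1-κ) then produces θ_0 + S_2 = θ_2.
  have h12 : E N (2 * N + 2) + E N 2 * π (π (beta N)) = -kappa N * E N 1 := by
    rw [h.sq_map_beta hN, E_last', h7, E_one_eq hN]
    field_simp
    linear_combination h6
  have h13 : π (π (theta N 0)) =
      -((S N (2 * N + 3) - S N 2) / E N 2 + π (π (beta N))) / (1 - kappa N) := by
    rw [theta, S_zero, add_zero, map_div₀, map_div₀, map_neg, map_neg, map_add, map_add, h11, map_sub,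
      map_sub, h.sq_map_kappa, map_one, map_one]
  rw [h13, theta, h9, h10, div_eq_div_iff h0 h8]
  field_simp
  linear_combination -h12

theorem sq_map_theta (hN : 1 ≤ N) {j : ℕ} (hj : j ≤ 2 * N + 1) :
    π (π (theta N j)) = theta N (j + 2) / E N 2 := by
  rw [theta_eq, map_add, map_add, h.sq_map_theta_zero hN, h.sq_map_S hN hj, theta_eq 2,
    theta_eq (j + 2)]
  ring

end IsShift

namespace IsInversion

variable {μ : Bir N} (h : IsInversion N μ)
include h

/-- Since π² carries x_{2N-1} and x_{2N} to the two continued terms, the formula for μ has to be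
extended to both of them. -/
theorem map_xx_last (hN : 1 ≤ N) : μ (xx N (2 * N + 1)) = muX N (2 * N + 1) := by
  have t0 := theta_ne_zero hN (by omega : 2 * N ≤ 2 * N + 2)
  have t1 := theta_ne_zero hN (by omega : 2 * N + 1 ≤ 2 * N + 2)
  have t2 := theta_ne_zero hN (by omega : 1 ≤ 2 * N + 2)
  have t3 := theta_ne_zero hN (by omega : 0 ≤ 2 * N + 2)
  have h1 := kappa_ne_zero (N := N)
  have h2 := A_ne_zero (N := N) (2 * N + 1)
  have h3 := E_ne_zero (N := N) (j := 2 * N) (by omega)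
  have h4 : xx N (2 * N + 1) = (-kappa N - beta N) * A N (2 * N + 1) / E N (2 * N) := by
    rw [← E_last, E_succ, rho_odd]
    field_simp
  have h5 := kappa_mul_theta_zero hN
  have h6 := theta_one (N := N)
  rw [muX_odd, theta_last hN, h4, map_div₀, map_mul, map_sub, map_neg, h.map_kappa, h.map_beta hN,
    h.map_A, h.map_E hN le_rfl]
  field_simp
  rw [h6]
  linear_combination h5

theorem map_xx_last' (hN : 1 ≤ N) : μ (xx N (2 * N + 2)) = muX N (2 * N + 2) := by
  have t1 := theta_ne_zero hN (by omega : 2 * N + 1 ≤ 2 * N + 2)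
  have t2 := theta_ne_zero hN (by omega : 2 ≤ 2 * N + 2)
  have t3 := theta_ne_zero hN (by omega : 0 ≤ 2 * N + 2)
  have h1 := kappa_ne_zero (N := N)
  have h2 := A_ne_zero (N := N) 1
  have h3 := x_ne_zero (N := N) 1
  have h4 := xx_last'_ne_zero hN
  have h5 := kappa_mul_theta_zero hN
  have h6 := theta_one (N := N)
  have h7 : theta N 2 = theta N 1 - x N 1 / A N 1 := by
    rw [← E_one_eq hN]; exact theta_succ_odd 0
  have h8 : theta N (2 * N + 3) = kappa N * theta N 1 + E N (2 * N + 2) := by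
    rw [← theta_last hN]; exact theta_succ_even (N + 1)
  -- The relation κ(x_1 x_{2N+2} - 1) = β(1 - A_1 x_1) is linear in x_{2N+2}, so applying μ to it
  -- determines the image.
  have h9 := congrArg μ (kappa_mul_xx_last' (N := N))
  have h10 : muX N 1 = x N 1 * (theta N 0 / theta N 2) := by
    have := muX_odd (N := N) 0
    rw [xx_of_le (by omega)] at this
    exact this
  have h11 : x N 1 / A N 1 = theta N 1 - theta N 2 := by rw [h7]; ring
  have h12 : muX N 1 ≠ 0 := by
    rw [h10]; exact mul_ne_zero h3 (div_ne_zero t3 t2)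
  refine mul_left_cancel₀ h12 ?_
  have h13 : muX N 1 * μ (xx N (2 * N + 2)) =
      1 + beta N * theta N 1 / theta N (2 * N + 1) * (1 - A N 1 * muX N 1) := by
    simp only [map_mul, map_sub, map_one, h.map_kappa, h.map_beta hN, h.map_A,
      h.map_x' 1 le_rfl (by omega)] at h9
    have := mul_left_cancel₀ (inv_ne_zero h1) (b := muX N 1 * μ (xx N (2 * N + 2)) - 1)
      (c := beta N * theta N 1 / theta N (2 * N + 1) * (1 - A N 1 * muX N 1)) (by rw [h9]; ring)
    linear_combination this
  have h14 : theta N (2 * N + 1) * theta N 2 +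
      beta N * theta N 1 * (theta N 2 - A N 1 * x N 1 * theta N 0) =
      theta N 0 * (kappa N * theta N 1 * (x N 1 * xx N (2 * N + 2)) -
        (kappa N + beta N) * (x N 1 / A N 1)) := by
    rw [h11]
    linear_combination (-theta N 0 * theta N 1) * kappa_mul_xx_last' (N := N) - theta N 2 * h5
      + beta N * theta N 2 * h6
  have h15 : kappa N * theta N 1 * (x N 1 * xx N (2 * N + 2)) - (kappa N + beta N) * (x N 1 / A N 1) =
      x N 1 * xx N (2 * N + 2) * theta N (2 * N + 3) := by
    rw [h8, E_last']
    field_simp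
    ring
  rw [h15] at h14
  rw [h13, muX_even, h10]
  field_simp
  linear_combination h14

theorem map_xx (hN : 1 ≤ N) {j : ℕ} (h1 : 1 ≤ j) (h2 : j ≤ 2 * N + 2) : μ (xx N j) = muX N j := by
  rcases (by omega : j ≤ 2 * N ∨ j = 2 * N + 1 ∨ j = 2 * N + 2) with h3 | rfl | rfl
  · rw [xx_of_le h3, h.map_x' j h1 h3]
  · exact h.map_xx_last hN
  · exact h.map_xx_last' hN

/-- π² shifts the sequences x and θ by two and preserves parity; the common factor 1/E_2 of the θ's
cancels in the multipliers of μ. -/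
theorem mul_shift_sq (hN : 1 ≤ N) {π : Bir N} (hπ : IsShift N π) : μ * (π * π) = π * π * μ := by
  refine bir_ext ?_ ?_ ?_ (fun j => ?_) fun j h3 h4 => ?_ <;>
    simp only [AlgEquiv.mul_apply]
  · rw [hπ.map_t, hπ.map_t, h.map_t, hπ.map_t, hπ.map_t]
  · rw [hπ.map_b, map_mul, hπ.map_b, hπ.map_q, map_mul, map_mul, h.map_q, h.map_b, hπ.map_b, map_mul,
      hπ.map_b, hπ.map_q]
  · rw [hπ.map_c, map_inv₀, hπ.map_c, inv_inv, h.map_c, map_div₀, map_div₀, eps, map_zpow₀, map_zpow₀,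
      hπ.map_t, hπ.map_t, hπ.map_c, map_inv₀, hπ.map_c, inv_inv]
  · rw [hπ.map_a, hπ.map_a, h.map_a, h.map_a, hπ.map_a, hπ.map_a]
  · have e1 : π (π (x N j)) = xx N (j + 2) := by
      rw [← xx_of_le h4, hπ.map_xx hN h3 (by omega), hπ.map_xx hN (by omega) (by omega)]
    have e2 : E N 2 ≠ 0 := E_ne_zero (by omega)
    have e3 : Even (j + 2) ↔ Even j := by rw [Nat.even_iff, Nat.even_iff]; omega
    have e4 : π (π (theta N (j - 1))) = theta N (j + 1) / E N 2 := by
      rw [hπ.sq_map_theta hN (by omega), show j - 1 + 2 = j + 1 by omega]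
    have e5 : π (π (theta N (j + 1))) = theta N (j + 3) / E N 2 :=
      hπ.sq_map_theta hN (by omega)
    rw [e1, h.map_xx hN (by omega) (by omega), h.map_x' j h3 h4, muX, muX, xx_of_le h4, map_mul,
      map_mul, e1]
    simp only [e3, apply_ite π, map_div₀, e4, e5, div_div_div_cancel_right₀ e2]
    rfl

end IsInversion

end ShiftCommutation

/-! ### The q-difference system from powers of π. -/

section System

variable {N : ℕ}

namespace IsShift

variable {π : Bir N} (h : IsShift N π)
include h

theorem pow_map_a (k : ℕ) (i : ZMod (2 * N + 1)) : (π ^ k) (a N i) = a N (i + k) := by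
  induction k with
  | zero => simp
  | succ k ih =>
    rw [pow_succ', AlgEquiv.mul_apply, ih, h.map_a, Nat.cast_succ, add_assoc]

theorem pow_map_A (k i : ℕ) : (π ^ k) (A N i) = A N (i + k) := by
  rw [A, map_pow, h.pow_map_a, A, Nat.cast_add]

theorem pow_map_xx (hN : 1 ≤ N) (k : ℕ) {j : ℕ} (h1 : 1 ≤ j) (h2 : j + k ≤ 2 * N + 2) :
    (π ^ k) (xx N j) = xx N (j + k) := by
  induction k with
  | zero => simp
  | succ k ih =>
    rw [pow_succ', AlgEquiv.mul_apply, ih (by omega), h.map_xx hN (by omega) (by omega), add_assoc]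

theorem pow_map_t (k : ℕ) : (π ^ k) (t N) = t N := by
  induction k with
  | zero => simp
  | succ k ih => rw [pow_succ', AlgEquiv.mul_apply, ih, h.map_t]

theorem pow_map_q (k : ℕ) : (π ^ k) (q N) = q N := by rw [q, map_pow, h.pow_map_t]

theorem pow_map_b (k : ℕ) : (π ^ k) (b N) = q N ^ k * b N := by
  induction k with
  | zero => simp
  | succ k ih => rw [pow_succ', AlgEquiv.mul_apply, ih, map_mul, map_pow, h.map_q, h.map_b]; ring

theorem pow_map_c (k : ℕ) : (π ^ (2 * k + 1)) (c N) = (c N)⁻¹ := by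
  induction k with
  | zero => rw [mul_zero, zero_add, pow_one, h.map_c]
  | succ k ih =>
    rw [show 2 * (k + 1) + 1 = (2 * k + 1) + 1 + 1 by ring, pow_succ, pow_succ,
      AlgEquiv.mul_apply, AlgEquiv.mul_apply, h.map_c, map_inv₀, h.map_c, inv_inv, ih]

/-- After applying π this is the closing relation for x_1 x_3 ⋯ x_{2N+1}. -/
theorem symm_mul_evenProd (hN : 1 ≤ N) :
    π⁻¹ (x N 1) * evenProd N = -(p N * mm N + p N ^ 2 * oddProd N) := by
  have h1 := oddProd_mul_xx_last (N := N)
  rw [← oddProd_shift hN] at h1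
  have h2 := p_ne_zero (N := N)
  have h3 : π (π⁻¹ (x N 1)) = x N 1 := π.apply_symm_apply _
  apply π.injective
  rw [map_mul, h3, map_neg, map_add, map_mul, map_mul, map_pow, h.map_p, h.map_mm, h.map_oddProd,
    h.map_evenProd]
  field_simp
  linear_combination h1

theorem symm_mul_xx_last (hN : 1 ≤ N) :
    A N 0 * (π⁻¹ (x N 1) * xx N (2 * N + 1) - 1) / (A N 0 - xx N (2 * N + 1)) =
      m N * p N / evenProd N := by
  have h1 := h.symm_mul_evenProd hN
  have h2 := oddProd_mul_xx_last (N := N)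
  have h3 := evenProd_ne_zero (N := N)
  have h4 : A N 0 - xx N (2 * N + 1) ≠ 0 := by
    have h5 := A_sub_x_ne_zero (N := N) (m := 2 * N) (by omega) le_rfl (2 * N)
    have h6 : π (A N (2 * N) - x N (2 * N)) = A N 0 - xx N (2 * N + 1) := by
      have h7 := A_add (N := N) 0
      rw [zero_add] at h7
      rw [map_sub, h.map_A, h7, h.map_x' _ (by omega) le_rfl]
    rw [← h6]
    exact (map_ne_zero π).2 h5
  rw [div_eq_div_iff h4 h3]
  rw [m] at h2 ⊢
  linear_combination A N 0 * xx N (2 * N + 1) * h1 - A N 0 * h2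

/-- Both sides equal m p/(x_2 x_4 ⋯ x_{2N}). This is the whole system at one position: for i < 2N
the i-th equation is its image under the (2N+1-i)-th power of π⁻¹. -/
theorem symm_mul_xx_last_eq (hN : 1 ≤ N) :
    A N 0 * (π⁻¹ (x N 1) * xx N (2 * N + 1) - 1) / (A N 0 - xx N (2 * N + 1)) =
      (x N 1 * xx N (2 * N + 2) - 1) / (1 - A N 1 * x N 1) := by
  rw [h.symm_mul_xx_last hN, div_eq_div_iff evenProd_ne_zero
    (one_sub_A_mul_x_ne_zero le_rfl (by omega) 1), xx_last'_mul]

omit h in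
theorem pow_inv_apply {k : ℕ} {u v : K N} (huv : (π ^ k) u = v) : (π ^ k)⁻¹ v = u := by
  rw [← huv]; exact (π ^ k).symm_apply_apply u

theorem inv_map_A {i k : ℕ} : (π ^ k)⁻¹ (A N (i + k)) = A N i := pow_inv_apply (h.pow_map_A k i)

/-- As x_1 is π^{-(i-1)} x_i, the exponents add up to i - 1 + k + 1 = 2N+1. -/
theorem inv_pow_map_x (hN : 1 ≤ N) {i k : ℕ} (h1 : 1 ≤ i) (h2 : i ≤ 2 * N) (hk : i + k = 2 * N + 1) :
    (π ^ k)⁻¹ (π⁻¹ (x N 1)) = (π ^ (2 * N + 1))⁻¹ (x N i) := by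
  have h3 : (π ^ (i - 1)) (x N 1) = x N i := by
    have := h.pow_map_xx hN (i - 1) (j := 1) le_rfl (by omega)
    rwa [show 1 + (i - 1) = i by omega, xx_of_le (by omega), xx_of_le h2] at this
  have h4 : (π ^ (2 * N + 1))⁻¹ * π ^ (i - 1) = (π ^ k)⁻¹ * π⁻¹ := by
    rw [show 2 * N + 1 = i - 1 + (k + 1) by omega, pow_add, mul_inv_rev, inv_mul_cancel_right,
      pow_succ', mul_inv_rev]
  rw [← h3, ← AlgEquiv.mul_apply, ← AlgEquiv.mul_apply, h4]

theorem inv_map_a (i : ZMod (2 * N + 1)) : (π ^ (2 * N + 1))⁻¹ (a N i) = a N i :=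
  pow_inv_apply (by
    have : ((2 * N + 1 : ℕ) : ZMod (2 * N + 1)) = 0 := ZMod.natCast_self _
    rw [h.pow_map_a, this, add_zero])

theorem inv_map_q : (π ^ (2 * N + 1))⁻¹ (q N) = q N := pow_inv_apply (h.pow_map_q _)

theorem inv_map_b : (π ^ (2 * N + 1))⁻¹ (b N) = (q N ^ (2 * N + 1))⁻¹ * b N :=
  pow_inv_apply (by
    rw [map_mul, map_inv₀, map_pow, h.pow_map_q, h.pow_map_b,
      inv_mul_cancel_left₀ (pow_ne_zero _ q_ne_zero)])

theorem inv_map_c : (π ^ (2 * N + 1))⁻¹ (c N) = (c N)⁻¹ :=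
  pow_inv_apply (by rw [map_inv₀, h.pow_map_c, inv_inv])

theorem qpStep_x (hN : 1 ≤ N) {i : ℕ} (h1 : 1 ≤ i) (h2 : i < 2 * N) :
    A N i * ((π ^ (2 * N + 1))⁻¹ (x N i) * x N i - 1) / (A N i - x N i) =
      ((π ^ (2 * N + 1))⁻¹ (x N (i + 1)) * x N (i + 1) - 1) /
        (1 - A N (i + 1) * (π ^ (2 * N + 1))⁻¹ (x N (i + 1))) := by
  obtain ⟨k, hk⟩ : ∃ k, i + k = 2 * N + 1 := ⟨2 * N + 1 - i, by omega⟩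
  have h3 := congrArg (⇑(π ^ k)⁻¹) (h.symm_mul_xx_last_eq hN)
  -- The index 0 is read as 2N+1 = i + k, so that going back k steps lands on i.
  have e1 : (π ^ k)⁻¹ (A N 0) = A N i := by
    have h4 := A_add (N := N) 0
    rw [zero_add] at h4
    rw [← h4, ← hk]
    exact h.inv_map_A
  have e2 : (π ^ k)⁻¹ (A N 1) = A N (i + 1) := by
    rw [← A_add 1, show 1 + (2 * N + 1) = i + 1 + k by omega]
    exact h.inv_map_A
  have e3 : (π ^ k)⁻¹ (π⁻¹ (x N 1)) = (π ^ (2 * N + 1))⁻¹ (x N i) :=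
    h.inv_pow_map_x hN h1 h2.le hk
  have e4 : (π ^ k)⁻¹ (x N 1) = (π ^ (2 * N + 1))⁻¹ (x N (i + 1)) := by
    obtain ⟨l, rfl⟩ : ∃ l, k = l + 1 := ⟨k - 1, by omega⟩
    rw [← h.inv_pow_map_x hN (k := l) (by omega) h2 (by omega), pow_succ', mul_inv_rev]
    rfl
  have e5 : (π ^ k)⁻¹ (xx N (2 * N + 1)) = x N i := pow_inv_apply (by
    rw [← xx_of_le h2.le, h.pow_map_xx hN k h1 (by omega), hk])
  have e6 : (π ^ k)⁻¹ (xx N (2 * N + 2)) = x N (i + 1) := pow_inv_apply (by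
    rw [← xx_of_le h2, h.pow_map_xx hN k (by omega) (by omega)]
    congr 1; omega)
  simp only [map_div₀, map_mul, map_sub, map_one, e1, e2, e3, e4, e5, e6] at h3
  exact h3

theorem qpStep_x_last (hN : 1 ≤ N) :
    A N (2 * N) * ((π ^ (2 * N + 1))⁻¹ (x N (2 * N)) * x N (2 * N) - 1) /
      (A N (2 * N) - x N (2 * N)) = mm N / (p N * oddProd N) := by
  have h3 := congrArg (⇑(π ^ 1)⁻¹) (h.symm_mul_xx_last hN)
  have e1 : (π ^ 1)⁻¹ (A N 0) = A N (2 * N) := by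
    have h4 := A_add (N := N) 0
    rw [zero_add] at h4
    rw [← h4]
    exact h.inv_map_A
  have e3 : (π ^ 1)⁻¹ (π⁻¹ (x N 1)) = (π ^ (2 * N + 1))⁻¹ (x N (2 * N)) :=
    h.inv_pow_map_x hN (by omega) le_rfl rfl
  have e5 : (π ^ 1)⁻¹ (xx N (2 * N + 1)) = x N (2 * N) := pow_inv_apply (by
    rw [← xx_of_le le_rfl, h.pow_map_xx hN 1 (by omega) (by omega)])
  have e6 : (π ^ 1)⁻¹ (m N) = mm N := pow_inv_apply (by rw [pow_one, h.map_mm])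
  have e7 : (π ^ 1)⁻¹ (p N) = (p N)⁻¹ := pow_inv_apply (by
    rw [pow_one, map_inv₀, h.map_p, inv_inv])
  have e8 : (π ^ 1)⁻¹ (evenProd N) = oddProd N := pow_inv_apply (by rw [pow_one, h.map_oddProd])
  simp only [map_div₀, map_mul, map_sub, map_one, e1, e3, e5, e6, e7, e8] at h3
  rw [h3, div_mul_eq_div_div, div_eq_mul_inv (mm N)]

theorem qpStep (hN : 1 ≤ N) : QPStep N (fun i => a N i) (b N) (c N) (f N)
    (fun i => (π ^ (2 * N + 1))⁻¹ (f N i)) := by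
  set T := (π ^ (2 * N + 1))⁻¹ with hT
  have hc := c_ne_zero (N := N)
  have e1 : ∀ i, 1 ≤ i → c N ^ (2 * (-1 : ℤ) ^ i) * f N i = x N i := by
    intro i hi
    obtain ⟨i, rfl⟩ : ∃ l, i = l + 1 := ⟨i - 1, by omega⟩
    rw [f_eq, lam, Nat.add_sub_cancel, pow_succ]
    rcases Nat.even_or_odd i with h1 | h1
    · rw [if_pos h1, h1.neg_one_pow, one_mul, mul_neg_one, zpow_neg]
      norm_cast
      field_simp
    · rw [if_neg (Nat.not_even_iff_odd.2 h1), h1.neg_one_pow, show (2 : ℤ) * (-1 * -1) = (2 : ℕ) by norm_num,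
        zpow_natCast]
      field_simp
  have e2 : ∀ i, 1 ≤ i → T (f N i) = c N ^ (2 * (-1 : ℤ) ^ i) * T (x N i) := by
    intro i hi
    have h2 := congrArg T (e1 i hi)
    rw [map_mul, map_zpow₀, hT, h.inv_map_c, inv_zpow, ← hT] at h2
    rw [← h2, mul_inv_cancel_left₀ (zpow_ne_zero _ hc)]
  -- T inverts c, so the normalizing powers of c in f_i and in its image are opposite and cancel in
  -- the product.
  have e3 : ∀ i, 1 ≤ i → T (f N i) * f N i = T (x N i) * x N i := by
    intro i hi
    rw [← e1 i hi, map_mul, map_zpow₀, hT, h.inv_map_c, inv_zpow, ← hT]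
    field_simp
  have e4 : ∀ i, 1 ≤ i → c N ^ (2 * (-1 : ℤ) ^ i) * T (f N (i + 1)) = T (x N (i + 1)) := by
    intro i hi
    rw [e2 (i + 1) (by omega), ← mul_assoc, ← zpow_add₀ hc, pow_succ]
    simp
  constructor
  · intro i h1 h2
    rw [e1 i h1]
    exact A_sub_x_ne_zero h1 h2 i
  · intro i h1 h2
    have h3 : T (A N (i + 1)) = A N (i + 1) := by rw [A, map_pow, hT, h.inv_map_a]
    have h4 : a N ((i + 1 : ℕ) : ZMod (2 * N + 1)) ^ (2 * N + 1) = A N (i + 1) := rfl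
    have h5 := (map_ne_zero T).2
      (one_sub_A_mul_x_ne_zero (N := N) (m := i + 1) (by omega) (by omega) (i + 1))
    rw [map_sub, map_mul, map_one, h3] at h5
    rwa [mul_assoc, e4 i h1, h4]
  · exact Finset.prod_ne_zero_iff.2 fun _ _ => f_ne_zero _
  · intro i h1 h2
    have h4 : a N ((i + 1 : ℕ) : ZMod (2 * N + 1)) ^ (2 * N + 1) = A N (i + 1) := rfl
    have h5 := h.qpStep_x hN h1 (by omega)
    rw [e3 i h1, e3 (i + 1) (by omega), e1 i h1, mul_assoc (_ ^ (2 * N + 1)), e4 i h1, h4]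
    exact h5
  · have h5 := h.qpStep_x_last hN
    have h6 : c N ^ (2 * N) = p N * c N := by
      rw [p, ← pow_succ]; congr 1; omega
    have h7 := p_ne_zero (N := N)
    have h8 := oddProd_ne_zero (N := N)
    rw [e3 _ (by omega), e1 _ (by omega), prod_f_odd, ← mm_eq_prod_Icc, h6]
    refine h5.trans ?_
    field_simp

end IsShift

end System

/-! ### Relations propagated around the cycle by π. -/

section Group

variable {N : ℕ}

theorem natCast_two_mul_add (k : ℕ) : ((2 * N + 1 + k : ℕ) : ZMod (2 * N + 1)) = k := by
  rw [Nat.cast_add, ZMod.natCast_self, zero_add]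

/-- Cyclic induction: a property stable under conjugation by π may be checked at whichever index is
convenient. -/
theorem zmod_induction {P : ZMod (2 * N + 1) → Prop} (i₀ : ZMod (2 * N + 1)) (h₀ : P i₀)
    (h : ∀ i, P i → P (i + 1)) (i : ZMod (2 * N + 1)) : P i := by
  have h1 : ∀ n : ℕ, P (i₀ + n) := by
    intro n
    induction n with
    | zero => simpa using h₀
    | succ n ih => rw [Nat.cast_succ, ← add_assoc]; exact h _ ih
  have h2 := h1 (i - i₀).val
  rwa [ZMod.natCast_zmod_val, add_sub_cancel] at h2

/-- The transformations `s_i`, `π`, `w_1`, `μ`. -/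
structure IsSystem (N : ℕ) (s : ZMod (2 * N + 1) → Bir N) (π w μ : Bir N) : Prop where
  refl : ∀ i : ℕ, 1 ≤ i → i ≤ 2 * N → Refl N i (s i)
  shift : IsShift N π
  flip : IsFlip N w
  inversion : IsInversion N μ
  conj : ∀ i, π * s i = s (i + 1) * π

theorem exists_isSystem (hN : 1 ≤ N) : ∃ s π w μ, IsSystem N s π w μ := by
  obtain ⟨π, hπ⟩ := exists_isShift hN
  obtain ⟨w, hw⟩ := exists_isFlip N
  obtain ⟨μ, hμ⟩ := exists_isInversion hN
  choose! σ hσ using exists_refl (N := N) hN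
  have hlast : ((2 * N : ℕ) : ZMod (2 * N + 1)) + 1 = 0 := by
    have := ZMod.natCast_self (2 * N + 1)
    rwa [Nat.cast_add, Nat.cast_one] at this
  let s : ZMod (2 * N + 1) → Bir N := fun i => if i = 0 then π⁻¹ * σ 1 * π else σ i.val
  have hs : ∀ i : ℕ, 1 ≤ i → i ≤ 2 * N → s i = σ i := fun i h1 h2 => by
    simp only [s, if_neg (natCast_zmod_ne_zero h1 h2), ZMod.val_natCast_of_lt (by omega : i < 2 * N + 1)]
  have hs0 : s 0 = π⁻¹ * σ 1 * π := if_pos rfl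
  refine ⟨s, π, w, μ, fun i h1 h2 => ?_, hπ, hw, hμ, fun i => ?_⟩
  · rw [hs i h1 h2]; exact hσ i h1 h2
  · rw [← ZMod.natCast_zmod_val i]
    have hi := ZMod.val_lt i
    rcases (by omega : i.val = 0 ∨ (1 ≤ i.val ∧ i.val < 2 * N) ∨ i.val = 2 * N) with h | h | h
    · have h1 := hs 1 le_rfl (by omega)
      rw [Nat.cast_one] at h1
      rw [h, Nat.cast_zero, zero_add, h1, hs0]
      group
    · have h1 := hs (i.val + 1) (by omega) (by omega)
      rw [Nat.cast_add, Nat.cast_one] at h1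
      rw [h1, hs _ h.1 h.2.le]
      exact hπ.mul_refl (hσ _ h.1 h.2.le) (hσ _ (by omega) (by omega)) h.1 h.2
    -- Passing from 2N to 0 is where the defining conjugate s_0 is met; the two-step relation to s_1
    -- gives it after cancelling one π.
    · have h1 := hπ.sq_mul_refl hN (hσ (2 * N) (by omega) le_rfl) (hσ 1 le_rfl (by omega))
      rw [h, hlast, hs0, hs _ (by omega) le_rfl]
      rw [mul_assoc, ← eq_inv_mul_iff_mul_eq] at h1
      rw [h1]
      group

namespace IsSystem

variable {s : ZMod (2 * N + 1) → Bir N} {π w μ : Bir N} (h : IsSystem N s π w μ)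
include h

theorem refl_one (hN : 1 ≤ N) : Refl N 1 (s 1) := by
  have := h.refl 1 le_rfl (by omega)
  rwa [Nat.cast_one] at this

theorem refl_two (hN : 1 ≤ N) : Refl N 2 (s 2) := by
  have := h.refl 2 (by omega) (by omega)
  rwa [Nat.cast_ofNat] at this

theorem map_succ (i : ZMod (2 * N + 1)) : s (i + 1) = π * s i * π⁻¹ := by
  rw [h.conj, mul_inv_cancel_right]

theorem s_zero : s 0 = π⁻¹ * s 1 * π := by
  have := h.map_succ 0
  rw [zero_add] at this
  rw [this]
  group

theorem mul_pow_shift {i j : ZMod (2 * N + 1)} {n : ℕ} (h1 : (s i * s j) ^ n = 1) :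
    (s (i + 1) * s (j + 1)) ^ n = 1 := by
  rw [h.map_succ, h.map_succ, show π * s i * π⁻¹ * (π * s j * π⁻¹) = π * (s i * s j) * π⁻¹ by group,
    conj_pow, h1, mul_one, mul_inv_cancel]

theorem s_mul_self (hN : 1 ≤ N) (i : ZMod (2 * N + 1)) : s i * s i = 1 := by
  revert i
  refine zmod_induction 1 ((h.refl_one hN).mul_self hN le_rfl (by omega)) fun i hi => ?_
  rw [← pow_one (_ * _)] at hi ⊢
  exact h.mul_pow_shift hi

theorem s_inv (hN : 1 ≤ N) (i : ZMod (2 * N + 1)) : (s i)⁻¹ = s i :=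
  inv_eq_of_mul_eq_one_left (h.s_mul_self hN i)

theorem s_braid (hN : 1 ≤ N) (i : ZMod (2 * N + 1)) : (s i * s (i + 1)) ^ 3 = 1 := by
  revert i
  refine zmod_induction 1 ?_ fun i hi => h.mul_pow_shift hi
  have h1 := (h.refl_one hN).braid hN (h.refl_two hN)
  rw [one_add_one_eq_two]
  calc (s 1 * s 2) ^ 3 = (s 1 * s 2 * s 1) * (s 2 * s 1 * s 2) := by
        simp only [pow_succ, pow_zero, one_mul, mul_assoc]
    _ = s 1 * s 2 * (s 1 * s 1) * s 2 * s 1 := by rw [← h1]; simp only [mul_assoc]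
    _ = s 1 * (s 2 * s 2) * s 1 := by rw [h.s_mul_self hN]; simp only [mul_assoc, mul_one]
    _ = 1 := by rw [h.s_mul_self hN, mul_one, h.s_mul_self hN]

theorem s_braid' (hN : 1 ≤ N) (i : ZMod (2 * N + 1)) : (s i * s (i - 1)) ^ 3 = 1 := by
  have h1 := h.s_braid hN (i - 1)
  rw [sub_add_cancel] at h1
  have h2 : s i * s (i - 1) = (s (i - 1) * s i)⁻¹ := by
    rw [mul_inv_rev, h.s_inv hN, h.s_inv hN]
  rw [h2, inv_pow, h1, inv_one]

theorem s_mul_comm (hN : 1 ≤ N) {i j : ZMod (2 * N + 1)} (h1 : j ≠ i + 1) (h2 : j ≠ i - 1) :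
    (s i * s j) ^ 2 = 1 := by
  -- Only the difference of the indices matters. Starting from index 1, the second index has a
  -- representative between 3 and 2N, so no wraparound occurs.
  suffices h3 : ∀ d : ZMod (2 * N + 1), d ≠ 1 → d ≠ -1 → ∀ i, (s i * s (i + d)) ^ 2 = 1 by
    have := h3 (j - i) (fun h => h1 (by linear_combination h)) (fun h => h2 (by linear_combination h)) i
    rwa [add_sub_cancel] at this
  intro d hd1 hd2
  refine zmod_induction 1 ?_ fun i hi => ?_
  · by_cases hd : d = 0
    · rw [hd, add_zero, h.s_mul_self hN, one_pow]
    · obtain ⟨k, hk, hk1, hk2⟩ : ∃ k : ℕ, (k : ZMod (2 * N + 1)) = 1 + d ∧ 3 ≤ k ∧ k ≤ 2 * N := by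
        refine ⟨(1 + d).val, ZMod.natCast_zmod_val _, ?_, ?_⟩
        · have e0 : (1 + d).val ≠ 0 := fun h0 => hd2 (by
            rw [ZMod.val_eq_zero] at h0; linear_combination h0)
          have e1 : (1 + d).val ≠ 1 := fun h0 => hd (by
            have := ZMod.natCast_zmod_val (1 + d)
            rw [h0, Nat.cast_one] at this; linear_combination -this)
          have e2 : (1 + d).val ≠ 2 := fun h0 => hd1 (by
            have := ZMod.natCast_zmod_val (1 + d)
            rw [h0, Nat.cast_ofNat] at this; linear_combination -this)
          omega
        · have := ZMod.val_lt (1 + d)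
          omega
      have hc1 : cart (1 : ZMod (2 * N + 1)) k = 0 := by
        rw [hk]
        refine cart_of_ne ?_ ?_ ?_
        · intro h0; exact hd (by linear_combination h0)
        · intro h0; exact hd1 (by linear_combination h0)
        · intro h0; exact hd2 (by linear_combination h0)
      have hc2 : cart (k : ZMod (2 * N + 1)) 1 = 0 := by
        rw [hk]
        refine cart_of_ne ?_ ?_ ?_
        · intro h0; exact hd (by linear_combination -h0)
        · intro h0; exact hd2 (by linear_combination -h0)
        · intro h0; exact hd1 (by linear_combination -h0)
      have h4 := (h.refl_one hN).comm (h.refl k (by omega) hk2) le_rfl (by omega) (by omega) hk2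
        (by omega) (by omega) (by rwa [Nat.cast_one]) (by rwa [Nat.cast_one])
      rw [← hk, pow_two]
      nth_rewrite 2 [h4]
      rw [mul_assoc, ← mul_assoc (s k), h.s_mul_self hN, one_mul, h.s_mul_self hN]
  · rw [add_right_comm]
    exact h.mul_pow_shift hi

theorem w_mul_self : w * w = 1 := h.flip.mul_self

theorem w_inv : w⁻¹ = w := inv_eq_of_mul_eq_one_left h.w_mul_self

theorem w_mul_shift (hN : 1 ≤ N) : w * π = π⁻¹ * w := by
  have h1 := IsFlip.shift_mul_flip_sq hN h.shift h.flip
  rw [← mul_assoc, mul_eq_one_iff_eq_inv, h.w_inv] at h1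
  rw [eq_inv_mul_iff_mul_eq, ← mul_assoc, h1]

theorem w_mul_shift_inv (hN : 1 ≤ N) : w * π⁻¹ = π * w := by
  rw [mul_inv_eq_iff_eq_mul, mul_assoc, h.w_mul_shift hN, mul_inv_cancel_left]

theorem w_mul_s (hN : 1 ≤ N) (i : ZMod (2 * N + 1)) : w * s i = s (-i) * w := by
  revert i
  refine zmod_induction 1 ?_ fun i hi => ?_
  · have h1 : s (-1) = s ((2 * N : ℕ) : ZMod (2 * N + 1)) := by
      congr 1
      have := ZMod.natCast_self (2 * N + 1)
      rw [Nat.cast_add, Nat.cast_one] at this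
      linear_combination -this
    rw [h1]
    exact h.flip.mul_refl (h.refl_one hN) (h.refl (2 * N) (by omega) le_rfl) le_rfl (by omega)
  · have h1 := h.map_succ (-(i + 1))
    rw [show -(i + 1) + 1 = -i by ring] at h1
    rw [h.map_succ, ← mul_assoc, ← mul_assoc, h.w_mul_shift hN, mul_assoc π⁻¹, hi, h1]
    simp only [mul_assoc, h.w_mul_shift_inv hN, inv_mul_cancel_left]

theorem mu_mul_self (hN : 1 ≤ N) : μ * μ = 1 := h.inversion.mul_self hN

theorem mu_mul_w (hN : 1 ≤ N) : μ * w = w * μ := h.flip.inversion_mul hN h.inversion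

theorem mu_mul_shift_sq (hN : 1 ≤ N) : μ * (π * π) = π * π * μ :=
  h.inversion.mul_shift_sq hN h.shift

/-- Commutation with π² makes the two neighbouring conjugates of μ coincide, which gives r the
effect of exchanging μ_0 and μ_1. -/
theorem conj_mu (hN : 1 ≤ N) : π⁻¹ * μ * π = π * μ * π⁻¹ := by
  rw [eq_mul_inv_iff_mul_eq, mul_assoc, mul_assoc, h.mu_mul_shift_sq hN, mul_assoc,
    inv_mul_cancel_left]

theorem mu_mul_s (hN : 1 ≤ N) (i : ZMod (2 * N + 1)) : μ * s i = s i * μ := by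
  have h1 : ∀ i, s (i + 2) = π * π * s i * (π * π)⁻¹ := by
    intro i
    rw [show i + 2 = i + 1 + 1 by ring, h.map_succ, h.map_succ]
    group
  have h2 : ∀ n : ℕ, μ * s (2 + 2 * n) = s (2 + 2 * n) * μ := by
    intro n
    induction n with
    | zero => simpa using (h.refl_two hN).inversion_mul hN h.inversion
    | succ n ih =>
      have h3 : (π * π)⁻¹ * μ = μ * (π * π)⁻¹ := by
        rw [inv_mul_eq_iff_eq_mul, ← mul_assoc, ← h.mu_mul_shift_sq hN, mul_inv_cancel_right]
      rw [show (2 : ZMod (2 * N + 1)) + 2 * ((n + 1 : ℕ) : ZMod (2 * N + 1)) = 2 + 2 * n + 2 by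
        push_cast; ring, h1, ← mul_assoc, ← mul_assoc, h.mu_mul_shift_sq hN, mul_assoc (π * π) μ, ih,
        mul_assoc _ _ μ, h3]
      simp only [mul_assoc]
  -- N + 1 is the inverse of 2 modulo 2N+1, so steps of two starting at 2 reach every i.
  have h3 := h2 (((i - 2) * (N + 1)).val)
  have h4 : (2 : ZMod (2 * N + 1)) + 2 * ((i - 2) * (N + 1)) = i := by
    have := ZMod.natCast_self (2 * N + 1)
    push_cast at this
    linear_combination (i - 2) * this
  rwa [ZMod.natCast_zmod_val, h4] at h3

theorem map_a (hN : 1 ≤ N) (i j : ZMod (2 * N + 1)) : s i (a N j) = a N j * a N i ^ cart i j := by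
  revert i j
  refine zmod_induction 1 (fun j => ?_) fun i hi j => ?_
  · have := (h.refl_one hN).map_a j
    rwa [Nat.cast_one] at this
  · have h1 : π⁻¹ (a N j) = a N (j - 1) := by
      have h2 : π (a N (j - 1)) = a N j := by rw [h.shift.map_a, sub_add_cancel]
      rw [← h2]; exact π.symm_apply_apply _
    rw [h.map_succ, AlgEquiv.mul_apply, AlgEquiv.mul_apply, h1, hi, map_mul, map_zpow₀,
      h.shift.map_a, h.shift.map_a, sub_add_cancel, ← cart_add i (j - 1) 1, sub_add_cancel]

theorem shift_inv_map_t : π⁻¹ (t N) = t N := by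
  conv_lhs => rw [← h.shift.map_t]
  exact π.symm_apply_apply _

theorem shift_inv_map_b : π⁻¹ (b N) = (q N)⁻¹ * b N := by
  have h1 : π ((q N)⁻¹ * b N) = b N := by
    rw [map_mul, map_inv₀, h.shift.map_q, h.shift.map_b, inv_mul_cancel_left₀ q_ne_zero]
  conv_lhs => rw [← h1]
  exact π.symm_apply_apply _

theorem shift_inv_map_c : π⁻¹ (c N) = (c N)⁻¹ := by
  have h1 : π (c N)⁻¹ = c N := by rw [map_inv₀, h.shift.map_c, inv_inv]
  conv_lhs => rw [← h1]
  exact π.symm_apply_apply _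

theorem map_t (hN : 1 ≤ N) (i : ZMod (2 * N + 1)) : s i (t N) = t N := by
  revert i
  refine zmod_induction 1 (h.refl_one hN).map_t fun i hi => ?_
  rw [h.map_succ, AlgEquiv.mul_apply, AlgEquiv.mul_apply, h.shift_inv_map_t, hi, h.shift.map_t]

theorem map_b (hN : 1 ≤ N) (i : ZMod (2 * N + 1)) : s i (b N) = b N := by
  revert i
  refine zmod_induction 1 (h.refl_one hN).map_b fun i hi => ?_
  have h1 : s i (q N) = q N := by rw [q, map_pow, h.map_t hN]
  rw [h.map_succ, AlgEquiv.mul_apply, AlgEquiv.mul_apply, h.shift_inv_map_b, map_mul, map_inv₀, h1, hi,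
    map_mul, map_inv₀, h.shift.map_q, h.shift.map_b, inv_mul_cancel_left₀ q_ne_zero]

end IsSystem

end Group

/-! ### Faithfulness on roots and the orders of the translations. -/

section Structure

variable {N : ℕ}

/-- Evaluating the polynomial identity at t = 2 leaves a power of 2 equal to 1. -/
theorem t_zpow_eq_one {k : ℤ} (h : t N ^ k = 1) : k = 0 := by
  have h1 : ∀ n : ℕ, t N ^ n = 1 → n = 0 := by
    intro n hn
    rw [t, var, ← map_pow, ← map_one (algebraMap (MvPolynomial (Var N) ℂ) (K N))] at hn
    have h2 := congrArg (MvPolynomial.eval fun _ => (2 : ℂ))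
      (IsFractionRing.injective (MvPolynomial (Var N) ℂ) (K N) hn)
    rw [map_pow, MvPolynomial.eval_X, map_one] at h2
    have h3 : (2 : ℕ) ^ n = 1 := by exact_mod_cast h2
    rw [Nat.pow_eq_one] at h3
    omega
  rcases k.eq_nat_or_neg with ⟨n, rfl | rfl⟩
  · rw [zpow_natCast] at h
    rw [h1 n h, Nat.cast_zero]
  · rw [zpow_neg, inv_eq_one, zpow_natCast] at h
    rw [h1 n h, Nat.cast_zero, neg_zero]

theorem q_zpow_eq_one (hN : 1 ≤ N) {k : ℤ} (h : q N ^ k = 1) : k = 0 := by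
  rw [q, ← zpow_natCast, ← zpow_mul] at h
  have := (mul_eq_zero.1 (t_zpow_eq_one h))
  omega

theorem eps_zpow_eq_one {k : ℤ} (h : eps N ^ k = 1) : k = 0 := by
  rw [eps, ← zpow_mul] at h
  have := (mul_eq_zero.1 (t_zpow_eq_one h))
  omega

theorem t_inv_ne : (t N)⁻¹ ≠ t N := by
  intro h
  have : t N ^ (-2 : ℤ) = 1 := by
    rw [show (-2 : ℤ) = -1 + -1 by norm_num, zpow_add₀ t_ne_zero, zpow_neg_one]
    nth_rewrite 2 [h]
    exact inv_mul_cancel₀ t_ne_zero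
  have := t_zpow_eq_one this
  omega

theorem map_eq_of_mem_closure {A : Set (Bir N)} {y : K N} (hA : ∀ u ∈ A, u y = y) {g : Bir N}
    (hg : g ∈ Subgroup.closure A) : g y = y := by
  have : Subgroup.closure A ≤ MulAction.stabilizer (Bir N) y := (Subgroup.closure_le _).2 hA
  exact this hg

theorem affineA_apply (n : ℕ) (i j : ZMod n) :
    affineA n i j = if i = j then 1 else if j = i + 1 ∨ i = j + 1 then 3 else 2 := rfl

namespace IsSystem

variable {s : ZMod (2 * N + 1) → Bir N} {π w μ : Bir N} (h : IsSystem N s π w μ)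
include h

theorem isLiftable (hN : 1 ≤ N) : (affineA (2 * N + 1)).IsLiftable s := by
  intro i j
  rw [affineA_apply]
  split_ifs with h1 h2
  · rw [← h1, pow_one, h.s_mul_self hN]
  · rcases h2 with rfl | rfl
    · exact h.s_braid hN i
    · have := h.s_braid' hN (j + 1)
      rwa [add_sub_cancel_right] at this
  · rw [not_or] at h2
    exact h.s_mul_comm hN h2.1 fun h3 => h2.2 (by rw [h3, sub_add_cancel])

/-- On the a_i the s_i act as simple reflections on exponentiated simple roots, with off-diagonal
Coxeter labels 2 and 3 only, and positive products of the a_i are never 1; the root criterion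
applies. -/
theorem eq_one_of_lift (hN : 1 ≤ N) (v : (affineA (2 * N + 1)).Group)
    (hv : ∀ i, (affineA (2 * N + 1)).toCoxeterSystem.lift ⟨s, h.isLiftable hN⟩ v (a N i) = a N i) :
    v = 1 := by
  have hs : ∀ i, (affineA (2 * N + 1)).toCoxeterSystem.lift ⟨s, h.isLiftable hN⟩
      ((affineA (2 * N + 1)).toCoxeterSystem.simple i) = s i :=
    (affineA (2 * N + 1)).toCoxeterSystem.lift_apply_simple (h.isLiftable hN)
  refine eq_one_of_map_root_eq (affineA (2 * N + 1)).toCoxeterSystem _ (a N) ?_ ?_ ?_ ?_ a_ne_zero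
    (a_mul_ne_one hN) v hv
  · intro i j hij
    rw [affineA_apply, if_neg hij]
    split_ifs <;> simp
  · intro i
    rw [hs, h.map_a hN, cart_self hN, zpow_neg, ← div_eq_mul_inv, div_eq_iff (zpow_ne_zero _ (a_ne_zero _)),
      zpow_ofNat, pow_two, inv_mul_cancel_left₀ (a_ne_zero _)]
  · intro i j hij
    have h1 : i ≠ j := by rintro rfl; simp at hij
    have h2 : ¬(j = i + 1 ∨ i = j + 1) := by
      intro h2; simp [affineA_apply, h1, h2] at hij
    rw [not_or] at h2
    rw [hs, h.map_a hN, cart_of_ne h1.symm h2.1 fun h3 => h2.2 (by rw [h3, sub_add_cancel]),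
      zpow_zero, mul_one]
  · intro i j hij
    have h1 : i ≠ j := by rintro rfl; simp at hij
    have h2 : j = i + 1 ∨ i = j + 1 := by
      by_contra h2; simp [affineA_apply, h1, h2] at hij
    rw [hs, h.map_a hN, mul_comm]
    rcases h2 with rfl | rfl
    · rw [cart_add_one hN, zpow_one]
    · have := cart_sub_one hN (j + 1)
      rw [add_sub_cancel_right] at this
      rw [this, zpow_one]

theorem isCoxeterGroup_s (hN : 1 ≤ N) : IsCoxeterGroup (affineA (2 * N + 1)) s := by
  refine isCoxeterGroup_of_injective s (h.isLiftable hN) ?_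
  rw [injective_iff_map_eq_one]
  intro v hv
  refine h.eq_one_of_lift hN v fun i => ?_
  rw [hv, AlgEquiv.one_apply]

theorem eq_one_of_mem_closure_s (hN : 1 ≤ N) {g : Bir N} (hg : g ∈ Subgroup.closure (Set.range s))
    (ha : ∀ i, g (a N i) = a N i) : g = 1 := by
  have h1 : Subgroup.closure (Set.range s) ≤
      ((affineA (2 * N + 1)).toCoxeterSystem.lift ⟨s, h.isLiftable hN⟩).range := by
    rw [Subgroup.closure_le]
    rintro _ ⟨i, rfl⟩
    exact ⟨_, (affineA (2 * N + 1)).toCoxeterSystem.lift_apply_simple (h.isLiftable hN) i⟩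
  obtain ⟨v, rfl⟩ := h1 hg
  rw [h.eq_one_of_lift hN v ha, map_one]

theorem zpow_map_t (k : ℤ) : (π ^ k) (t N) = t N := by
  rcases k.eq_nat_or_neg with ⟨n, rfl | rfl⟩
  · rw [zpow_natCast, h.shift.pow_map_t]
  · rw [zpow_neg, zpow_natCast]
    exact IsShift.pow_inv_apply (h.shift.pow_map_t n)

theorem zpow_map_q (k : ℤ) : (π ^ k) (q N) = q N := by rw [q, map_pow, h.zpow_map_t]

theorem zpow_map_b (k : ℤ) : (π ^ k) (b N) = q N ^ k * b N := by
  rcases k.eq_nat_or_neg with ⟨n, rfl | rfl⟩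
  · rw [zpow_natCast, zpow_natCast, h.shift.pow_map_b]
  · rw [zpow_neg, zpow_neg, zpow_natCast, zpow_natCast]
    refine IsShift.pow_inv_apply ?_
    rw [map_mul, map_inv₀, map_pow, h.shift.pow_map_q, h.shift.pow_map_b,
      inv_mul_cancel_left₀ (pow_ne_zero _ q_ne_zero)]

theorem w_mul_zpow (hN : 1 ≤ N) (k : ℤ) : w * π ^ k = π ^ (-k) * w := by
  have h1 : w * π * w⁻¹ = π⁻¹ := by rw [h.w_mul_shift hN, mul_inv_cancel_right]
  have h2 := conj_zpow (a := w) (b := π) (i := k)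
  rw [h1, inv_zpow, ← zpow_neg, eq_mul_inv_iff_mul_eq] at h2
  exact h2.symm

/-- Because w_1 inverts π under conjugation, words in w_0 and w_1 reduce to an even power of π times
at most one w_1. -/
theorem mem_closure_w (hN : 1 ≤ N) {g : Bir N}
    (hg : g ∈ Subgroup.closure (Set.range ![π ^ 2 * w, w])) :
    ∃ k : ℤ, g = π ^ (2 * k) ∨ g = π ^ (2 * k) * w := by
  have hw := h.w_mul_self
  have hwi := h.w_inv
  have hz := h.w_mul_zpow hN
  induction hg using Subgroup.closure_induction with
  | mem x hx =>
    obtain ⟨i, rfl⟩ := hx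
    fin_cases i
    · exact ⟨1, Or.inr rfl⟩
    · exact ⟨0, Or.inr (by simp)⟩
  | one => exact ⟨0, Or.inl (by simp)⟩
  | mul x y _ _ hx hy =>
    obtain ⟨k, rfl | rfl⟩ := hx <;> obtain ⟨l, rfl | rfl⟩ := hy
    · exact ⟨k + l, Or.inl (by rw [← zpow_add]; ring_nf)⟩
    · exact ⟨k + l, Or.inr (by rw [← mul_assoc, ← zpow_add]; ring_nf)⟩
    · exact ⟨k - l, Or.inr (by rw [mul_assoc, hz, ← mul_assoc, ← zpow_add]; ring_nf)⟩
    · exact ⟨k - l, Or.inl (by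
        rw [mul_assoc, ← mul_assoc w, hz, mul_assoc, hw, mul_one, ← zpow_add]; ring_nf)⟩
  | inv x _ hx =>
    obtain ⟨k, rfl | rfl⟩ := hx
    · exact ⟨-k, Or.inl (by rw [← zpow_neg]; ring_nf)⟩
    · exact ⟨k, Or.inr (by rw [mul_inv_rev, hwi, ← zpow_neg, hz, neg_neg])⟩

theorem zpow_mul_w_map_t (k : ℤ) : (π ^ k * w) (t N) = (t N)⁻¹ := by
  rw [AlgEquiv.mul_apply, h.flip.map_t, map_inv₀, h.zpow_map_t]

theorem zpow_mul_w_map_b (k : ℤ) : (π ^ k * w) (b N) = q N ^ (2 * N + 1 + k) * b N := by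
  rw [AlgEquiv.mul_apply, h.flip.map_b, Q, map_mul, map_pow, h.zpow_map_q, h.zpow_map_b, ← mul_assoc,
    zpow_add₀ q_ne_zero]
  norm_cast

theorem m_map_t (k : Fin 2) : ![π⁻¹ * μ * π, μ] k (t N) = t N := by
  fin_cases k
  · simp [AlgEquiv.mul_apply, h.shift.map_t, h.inversion.map_t, h.shift_inv_map_t]
  · exact h.inversion.map_t

theorem m_map_b (k : Fin 2) : ![π⁻¹ * μ * π, μ] k (b N) = b N := by
  fin_cases k
  · have hq : π⁻¹ (q N) = q N := by rw [q, map_pow, h.shift_inv_map_t]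
    change (π⁻¹ * μ * π) (b N) = b N
    rw [AlgEquiv.mul_apply, AlgEquiv.mul_apply, h.shift.map_b, map_mul, h.inversion.map_q,
      h.inversion.map_b, map_mul, hq, h.shift_inv_map_b, mul_inv_cancel_left₀ q_ne_zero]
  · exact h.inversion.map_b

theorem m_map_a (k : Fin 2) (i : ZMod (2 * N + 1)) : ![π⁻¹ * μ * π, μ] k (a N i) = a N i := by
  fin_cases k
  · have : π⁻¹ (a N (i + 1)) = a N i := by rw [← h.shift.map_a]; exact π.symm_apply_apply _
    simp [AlgEquiv.mul_apply, h.shift.map_a, h.inversion.map_a, this]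
  · exact h.inversion.map_a i

theorem m_map_c : (π⁻¹ * μ * π * μ) (c N) = eps N ^ 2 * c N := by
  have h1 : π (eps N) = eps N := by rw [eps, map_zpow₀, h.shift.map_t]
  have h2 : π⁻¹ (eps N) = eps N := by rw [eps, map_zpow₀, h.shift_inv_map_t]
  have h3 := eps_ne_zero (N := N)
  have h4 := c_ne_zero (N := N)
  simp only [AlgEquiv.mul_apply, h.inversion.map_c, map_div₀, h1, h2, h.shift.map_c, map_inv₀,
    h.inversion.map_eps, h.shift_inv_map_c]
  field_simp

theorem w_pow_ne_one (hN : 1 ≤ N) {n : ℕ} (hn : 0 < n) : (π ^ 2 * w * w) ^ n ≠ 1 := by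
  intro h1
  rw [mul_assoc, h.w_mul_self, mul_one, ← pow_mul] at h1
  have h2 := h.shift.pow_map_b (2 * n)
  rw [h1, AlgEquiv.one_apply, eq_comm, mul_eq_right₀ b_ne_zero, ← zpow_natCast] at h2
  have := q_zpow_eq_one hN h2
  omega

theorem m_pow_ne_one {n : ℕ} (hn : 0 < n) : (π⁻¹ * μ * π * μ) ^ n ≠ 1 := by
  have h0 : ∀ n : ℕ, ((π⁻¹ * μ * π * μ) ^ n) (c N) = eps N ^ (2 * n) * c N := by
    intro n
    induction n with
    | zero => simp
    | succ n ih =>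
      have h2 : (π⁻¹ * μ * π * μ) (eps N) = eps N := by
        have h3 : (π⁻¹ * μ * π * μ) (t N) = t N := by
          have := h.m_map_t 0
          rw [AlgEquiv.mul_apply, h.inversion.map_t]
          exact this
        rw [eps, map_zpow₀, h3]
      rw [pow_succ', AlgEquiv.mul_apply, ih, map_mul, map_pow, h2, h.m_map_c]
      ring
  intro h1
  have h2 := h0 n
  rw [h1, AlgEquiv.one_apply, eq_comm, mul_eq_right₀ c_ne_zero, ← zpow_natCast] at h2
  have := eps_zpow_eq_one h2
  omega

end IsSystem

end Structure

/-! ### Remaining relations and the decomposition of the group. -/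

section Relations

variable {N : ℕ}

namespace IsSystem

variable {s : ZMod (2 * N + 1) → Bir N} {π w μ : Bir N} (h : IsSystem N s π w μ)
include h

theorem r_sq (hN : 1 ≤ N) : (π * w) ^ 2 = 1 := by
  rw [pow_two, mul_assoc, ← mul_assoc w, h.w_mul_shift hN, mul_assoc, h.w_mul_self, mul_one,
    mul_inv_cancel]

theorem w_sq (hN : 1 ≤ N) (k : Fin 2) : ![π ^ 2 * w, w] k ^ 2 = 1 := by
  have h1 := h.w_mul_zpow hN 2
  have h2 := h.w_mul_self
  fin_cases k
  · change (π ^ (2 : ℤ) * w) ^ 2 = 1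
    rw [pow_two, mul_assoc, ← mul_assoc w, h1, mul_assoc, h2, mul_one, ← zpow_add, add_neg_cancel,
      zpow_zero]
  · change w ^ 2 = 1
    rw [pow_two, h2]

theorem w_mul_s' (hN : 1 ≤ N) (i : ZMod (2 * N + 1)) : π ^ 2 * w * s i = s (2 - i) * (π ^ 2 * w) := by
  rw [mul_assoc, h.w_mul_s hN, pow_two, mul_assoc, ← mul_assoc π (s (-i)), h.conj, mul_assoc,
    ← mul_assoc π (s (-i + 1)), h.conj, show -i + 1 + 1 = 2 - i by ring]
  simp only [mul_assoc]

theorem r_mul_s (hN : 1 ≤ N) (i : ZMod (2 * N + 1)) : π * w * s i = s (1 - i) * (π * w) := by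
  rw [mul_assoc, h.w_mul_s hN, ← mul_assoc, h.conj, show -i + 1 = 1 - i by ring, mul_assoc]

theorem r_mul_w_zero (hN : 1 ≤ N) : π * w * (π ^ 2 * w) = w * (π * w) := by
  have h1 := h.w_mul_zpow hN 2
  have h2 : w * π ^ 2 = π ^ (-2 : ℤ) * w := h1
  have h3 := h.w_mul_self
  rw [mul_assoc, ← mul_assoc w, h2, mul_assoc, h3, mul_one, ← mul_assoc w, h.w_mul_shift hN,
    mul_assoc, h3, mul_one]
  group

theorem r_mul_w_one (hN : 1 ≤ N) : π * w * w = π ^ 2 * w * (π * w) := by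
  have h3 := h.w_mul_self
  rw [mul_assoc, h3, mul_assoc, ← mul_assoc w, h.w_mul_shift hN, mul_assoc, h3]
  group

theorem m_sq (hN : 1 ≤ N) (k : Fin 2) : ![π⁻¹ * μ * π, μ] k ^ 2 = 1 := by
  have h2 := h.mu_mul_self hN
  fin_cases k
  · change (π⁻¹ * μ * π) ^ 2 = 1
    have := conj_pow (a := π⁻¹) (b := μ) (i := 2)
    rw [inv_inv] at this
    rw [this, pow_two, h2, mul_one, inv_mul_cancel]
  · change μ ^ 2 = 1
    rw [pow_two, h2]

theorem m_mul_s (hN : 1 ≤ N) (k : Fin 2) (i : ZMod (2 * N + 1)) :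
    ![π⁻¹ * μ * π, μ] k * s i = s i * ![π⁻¹ * μ * π, μ] k := by
  fin_cases k
  · change π⁻¹ * μ * π * s i = s i * (π⁻¹ * μ * π)
    have h1 : s i * π⁻¹ = π⁻¹ * s (i + 1) := by
      rw [h.map_succ]; group
    rw [mul_assoc, h.conj, ← mul_assoc, mul_assoc π⁻¹, h.mu_mul_s hN, ← mul_assoc, ← h1]
    simp only [mul_assoc]
  · exact h.mu_mul_s hN i

theorem conj_mu_mul_w (hN : 1 ≤ N) : π⁻¹ * μ * π * w = w * (π⁻¹ * μ * π) := by
  rw [← mul_assoc, ← mul_assoc, h.w_mul_shift_inv hN, mul_assoc π w, ← h.mu_mul_w hN, h.conj_mu hN,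
    mul_assoc (π * μ), ← h.w_mul_shift hN]
  simp only [mul_assoc]

theorem conj_mu_mul_shift_sq (hN : 1 ≤ N) : π⁻¹ * μ * π * (π * π) = π * π * (π⁻¹ * μ * π) := by
  have h1 := h.mu_mul_shift_sq hN
  have h2 : π⁻¹ * μ * π * (π * π) = π⁻¹ * (μ * (π * π)) * π := by simp only [mul_assoc]
  rw [h2, h1]
  group

theorem m_mul_w (hN : 1 ≤ N) (k l : Fin 2) :
    ![π⁻¹ * μ * π, μ] k * ![π ^ 2 * w, w] l = ![π ^ 2 * w, w] l * ![π⁻¹ * μ * π, μ] k := by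
  have h0 : ∀ ν : Bir N, ν * w = w * ν → ν * (π * π) = π * π * ν →
      ν * (π ^ 2 * w) = π ^ 2 * w * ν := by
    intro ν h1 h2
    rw [pow_two, ← mul_assoc, h2, mul_assoc, h1, ← mul_assoc]
  fin_cases k <;> fin_cases l
  · exact h0 _ (h.conj_mu_mul_w hN) (h.conj_mu_mul_shift_sq hN)
  · exact h.conj_mu_mul_w hN
  · exact h0 _ (h.mu_mul_w hN) (h.mu_mul_shift_sq hN)
  · exact h.mu_mul_w hN

theorem r_mul_m_zero (hN : 1 ≤ N) : π * w * (π⁻¹ * μ * π) = μ * (π * w) := by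
  rw [mul_assoc, ← h.conj_mu_mul_w hN]
  group

theorem r_mul_m_one (hN : 1 ≤ N) : π * w * μ = π⁻¹ * μ * π * (π * w) := by
  rw [h.conj_mu hN, mul_assoc, ← h.mu_mul_w hN]
  group

theorem r_inv (hN : 1 ≤ N) : (π * w)⁻¹ = π * w :=
  inv_eq_of_mul_eq_one_left (by rw [← pow_two, h.r_sq hN])

theorem r_map_t : (π * w) (t N) = (t N)⁻¹ := by
  have := h.zpow_mul_w_map_t 1
  rwa [zpow_one] at this

theorem r_map_b : (π * w) (b N) = q N ^ (2 * (N : ℤ) + 2) * b N := by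
  have := h.zpow_mul_w_map_b 1
  rwa [zpow_one, add_assoc] at this

theorem r_ne_one : π * w ≠ 1 := by
  intro h1
  have := h.r_map_t
  rw [h1, AlgEquiv.one_apply] at this
  exact t_inv_ne this.symm

/-- In the normal form, t detects the factor w_1, and b detects the exponent of π. -/
theorem mem_closure_w_of_map (hN : 1 ≤ N) {g : Bir N}
    (hg : g ∈ Subgroup.closure (Set.range ![π ^ 2 * w, w])) (ht : g (t N) = t N)
    (hb : g (b N) = b N) : g = 1 := by
  obtain ⟨k, rfl | rfl⟩ := h.mem_closure_w hN hg
  · rw [h.zpow_map_b, mul_eq_right₀ b_ne_zero] at hb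
    rw [q_zpow_eq_one hN hb, zpow_zero]
  · rw [h.zpow_mul_w_map_t] at ht
    exact absurd ht t_inv_ne

theorem s_fix_t (hN : 1 ≤ N) {g : Bir N} (hg : g ∈ Subgroup.closure (Set.range s)) :
    g (t N) = t N :=
  map_eq_of_mem_closure (by rintro _ ⟨i, rfl⟩; exact h.map_t hN i) hg

theorem s_fix_b (hN : 1 ≤ N) {g : Bir N} (hg : g ∈ Subgroup.closure (Set.range s)) :
    g (b N) = b N :=
  map_eq_of_mem_closure (by rintro _ ⟨i, rfl⟩; exact h.map_b hN i) hg

theorem m_fix_t {g : Bir N} (hg : g ∈ Subgroup.closure (Set.range ![π⁻¹ * μ * π, μ])) :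
    g (t N) = t N :=
  map_eq_of_mem_closure (by rintro _ ⟨i, rfl⟩; exact h.m_map_t i) hg

theorem m_fix_b {g : Bir N} (hg : g ∈ Subgroup.closure (Set.range ![π⁻¹ * μ * π, μ])) :
    g (b N) = b N :=
  map_eq_of_mem_closure (by rintro _ ⟨i, rfl⟩; exact h.m_map_b i) hg

theorem m_fix_a {g : Bir N} (hg : g ∈ Subgroup.closure (Set.range ![π⁻¹ * μ * π, μ]))
    (i : ZMod (2 * N + 1)) : g (a N i) = a N i :=
  map_eq_of_mem_closure (by rintro _ ⟨k, rfl⟩; exact h.m_map_a k i) hg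

theorem w_conj_s (hN : 1 ≤ N) : ∀ u ∈ Subgroup.closure (Set.range ![π ^ 2 * w, w]),
    ∀ x ∈ Subgroup.closure (Set.range s), u * x * u⁻¹ ∈ Subgroup.closure (Set.range s) := by
  refine conj_mem_closure ?_ ?_
  · rintro _ ⟨k, rfl⟩
    exact inv_eq_of_mul_eq_one_left (by rw [← pow_two, h.w_sq hN])
  · rintro _ ⟨k, rfl⟩ _ ⟨i, rfl⟩
    fin_cases k
    · change π ^ 2 * w * s i * (π ^ 2 * w)⁻¹ ∈ _
      rw [h.w_mul_s' hN, mul_inv_cancel_right]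
      exact Subgroup.subset_closure ⟨_, rfl⟩
    · change w * s i * w⁻¹ ∈ _
      rw [h.w_mul_s hN, mul_inv_cancel_right]
      exact Subgroup.subset_closure ⟨_, rfl⟩

theorem m_commute (hN : 1 ≤ N) : ∀ u ∈ Subgroup.closure (Set.range ![π⁻¹ * μ * π, μ]),
    ∀ x ∈ Subgroup.closure (Set.range s) ⊔ Subgroup.closure (Set.range ![π ^ 2 * w, w]),
      u * x = x * u := by
  rw [← Subgroup.closure_union]
  refine commute_closure ?_
  rintro _ ⟨k, rfl⟩ _ (⟨i, rfl⟩ | ⟨l, rfl⟩)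
  · exact h.m_mul_s hN k i
  · exact h.m_mul_w hN k l

theorem isSemidirect_s_w (hN : 1 ≤ N) : IsSemidirect (Subgroup.closure (Set.range s))
    (Subgroup.closure (Set.range ![π ^ 2 * w, w]))
    (Subgroup.closure (Set.range s) ⊔ Subgroup.closure (Set.range ![π ^ 2 * w, w])) := by
  refine ⟨rfl, (Subgroup.eq_bot_iff_forall _).2 fun g hg => ?_, h.w_conj_s hN⟩
  exact h.mem_closure_w_of_map hN hg.2 (h.s_fix_t hN hg.1) (h.s_fix_b hN hg.1)

/-- For g = y u in the intersection, g and y fix t and b, so u = 1. Then y = g fixes all a_i as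
well, and faithfulness on the roots gives y = 1. -/
theorem isDirect_m (hN : 1 ≤ N) :
    IsDirect (Subgroup.closure (Set.range s) ⊔ Subgroup.closure (Set.range ![π ^ 2 * w, w]))
      (Subgroup.closure (Set.range ![π⁻¹ * μ * π, μ]))
      (Subgroup.closure (Set.range s) ⊔ Subgroup.closure (Set.range ![π ^ 2 * w, w]) ⊔
        Subgroup.closure (Set.range ![π⁻¹ * μ * π, μ])) := by
  refine ⟨rfl, (Subgroup.eq_bot_iff_forall _).2 fun g hg => ?_, h.m_commute hN⟩
  obtain ⟨y, hy, u, hu, hyu⟩ := mem_sup_of_conj (h.w_conj_s hN) hg.1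
  have h1 : u = y⁻¹ * g := by rw [← hyu, inv_mul_cancel_left]
  have hu1 : u = 1 := by
    refine h.mem_closure_w_of_map hN hu ?_ ?_
    · rw [h1, AlgEquiv.mul_apply, h.m_fix_t hg.2, h.s_fix_t hN (inv_mem hy)]
    · rw [h1, AlgEquiv.mul_apply, h.m_fix_b hg.2, h.s_fix_b hN (inv_mem hy)]
  rw [hu1, mul_one] at hyu
  rw [← hyu]
  refine h.eq_one_of_mem_closure_s hN hy fun i => ?_
  rw [hyu, h.m_fix_a hg.2]

/-- Parity decides. After removing the factors that fix t and b, r would agree on them with some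
π^{2k} w_1, which multiplies b by q^{2N+1+2k}; r multiplies it by q^{2N+2}. -/
theorem r_notMem (hN : 1 ≤ N) :
    π * w ∉ Subgroup.closure (Set.range s) ⊔ Subgroup.closure (Set.range ![π ^ 2 * w, w]) ⊔
      Subgroup.closure (Set.range ![π⁻¹ * μ * π, μ]) := by
  intro hr
  obtain ⟨x, hx, v, hv, hxv⟩ := mem_sup_of_conj (fun u hu x hx => by
    rwa [h.m_commute hN u hu x hx, mul_inv_cancel_right]) hr
  obtain ⟨y, hy, u, hu, hyu⟩ := mem_sup_of_conj (h.w_conj_s hN) hx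
  have h1 : u = y⁻¹ * ((π * w) * v⁻¹) := by
    rw [← hxv, ← hyu, mul_inv_cancel_right, inv_mul_cancel_left]
  have hy' := inv_mem hy
  have hq : y⁻¹ (q N) = q N := by rw [q, map_pow, h.s_fix_t hN hy']
  have ht : u (t N) = (t N)⁻¹ := by
    rw [h1, AlgEquiv.mul_apply, AlgEquiv.mul_apply, h.m_fix_t (inv_mem hv), h.r_map_t, map_inv₀,
      h.s_fix_t hN hy']
  have hb : u (b N) = q N ^ (2 * (N : ℤ) + 2) * b N := by
    rw [h1, AlgEquiv.mul_apply, AlgEquiv.mul_apply, h.m_fix_b (inv_mem hv), h.r_map_b, map_mul,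
      map_zpow₀, hq, h.s_fix_b hN hy']
  obtain ⟨k, rfl | rfl⟩ := h.mem_closure_w hN hu
  · rw [h.zpow_map_t] at ht
    exact t_inv_ne ht.symm
  · rw [h.zpow_mul_w_map_b] at hb
    have h2 := mul_right_cancel₀ b_ne_zero hb
    have h3 : q N ^ (2 * (N : ℤ) + 1 + 2 * k - (2 * (N : ℤ) + 2)) = 1 := by
      rw [zpow_sub₀ q_ne_zero, h2, div_self (zpow_ne_zero _ q_ne_zero)]
    have := q_zpow_eq_one hN h3
    omega

theorem isSemidirect_r (hN : 1 ≤ N) :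
    IsSemidirect (Subgroup.closure (Set.range s) ⊔ Subgroup.closure (Set.range ![π ^ 2 * w, w]) ⊔
      Subgroup.closure (Set.range ![π⁻¹ * μ * π, μ])) (Subgroup.closure {π * w})
      (Subgroup.closure (Set.range s ∪ Set.range ![π ^ 2 * w, w] ∪ Set.range ![π⁻¹ * μ * π, μ] ∪
        {π * w})) := by
  refine ⟨?_, (Subgroup.eq_bot_iff_forall _).2 fun g hg => ?_, ?_⟩
  · rw [Subgroup.closure_union, Subgroup.closure_union, Subgroup.closure_union]
  · obtain ⟨n, hn⟩ := Subgroup.mem_closure_singleton.1 hg.2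
    rcases Int.even_or_odd' n with ⟨k, rfl | rfl⟩
    · rw [← hn, zpow_mul]
      have := h.r_sq hN
      rw [show (π * w) ^ (2 : ℤ) = (π * w) ^ 2 from rfl, this, one_zpow]
    · have h2 : g = π * w := by
        rw [← hn, zpow_add, zpow_mul, show (π * w) ^ (2 : ℤ) = (π * w) ^ 2 from rfl, h.r_sq hN,
          one_zpow, one_mul, zpow_one]
      exact absurd (h2 ▸ hg.1) (h.r_notMem hN)
  · rw [← Subgroup.closure_union, ← Subgroup.closure_union]
    refine conj_mem_closure ?_ ?_
    · rintro _ rfl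
      exact h.r_inv hN
    · rintro _ rfl _ ((⟨i, rfl⟩ | ⟨k, rfl⟩) | ⟨k, rfl⟩)
      · rw [h.r_mul_s hN, mul_inv_cancel_right]
        exact Subgroup.subset_closure (Or.inl (Or.inl ⟨_, rfl⟩))
      · fin_cases k
        · change π * w * (π ^ 2 * w) * (π * w)⁻¹ ∈ _
          rw [h.r_mul_w_zero hN, mul_inv_cancel_right]
          exact Subgroup.subset_closure (Or.inl (Or.inr ⟨1, rfl⟩))
        · change π * w * w * (π * w)⁻¹ ∈ _
          rw [h.r_mul_w_one hN, mul_inv_cancel_right]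
          exact Subgroup.subset_closure (Or.inl (Or.inr ⟨0, rfl⟩))
      · fin_cases k
        · change π * w * (π⁻¹ * μ * π) * (π * w)⁻¹ ∈ _
          rw [h.r_mul_m_zero hN, mul_inv_cancel_right]
          exact Subgroup.subset_closure (Or.inr ⟨1, rfl⟩)
        · change π * w * μ * (π * w)⁻¹ ∈ _
          rw [h.r_mul_m_one hN, mul_inv_cancel_right]
          exact Subgroup.subset_closure (Or.inr ⟨0, rfl⟩)

/-- π = r w_1 because w_1 is an involution. This puts T, a power of π, into the group. -/
theorem shift_mem : π ∈ Subgroup.closure (Set.range s ∪ Set.range ![π ^ 2 * w, w] ∪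
    Set.range ![π⁻¹ * μ * π, μ] ∪ {π * w}) := by
  have h1 := mul_mem (Subgroup.subset_closure (Or.inr rfl) : π * w ∈ Subgroup.closure (Set.range s ∪
    Set.range ![π ^ 2 * w, w] ∪ Set.range ![π⁻¹ * μ * π, μ] ∪ {π * w}))
    (Subgroup.subset_closure (Or.inl (Or.inl (Or.inr ⟨1, rfl⟩))) : w ∈ _)
  rwa [mul_assoc π w w, h.w_mul_self, mul_one] at h1

theorem m_mul_map_t : (π⁻¹ * μ * π * μ) (t N) = t N := by
  rw [AlgEquiv.mul_apply, h.inversion.map_t]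
  exact h.m_map_t 0

theorem m_mul_map_b : (π⁻¹ * μ * π * μ) (b N) = b N := by
  rw [AlgEquiv.mul_apply, h.inversion.map_b]
  exact h.m_map_b 0

theorem m_mul_map_a (i : ZMod (2 * N + 1)) : (π⁻¹ * μ * π * μ) (a N i) = a N i := by
  rw [AlgEquiv.mul_apply, h.inversion.map_a]
  exact h.m_map_a 0 i

end IsSystem

end Relations

end QPA4

end

/-! ### The extended affine Weyl group and its q-difference system. -/

theorem theorem1p2 (N : ℕ) (hN : 1 ≤ N) :
    ∃ (s : ZMod (2 * N + 1) → QPA4.Bir N) (w : Fin 2 → QPA4.Bir N) (π r μ : QPA4.Bir N)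
      (m : Fin 2 → QPA4.Bir N),
      -- the birational transformations
      (∀ i : ℕ, 1 ≤ i → i ≤ 2 * N → QPA4.IsS N i (s i)) ∧
      QPA4.IsW1 N (w 1) ∧
      QPA4.IsPi N π ∧
      QPA4.IsMu N μ ∧ (∀ μ' : QPA4.Bir N, QPA4.IsMu N μ' → μ' = μ) ∧
      s 0 = π⁻¹ * s 1 * π ∧
      w 0 = π ^ 2 * w 1 ∧
      r = π * w 1 ∧
      m 0 = π⁻¹ * μ * π ∧
      m 1 = μ ∧
      -- the fundamental relations of the group generated by the `s i`, `w k`, `r`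
      (∀ i, s i ^ 2 = 1) ∧
      (∀ i, (s i * s (i + 1)) ^ 3 = 1) ∧
      (∀ i, (s i * s (i - 1)) ^ 3 = 1) ∧
      (∀ i j, j ≠ i + 1 → j ≠ i - 1 → (s i * s j) ^ 2 = 1) ∧
      (∀ k, w k ^ 2 = 1) ∧
      (∀ n : ℕ, 0 < n → (w 0 * w 1) ^ n ≠ 1) ∧
      (∀ i, w 0 * s i = s (((2 * N + 3 : ℕ) : ZMod (2 * N + 1)) - i) * w 0) ∧
      (∀ i, w 1 * s i = s (((2 * N + 1 : ℕ) : ZMod (2 * N + 1)) - i) * w 1) ∧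
      r ^ 2 = 1 ∧
      (∀ i, r * s i = s (((2 * N + 2 : ℕ) : ZMod (2 * N + 1)) - i) * r) ∧
      r * w 0 = w 1 * r ∧
      r * w 1 = w 0 * r ∧
      -- the fundamental relations involving `μ₀ = m 0` and `μ₁ = m 1`
      (∀ k, m k ^ 2 = 1) ∧
      (∀ n : ℕ, 0 < n → (m 0 * m 1) ^ n ≠ 1) ∧
      (∀ k i, m k * s i = s i * m k) ∧
      (∀ k l, m k * w l = w l * m k) ∧
      r * m 0 = m 1 * r ∧
      r * m 1 = m 0 * r ∧
      -- the structure of the extended affine Weyl group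
      QPA4.IsCoxeterGroup (QPA4.affineA (2 * N + 1)) s ∧
      QPA4.IsCoxeterGroup QPA4.affineA1 w ∧
      QPA4.IsCoxeterGroup QPA4.affineA1 m ∧
      (∃ W W' : Subgroup (QPA4.Bir N),
        QPA4.IsSemidirect (Subgroup.closure (Set.range s)) (Subgroup.closure (Set.range w)) W ∧
        QPA4.IsDirect W (Subgroup.closure (Set.range m)) W' ∧
        QPA4.IsSemidirect W' (Subgroup.closure {r})
          (Subgroup.closure (Set.range s ∪ Set.range w ∪ Set.range m ∪ {r}))) ∧
      r ≠ 1 ∧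
      -- `μ₀ μ₁` shifts `c` and fixes the other parameters
      (m 0 * m 1) (QPA4.c N) = QPA4.eps N ^ 2 * QPA4.c N ∧
      (∀ i, (m 0 * m 1) (QPA4.a N i) = QPA4.a N i) ∧
      (m 0 * m 1) (QPA4.b N) = QPA4.b N ∧
      (m 0 * m 1) (QPA4.q N) = QPA4.q N ∧
      -- the system is the action of an element `T` of the group, with `p = q ^ (-(2N+1))`
      (∃ T ∈ Subgroup.closure (Set.range s ∪ Set.range w ∪ Set.range m ∪ {r}),
        T = (π ^ (2 * N + 1))⁻¹ ∧
        (∀ i, T (QPA4.a N i) = QPA4.a N i) ∧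
        T (QPA4.b N) = (QPA4.q N ^ (2 * N + 1))⁻¹ * QPA4.b N ∧
        T (QPA4.c N) = (QPA4.c N)⁻¹ ∧
        T (QPA4.q N) = QPA4.q N ∧
        QPA4.QPStep N (fun i => QPA4.a N i) (QPA4.b N) (QPA4.c N)
          (QPA4.f N) (fun i => T (QPA4.f N i))) := by
  obtain ⟨s, π, w, μ, h⟩ := QPA4.exists_isSystem hN
  have hμ := h.inversion.isMu hN
  refine ⟨s, ![π ^ 2 * w, w], π, π * w, μ, ![π⁻¹ * μ * π, μ],
    fun i h1 h2 => (h.refl i h1 h2).isS hN, h.flip.isW1, h.shift.isPi hN, hμ,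
    fun μ' hμ' => hμ'.unique hN hμ, h.s_zero, rfl, rfl, rfl, rfl,
    fun i => by rw [pow_two, h.s_mul_self hN], h.s_braid hN, h.s_braid' hN,
    fun i j => h.s_mul_comm hN, h.w_sq hN, fun n => h.w_pow_ne_one hN, fun i => ?_, fun i => ?_,
    h.r_sq hN, fun i => ?_, h.r_mul_w_zero hN, h.r_mul_w_one hN, h.m_sq hN, fun n => h.m_pow_ne_one,
    h.m_mul_s hN, h.m_mul_w hN, h.r_mul_m_zero hN, h.r_mul_m_one hN, h.isCoxeterGroup_s hN,
    QPA4.isCoxeterGroup_affineA1 _ (h.w_sq hN) fun n => h.w_pow_ne_one hN,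
    QPA4.isCoxeterGroup_affineA1 _ (h.m_sq hN) fun n => h.m_pow_ne_one,
    ⟨_, _, h.isSemidirect_s_w hN, h.isDirect_m hN, h.isSemidirect_r hN⟩, h.r_ne_one, h.m_map_c,
    h.m_mul_map_a, h.m_mul_map_b, ?_, (π ^ (2 * N + 1))⁻¹, inv_mem (pow_mem h.shift_mem _), rfl,
    h.shift.inv_map_a, h.shift.inv_map_b, h.shift.inv_map_c, h.shift.inv_map_q, h.shift.qpStep hN⟩
  · rw [show 2 * N + 3 = 2 * N + 1 + 2 by ring, QPA4.natCast_two_mul_add]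
    exact h.w_mul_s' hN i
  · rw [ZMod.natCast_self, zero_sub]
    exact h.w_mul_s hN i
  · rw [show 2 * N + 2 = 2 * N + 1 + 1 by ring, QPA4.natCast_two_mul_add, Nat.cast_one]
    exact h.r_mul_s hN i
  · rw [QPA4.q, map_pow]
    exact congrArg (· ^ (2 * N - 1)) h.m_mul_map_t
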